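/- **Proposition 3.3.** Let $r\ge 0$, let $V=\mathbb C^r$ with standard basis $v_1,\dots,v_r$, and let $\xi=(\xi_1\ge\dots\ge\xi_r\ge0)$ be a partition, $n=|\xi|$, $N=\xi_1$ ($N=0$ if $r=0$). Let $\mathbb C\langle X,Y\rangle$ be the associative algebra with generators $X,Y$ and relation $YX-XY=X$, acting on $\mathbb C[t,t^{-1}]/\mathbb C[t]$ with $X$ acting as multiplication by $t$ and $Y$ as $t\,\partial/\partial t$, and let $\mathfrak a=\mathfrak{gl}_r\otimes\mathbb C\langle X,Y\rangle$ be the Lie algebra with the commutator bracket. Let $V_\xi$ be the $\mathfrak a$-submodule of $\bigwedge^{n}\bigl(V\otimes\mathbb C[t,t^{-1}]/\mathbb C[t]\bigr)$ generated by $$v_\xi=\bigwedge_{i=1}^r\bigwedge_{j=1}^{\xi_i}v_i\otimes t^{-j}.$$ For $k\ge0$ let $V_\xi^{[k]}$ be the $\mathfrak a$-submodule of $V_\xi^{\otimes k}$ generated by $v_\xi^{\otimes k}$ (so $V_\xi^{[0]}=\mathbb C$), and let $V_\xi^{[*]}=\bigoplus_{k\ge0}(V_\xi^{[k]})^*$ be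 the commutative graded algebra whose multiplication is dual to the inclusions $V_\xi^{[k_1+k_2]}\hookrightarrow V_\xi^{[k_1]}\otimes V_\xi^{[k_2]}$. Put $u_{rj-i+1}=v_i\otimes t^{-j}$ for $1\le i\le r$, $1\le j\le N$; these vectors $u_1,\dots,u_{Nr}$ form a basis of the $\mathfrak a$-invariant subspace $U=V\otimes(t^{-N}\mathbb C[t]/\mathbb C[t])$. Let $\eta(\xi)=\{\eta_1<\dots<\eta_n\}$ be the set of the numbers $lr-s$ with $1\le l\le N$, $0\le s<\xi^t_l$, where $\xi^t_l=\#\{i:\xi_i\ge l\}$. Let $\mathrm{Sh}_{\eta(\xi)}$ be the Schubert variety of $n$-dimensional subspaces $P\subset U$ with $\dim(P\cap\langle u_1,\dots,u_{\eta_i}\rangle)\ge i$ for $i=1,\dots,n$, embedded as a reduced closed subvariety in the projective space of lines in $\bigwedge^nU$ by the Plücker embedding, and let $\mathcal O(k)$ be the restriction to it of the line bundle $\mathcal O(k)$ of this projective space. The operators by which $\mathfrak a$ acts on $U$ generate one-parameter subgroups of $GL(U)$ preserving $\mathrm{Sh}_{\eta(\xi)}$; through them $\mathfrak a$ acts on $\Gamma(\mathrm{Sh}_{\eta(\xi)},\mathcal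 O(k))$ by $(a\cdot s)(x)=\frac{d}{dt}\big|_{t=0}s(\exp(-ta)x)$, where sections are regarded as functions on the punctured affine cone. Then for every $k\ge0$ there is an isomorphism of $\mathfrak a$-modules $$V_\xi^{[k]}\cong\Gamma(\mathrm{Sh}_{\eta(\xi)},\mathcal O(k))^*,$$ and there is an isomorphism of schemes over $\mathbb C$ $$\operatorname{Proj}V_\xi^{[*]}\cong\mathrm{Sh}_{\eta(\xi)}.$$ -/

import Mathlib

open scoped TensorProduct LaurentPolynomial DirectSum
open CategoryTheory AlgebraicGeometry

attribute [local instance] LieRing.ofAssociativeRing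

noncomputable section

namespace HigherLevel

section LieGeneralities

variable {K : Type*} [Field K] {W : Type*} [AddCommGroup W] [Module K W]

open Classical in
/-- The operator `1 ⊗ ⋯ ⊗ A ⊗ ⋯ ⊗ 1`, with `A` in the place `i`, on `W^{⊗ι}`. -/
def tensorPlace (ι : Type*) (i : ι) : Module.End K W →ₗ[K] Module.End K (⨂[K] _ : ι, W) :=
  (PiTensorProduct.mapMultilinear K (fun _ : ι => W) (fun _ : ι => W)).toLinearMap
    (fun _ => LinearMap.id) i

theorem tensorPlace_tprod {ι : Type*} [DecidableEq ι] (i : ι) (A : Module.End K W) (v : ι → W) :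
    tensorPlace ι i A (PiTensorProduct.tprod K v) =
      PiTensorProduct.tprod K (Function.update v i (A (v i))) := by
  simp only [tensorPlace, MultilinearMap.toLinearMap_apply, PiTensorProduct.mapMultilinear_apply,
    PiTensorProduct.map_tprod]
  congr 1
  funext j
  rcases eq_or_ne j i with rfl | h
  · simp
  · simp [h]

/-- Lie algebra action on a tensor power, by the Leibniz rule:
`A · (w₁ ⊗ ⋯ ⊗ wₖ) = ∑ᵢ w₁ ⊗ ⋯ ⊗ A wᵢ ⊗ ⋯ ⊗ wₖ`. -/
def tensorDer (ι : Type*) [Fintype ι] :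
    Module.End K W →ₗ⁅K⁆ Module.End K (⨂[K] _ : ι, W) where
  toLinearMap := ∑ i, tensorPlace ι i
  map_lie' := by
    classical
    intro A B
    have hs : ∀ i, tensorPlace ι i (A * B - B * A) =
        tensorPlace ι i A * tensorPlace ι i B - tensorPlace ι i B * tensorPlace ι i A := by
      intro i
      rw [map_sub]
      congr 1 <;>
      · refine PiTensorProduct.ext (MultilinearMap.ext fun v => ?_)
        simp [tensorPlace_tprod]
    have hc : ∀ i j, i ≠ j → tensorPlace ι i A * tensorPlace ι j B =
        tensorPlace ι j B * tensorPlace ι i A := by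
      intro i j h
      refine PiTensorProduct.ext (MultilinearMap.ext fun v => ?_)
      simp [tensorPlace_tprod, h, h.symm, Function.update_comm h]
    simp only [LieRing.of_associative_ring_bracket, AddHom.toFun_eq_coe, LinearMap.coe_toAddHom,
      LinearMap.sum_apply, hs, Finset.sum_sub_distrib]
    rw [Finset.sum_mul_sum, Finset.sum_mul_sum, sub_eq_sub_iff_sub_eq_sub]
    rw [Finset.sum_comm (f := fun i j => tensorPlace ι i B * tensorPlace ι j A)]
    rw [← Finset.sum_sub_distrib, ← Finset.sum_sub_distrib]
    refine Finset.sum_congr rfl fun i _ => ?_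
    rw [sub_eq_sub_iff_sub_eq_sub, ← Finset.sum_sub_distrib]
    rw [Finset.sum_eq_single i (fun j _ h => by rw [hc i j h.symm, sub_self]) (by simp)]

theorem tensorDer_tprod {ι : Type*} [Fintype ι] [DecidableEq ι] (A : Module.End K W) (v : ι → W) :
    tensorDer ι A (PiTensorProduct.tprod K v) =
      ∑ i, PiTensorProduct.tprod K (Function.update v i (A (v i))) := by
  change (∑ i, tensorPlace ι i : Module.End K W →ₗ[K] _) A _ = _
  simp [tensorPlace_tprod]

/-- The projection `W^{⊗n} → ⋀ⁿ W`. -/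
def tensorToExterior (n : ℕ) : (⨂[K] _ : Fin n, W) →ₗ[K] ⋀[K]^n W :=
  PiTensorProduct.lift (exteriorPower.ιMulti K n : W [⋀^Fin n]→ₗ[K] ⋀[K]^n W).toMultilinearMap

theorem tensorToExterior_tprod (n : ℕ) (v : Fin n → W) :
    tensorToExterior n (PiTensorProduct.tprod K v) = exteriorPower.ιMulti K n v := by
  simp [tensorToExterior]

/-- The alternating map `(w₁, …, wₙ) ↦ ∑ᵢ w₁ ∧ ⋯ ∧ A wᵢ ∧ ⋯ ∧ wₙ`. -/
def exteriorDerAux (n : ℕ) (A : Module.End K W) : W [⋀^Fin n]→ₗ[K] ⋀[K]^n W :=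
  { ((tensorToExterior n) ∘ₗ (tensorDer (Fin n) A)).compMultilinearMap
      (PiTensorProduct.tprod K) with
    map_eq_zero_of_eq' := by
      intro v i j hv hij
      simp only [MultilinearMap.toFun_eq_coe,
        LinearMap.compMultilinearMap_apply, LinearMap.comp_apply, tensorDer_tprod, map_sum,
        tensorToExterior_tprod]
      rw [← Finset.add_sum_erase _ _ (Finset.mem_univ i),
        ← Finset.add_sum_erase _ _ (Finset.mem_erase.2 ⟨hij.symm, Finset.mem_univ j⟩),
        Finset.sum_eq_zero, add_zero]
      · have : Function.update v j (A (v j)) =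
            Function.update v i (A (v i)) ∘ Equiv.swap i j := by
          funext l
          rcases eq_or_ne l i with rfl | hi
          · simp [hij, hij.symm, hv]
          · rcases eq_or_ne l j with rfl | hj
            · simp [hv]
            · simp [hi, hj, Equiv.swap_apply_of_ne_of_ne hi hj]
        rw [this, AlternatingMap.map_swap _ _ hij, add_neg_cancel]
      · intro l hl
        simp only [Finset.mem_erase, Finset.mem_univ, and_true] at hl
        refine AlternatingMap.map_eq_zero_of_eq _ _ (i := i) (j := j) ?_ hij
        simp [hl.1.symm, hl.2.symm, hv] }

theorem exteriorDerAux_apply (n : ℕ) (A : Module.End K W) (v : Fin n → W) :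
    exteriorDerAux n A v = ∑ i, exteriorPower.ιMulti K n (Function.update v i (A (v i))) := by
  change tensorToExterior n (tensorDer (Fin n) A (PiTensorProduct.tprod K v)) = _
  simp [tensorDer_tprod, tensorToExterior_tprod]

theorem exteriorDerAux_comp (n : ℕ) (A : Module.End K W) (x : ⨂[K] _ : Fin n, W) :
    exteriorPower.alternatingMapLinearEquiv (exteriorDerAux n A) (tensorToExterior n x) =
      tensorToExterior n (tensorDer (Fin n) A x) := by
  have : (exteriorPower.alternatingMapLinearEquiv (exteriorDerAux n A)) ∘ₗ (tensorToExterior n) =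
      tensorToExterior n ∘ₗ tensorDer (Fin n) A := by
    refine PiTensorProduct.ext (MultilinearMap.ext fun v => ?_)
    simp [tensorDer_tprod, tensorToExterior_tprod, exteriorDerAux_apply]
  exact LinearMap.congr_fun this x

/-- Lie algebra action on an exterior power, by the Leibniz rule:
`A · (w₁ ∧ ⋯ ∧ wₙ) = ∑ᵢ w₁ ∧ ⋯ ∧ A wᵢ ∧ ⋯ ∧ wₙ`. -/
def exteriorDer (n : ℕ) : Module.End K W →ₗ⁅K⁆ Module.End K (⋀[K]^n W) where
  toFun A := exteriorPower.alternatingMapLinearEquiv (exteriorDerAux n A)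
  map_add' A B := by
    refine exteriorPower.linearMap_ext (AlternatingMap.ext fun v => ?_)
    simp [exteriorDerAux_apply, Finset.sum_add_distrib]
  map_smul' c A := by
    refine exteriorPower.linearMap_ext (AlternatingMap.ext fun v => ?_)
    simp [exteriorDerAux_apply, Finset.smul_sum]
  map_lie' := by
    intro A B
    refine exteriorPower.linearMap_ext (AlternatingMap.ext fun v => ?_)
    simp only [LinearMap.compAlternatingMap_apply]
    rw [← tensorToExterior_tprod, exteriorDerAux_comp, LieHom.map_lie]
    simp [LieRing.of_associative_ring_bracket, exteriorDerAux_comp]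

theorem exteriorDer_ιMulti (n : ℕ) (A : Module.End K W) (v : Fin n → W) :
    exteriorDer n A (exteriorPower.ιMulti K n v) =
      ∑ i, exteriorPower.ιMulti K n (Function.update v i (A (v i))) := by
  change exteriorPower.alternatingMapLinearEquiv (exteriorDerAux n A) _ = _
  simp [exteriorDerAux_apply]

variable {L : Type*} [LieRing L] [LieAlgebra K L]

/-- For a representation `ρ` of a Lie algebra `L` on `W`, the `L`-submodule of `W` generated by
the vector `w`. -/
def cyclic (ρ : L →ₗ⁅K⁆ Module.End K W) (w : W) : Submodule K W :=
  sInf {N | w ∈ N ∧ ∀ a : L, ∀ x ∈ N, ρ a x ∈ N}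

theorem mem_cyclic_self (ρ : L →ₗ⁅K⁆ Module.End K W) (w : W) : w ∈ cyclic ρ w :=
  Submodule.mem_sInf.2 fun _ hN => hN.1

theorem map_mem_cyclic (ρ : L →ₗ⁅K⁆ Module.End K W) (w : W) (a : L) {x : W}
    (hx : x ∈ cyclic ρ w) : ρ a x ∈ cyclic ρ w :=
  Submodule.mem_sInf.2 fun N hN => hN.2 a x (Submodule.mem_sInf.1 hx N hN)

theorem cyclic_le (ρ : L →ₗ⁅K⁆ Module.End K W) (w : W) {N : Submodule K W} (hw : w ∈ N)
    (hN : ∀ a : L, ∀ x ∈ N, ρ a x ∈ N) : cyclic ρ w ≤ N :=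
  sInf_le ⟨hw, hN⟩

/-- The action of `L` on the submodule generated by `w`. -/
def cyclicRep (ρ : L →ₗ⁅K⁆ Module.End K W) (w : W) : L →ₗ⁅K⁆ Module.End K (cyclic ρ w) where
  toFun a := (ρ a).restrict fun _ hx => map_mem_cyclic ρ w a hx
  map_add' a b := by ext x; simp [LinearMap.restrict_apply]
  map_smul' c a := by ext x; simp [LinearMap.restrict_apply]
  map_lie' := by
    intro a b
    ext x
    simp [LinearMap.restrict_apply, LieRing.of_associative_ring_bracket]

theorem cyclicRep_coe (ρ : L →ₗ⁅K⁆ Module.End K W) (w : W) (a : L) (x : cyclic ρ w) :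
    (cyclicRep ρ w a x : W) = ρ a x := rfl

/-- The representation of `L` on the tensor power `W^{⊗k}`. -/
def tensorRep (ρ : L →ₗ⁅K⁆ Module.End K W) (k : ℕ) : L →ₗ⁅K⁆ Module.End K (⨂[K]^k W) :=
  (tensorDer (Fin k)).comp ρ

/-- The module `W^{[k]}`: the submodule of `W^{⊗k}` generated by `w^{⊗k}`. -/
def higher (ρ : L →ₗ⁅K⁆ Module.End K W) (w : W) (k : ℕ) : Submodule K (⨂[K]^k W) :=
  cyclic (tensorRep ρ k) (PiTensorProduct.tprod K fun _ => w)

/-- The action of `L` on `W^{[k]}`. -/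
def higherRep (ρ : L →ₗ⁅K⁆ Module.End K W) (w : W) (k : ℕ) :
    L →ₗ⁅K⁆ Module.End K (higher ρ w k) :=
  cyclicRep (tensorRep ρ k) (PiTensorProduct.tprod K fun _ => w)

theorem higherRep_coe (ρ : L →ₗ⁅K⁆ Module.End K W) (w : W) (k : ℕ) (a : L) (x : higher ρ w k) :
    (higherRep ρ w k a x : ⨂[K]^k W) = tensorRep ρ k a x := rfl

end LieGeneralities

section GradedDual

variable {K : Type*} [Field K] {W : Type*} [AddCommGroup W] [Module K W]
variable {L : Type*} [LieRing L] [LieAlgebra K L]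

theorem mulEquiv_tprod {i j : ℕ} (a : Fin i → W) (b : Fin j → W) :
    TensorPower.mulEquiv (PiTensorProduct.tprod K a ⊗ₜ[K] PiTensorProduct.tprod K b) =
      PiTensorProduct.tprod K (Fin.append a b) :=
  TensorPower.tprod_mul_tprod K a b

theorem mulEquiv_symm_tprod {i j : ℕ} (a : Fin (i + j) → W) :
    (TensorPower.mulEquiv (R := K) (M := W) (n := i) (m := j)).symm (PiTensorProduct.tprod K a) =
      PiTensorProduct.tprod K (fun l => a (Fin.castAdd j l)) ⊗ₜ[K]
        PiTensorProduct.tprod K (fun l => a (Fin.natAdd i l)) := by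
  rw [LinearEquiv.symm_apply_eq, mulEquiv_tprod, Fin.append_castAdd_natAdd]

theorem tensorRep_mulEquiv (ρ : L →ₗ⁅K⁆ Module.End K W) {i j : ℕ} (a : L)
    (x : (⨂[K]^i W) ⊗[K] (⨂[K]^j W)) :
    tensorRep ρ (i + j) a (TensorPower.mulEquiv x) =
      TensorPower.mulEquiv ((tensorRep ρ i a).rTensor _ x + (tensorRep ρ j a).lTensor _ x) := by
  have : tensorRep ρ (i + j) a ∘ₗ TensorPower.mulEquiv.toLinearMap =
      TensorPower.mulEquiv.toLinearMap ∘ₗ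
        ((tensorRep ρ i a).rTensor (⨂[K]^j W) + (tensorRep ρ j a).lTensor (⨂[K]^i W)) := by
    refine TensorProduct.ext ?_
    refine PiTensorProduct.ext (MultilinearMap.ext fun u => ?_)
    refine PiTensorProduct.ext (MultilinearMap.ext fun v => ?_)
    simp [tensorRep, mulEquiv_tprod, tensorDer_tprod, Fin.sum_univ_add,
      TensorProduct.sum_tmul, TensorProduct.tmul_sum]
    congr 1
    · refine Finset.sum_congr rfl fun l _ => congrArg _ ?_
      funext m
      refine Fin.addCases (fun m => ?_) (fun m => ?_) m
      · rcases eq_or_ne m l with rfl | h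
        · simp
        · have h' : Fin.castAdd j m ≠ Fin.castAdd j l := fun e => h (Fin.castAdd_injective _ _ e)
          simp [h, h']
      · have h' : Fin.natAdd i m ≠ Fin.castAdd j l := by
          intro e
          have := congrArg Fin.val e
          simp at this
          omega
        simp [h']
    · refine Finset.sum_congr rfl fun l _ => congrArg _ ?_
      funext m
      refine Fin.addCases (fun m => ?_) (fun m => ?_) m
      · have h' : Fin.castAdd j m ≠ Fin.natAdd i l := by
          intro e
          have := congrArg Fin.val e
          simp at this
          omega
        simp [h']
      · rcases eq_or_ne m l with rfl | h
        · simp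
        · have h' : Fin.natAdd i m ≠ Fin.natAdd i l := fun e => h (Fin.natAdd_injective _ _ e)
          simp [h, h']
  exact LinearMap.congr_fun this x

/-- The inclusion `W^{[i]} ⊗ W^{[j]} → W^{⊗(i+j)}`. -/
def higherTensorIncl (ρ : L →ₗ⁅K⁆ Module.End K W) (w : W) (i j : ℕ) :
    higher ρ w i ⊗[K] higher ρ w j →ₗ[K] ⨂[K]^(i + j) W :=
  TensorPower.mulEquiv.toLinearMap ∘ₗ
    TensorProduct.map (higher ρ w i).subtype (higher ρ w j).subtype

theorem higherTensorIncl_injective (ρ : L →ₗ⁅K⁆ Module.End K W) (w : W) (i j : ℕ) :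
    Function.Injective (higherTensorIncl ρ w i j) :=
  TensorPower.mulEquiv.injective.comp
    (TensorProduct.map_injective_of_flat_flat _ _ Subtype.val_injective Subtype.val_injective)

theorem higher_le_range (ρ : L →ₗ⁅K⁆ Module.End K W) (w : W) (i j : ℕ) :
    higher ρ w (i + j) ≤ LinearMap.range (higherTensorIncl ρ w i j) := by
  refine cyclic_le _ _ ?_ ?_
  · refine ⟨⟨_, mem_cyclic_self _ _⟩ ⊗ₜ[K] ⟨_, mem_cyclic_self _ _⟩, ?_⟩
    simp only [higherTensorIncl, LinearMap.comp_apply, TensorProduct.map_tmul,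
      Submodule.subtype_apply, LinearEquiv.coe_coe, mulEquiv_tprod]
    congr 1
    funext l
    refine Fin.addCases (fun l => ?_) (fun l => ?_) l <;> simp
  · rintro a _ ⟨x, rfl⟩
    refine ⟨(higherRep ρ w i a).rTensor _ x + (higherRep ρ w j a).lTensor _ x, ?_⟩
    simp only [higherTensorIncl, LinearMap.comp_apply, LinearEquiv.coe_coe, tensorRep_mulEquiv]
    congr 1
    induction x with
    | zero => simp
    | add x y hx hy => 
      simp only [map_add] at hx hy ⊢
      rw [add_add_add_comm, hx, hy, add_add_add_comm]
    | tmul x y => simp [higherRep_coe]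

/-- The natural inclusion `m_{i,j} : W^{[i+j]} → W^{[i]} ⊗ W^{[j]}` of subspaces of
`W^{⊗(i+j)}`. -/
def comul (ρ : L →ₗ⁅K⁆ Module.End K W) (w : W) (i j : ℕ) :
    higher ρ w (i + j) →ₗ[K] higher ρ w i ⊗[K] higher ρ w j :=
  (LinearEquiv.ofInjective _ (higherTensorIncl_injective ρ w i j)).symm.toLinearMap ∘ₗ
    Submodule.inclusion (higher_le_range ρ w i j)

theorem higherTensorIncl_comul (ρ : L →ₗ⁅K⁆ Module.End K W) (w : W) (i j : ℕ)
    (x : higher ρ w (i + j)) : higherTensorIncl ρ w i j (comul ρ w i j x) = x := by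
  have := (LinearEquiv.ofInjective _ (higherTensorIncl_injective ρ w i j)).apply_symm_apply
    (Submodule.inclusion (higher_le_range ρ w i j) x)
  exact congrArg Subtype.val this

/-- The graded component `(W^{[k]})^*`. -/
abbrev HigherDual (ρ : L →ₗ⁅K⁆ Module.End K W) (w : W) (k : ℕ) : Type _ :=
  Module.Dual K (higher ρ w k)

/-- The product `(W^{[i]})^* ⊗ (W^{[j]})^* → (W^{[i+j]})^*`, dual to `m_{i,j}`. -/
def dualMul (ρ : L →ₗ⁅K⁆ Module.End K W) (w : W) (i j : ℕ) :
    HigherDual ρ w i ⊗[K] HigherDual ρ w j →ₗ[K] HigherDual ρ w (i + j) :=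
  (comul ρ w i j).dualMap ∘ₗ TensorProduct.dualDistrib K (higher ρ w i) (higher ρ w j)

/-- The product of two functionals on tensor powers. -/
def formMul {i j : ℕ} (F : Module.Dual K (⨂[K]^i W)) (G : Module.Dual K (⨂[K]^j W)) :
    Module.Dual K (⨂[K]^(i + j) W) :=
  TensorProduct.dualDistrib K _ _ (F ⊗ₜ[K] G) ∘ₗ TensorPower.mulEquiv.symm.toLinearMap

theorem formMul_tprod {i j : ℕ} (F : Module.Dual K (⨂[K]^i W)) (G : Module.Dual K (⨂[K]^j W))
    (a : Fin (i + j) → W) :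
    formMul F G (PiTensorProduct.tprod K a) =
      F (PiTensorProduct.tprod K fun l => a (Fin.castAdd j l)) *
        G (PiTensorProduct.tprod K fun l => a (Fin.natAdd i l)) := by
  simp [formMul, mulEquiv_symm_tprod]

theorem dualMul_restrict (ρ : L →ₗ⁅K⁆ Module.End K W) (w : W) {i j : ℕ}
    (F : Module.Dual K (⨂[K]^i W)) (G : Module.Dual K (⨂[K]^j W)) :
    dualMul ρ w i j ((F ∘ₗ (higher ρ w i).subtype) ⊗ₜ[K] (G ∘ₗ (higher ρ w j).subtype)) =
      formMul F G ∘ₗ (higher ρ w (i + j)).subtype := by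
  refine LinearMap.ext fun x => ?_
  have h := higherTensorIncl_comul ρ w i j x
  simp only [dualMul, formMul, LinearMap.comp_apply, LinearMap.dualMap_apply,
    Submodule.subtype_apply, ← h]
  simp only [higherTensorIncl, LinearMap.comp_apply, LinearEquiv.coe_coe,
    LinearEquiv.symm_apply_apply]
  generalize comul ρ w i j x = y
  induction y with
  | zero => simp
  | add x y hx hy => simp only [map_add, hx, hy]
  | tmul x y => simp

theorem higherDual_exists_extend (ρ : L →ₗ⁅K⁆ Module.End K W) (w : W) {i : ℕ}
    (f : HigherDual ρ w i) : ∃ F : Module.Dual K (⨂[K]^i W), F ∘ₗ (higher ρ w i).subtype = f :=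
  LinearMap.exists_extend f

theorem higher_reindex (ρ : L →ₗ⁅K⁆ Module.End K W) (w : W) {i j : ℕ} (h : i = j)
    (e : Fin i ≃ Fin j) {x : ⨂[K]^i W} (hx : x ∈ higher ρ w i) :
    PiTensorProduct.reindex K (fun _ => W) e x = TensorPower.cast K W h x := by
  subst h
  have key : ∀ (a : L) (y : ⨂[K]^i W), PiTensorProduct.reindex K (fun _ => W) e
      (tensorRep ρ i a y) = tensorRep ρ i a (PiTensorProduct.reindex K (fun _ => W) e y) := by
    intro a y
    have : (PiTensorProduct.reindex K (fun _ => W) e).toLinearMap ∘ₗ tensorRep ρ i a =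
        tensorRep ρ i a ∘ₗ (PiTensorProduct.reindex K (fun _ => W) e).toLinearMap := by
      refine PiTensorProduct.ext (MultilinearMap.ext fun v => ?_)
      simp [tensorRep, tensorDer_tprod]
      refine Fintype.sum_equiv e _ _ fun l => congrArg _ (funext fun m => ?_)
      rcases eq_or_ne m (e l) with rfl | h
      · simp
      · have h' : e.symm m ≠ l := fun h' => h (by rw [← h', Equiv.apply_symm_apply])
        simp [h, h']
    exact LinearMap.congr_fun this y
  have hle : higher ρ w i ≤ LinearMap.eqLocus
      (PiTensorProduct.reindex K (fun _ => W) e).toLinearMap LinearMap.id := by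
    refine cyclic_le _ _ ?_ ?_
    · simp [LinearMap.mem_eqLocus]
    · intro a y hy
      rw [LinearMap.mem_eqLocus] at hy ⊢
      simp only [LinearEquiv.coe_coe, LinearMap.id_apply] at hy ⊢
      rw [key, hy]
  simpa using hle hx

theorem gradedMonoid_eq (ρ : L →ₗ⁅K⁆ Module.End K W) (w : W) {i j : ℕ} (h : i = j)
    (F : Module.Dual K (⨂[K]^i W)) (G : Module.Dual K (⨂[K]^j W))
    (hFG : ∀ x ∈ higher ρ w i, F x = G (TensorPower.cast K W h x)) :
    (GradedMonoid.mk i (F ∘ₗ (higher ρ w i).subtype) : GradedMonoid (HigherDual ρ w)) =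
      GradedMonoid.mk j (G ∘ₗ (higher ρ w j).subtype) := by
  subst h
  congr 1
  refine LinearMap.ext fun x => ?_
  simpa using hFG x x.2

/-- The functional on `W^{⊗0} = K`. -/
def formOne : Module.Dual K (⨂[K]^0 W) := (PiTensorProduct.isEmptyEquiv (Fin 0)).toLinearMap

theorem formOne_tprod (a : Fin 0 → W) : formOne (PiTensorProduct.tprod K a) = 1 := by
  simp [formOne]

/-- The unit of the algebra, in degree zero, where `W^{[0]} = W^{⊗0} = K`. -/
def dualOne (ρ : L →ₗ⁅K⁆ Module.End K W) (w : W) : HigherDual ρ w 0 :=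
  formOne ∘ₗ (higher ρ w 0).subtype

theorem linearMap_eq_of_tprod {ι : Type*} {F G : Module.Dual K (⨂[K] _ : ι, W)}
    (h : ∀ a : ι → W, F (PiTensorProduct.tprod K a) = G (PiTensorProduct.tprod K a))
    (x : ⨂[K] _ : ι, W) : F x = G x := by
  have : F = G := PiTensorProduct.ext (MultilinearMap.ext h)
  rw [this]

variable (ρ : L →ₗ⁅K⁆ Module.End K W) (w : W)

theorem dualMul_assoc {i j k : ℕ} (f : HigherDual ρ w i) (g : HigherDual ρ w j)
    (h : HigherDual ρ w k) :
    (GradedMonoid.mk _ (dualMul ρ w (i + j) k (dualMul ρ w i j (f ⊗ₜ[K] g) ⊗ₜ[K] h)) :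
        GradedMonoid (HigherDual ρ w)) =
      GradedMonoid.mk _ (dualMul ρ w i (j + k) (f ⊗ₜ[K] dualMul ρ w j k (g ⊗ₜ[K] h))) := by
  obtain ⟨F, rfl⟩ := higherDual_exists_extend ρ w f
  obtain ⟨G, rfl⟩ := higherDual_exists_extend ρ w g
  obtain ⟨H, rfl⟩ := higherDual_exists_extend ρ w h
  simp only [dualMul_restrict]
  refine gradedMonoid_eq ρ w (add_assoc i j k) _ _ fun x _ => ?_
  refine linearMap_eq_of_tprod (G := formMul F (formMul G H) ∘ₗ
    (TensorPower.cast K W (add_assoc i j k)).toLinearMap) (fun a => ?_) x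
  simp only [LinearMap.comp_apply, LinearEquiv.coe_coe, TensorPower.cast_tprod, formMul_tprod,
    mul_assoc]
  congr 3
  refine congrArg _ (funext fun l => ?_)
  simp only [Function.comp_apply]
  congr 1
  ext
  simp [add_assoc]

theorem dualMul_comm {i j : ℕ} (f : HigherDual ρ w i) (g : HigherDual ρ w j) :
    (GradedMonoid.mk _ (dualMul ρ w i j (f ⊗ₜ[K] g)) : GradedMonoid (HigherDual ρ w)) =
      GradedMonoid.mk _ (dualMul ρ w j i (g ⊗ₜ[K] f)) := by
  obtain ⟨F, rfl⟩ := higherDual_exists_extend ρ w f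
  obtain ⟨G, rfl⟩ := higherDual_exists_extend ρ w g
  simp only [dualMul_restrict]
  refine gradedMonoid_eq ρ w (add_comm i j) _ _ fun x hx => ?_
  rw [← higher_reindex ρ w (add_comm i j) finAddFlip hx]
  refine linearMap_eq_of_tprod (G := formMul G F ∘ₗ
    (PiTensorProduct.reindex K (fun _ => W) finAddFlip).toLinearMap) (fun a => ?_) x
  simp only [LinearMap.comp_apply, LinearEquiv.coe_coe, formMul_tprod]
  rw [PiTensorProduct.reindex_tprod, formMul_tprod, mul_comm]
  simp [finAddFlip]

theorem dualOne_mul {i : ℕ} (f : HigherDual ρ w i) :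
    (GradedMonoid.mk _ (dualMul ρ w 0 i (dualOne ρ w ⊗ₜ[K] f)) : GradedMonoid (HigherDual ρ w)) =
      GradedMonoid.mk _ f := by
  obtain ⟨F, rfl⟩ := higherDual_exists_extend ρ w f
  simp only [dualOne, dualMul_restrict]
  refine gradedMonoid_eq ρ w (zero_add i) _ _ fun x _ => ?_
  refine linearMap_eq_of_tprod (G := F ∘ₗ
    (TensorPower.cast K W (zero_add i)).toLinearMap) (fun a => ?_) x
  simp only [LinearMap.comp_apply, LinearEquiv.coe_coe, TensorPower.cast_tprod, formMul_tprod,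
    formOne_tprod, one_mul]
  congr 2
  funext l
  simp only [Function.comp_apply]
  congr 1
  ext
  simp

instance higherDualGOne : GradedMonoid.GOne (HigherDual ρ w) where
  one := dualOne ρ w

instance higherDualGMul : GradedMonoid.GMul (HigherDual ρ w) where
  mul {i j} f g := dualMul ρ w i j (f ⊗ₜ[K] g)

/-- The commutative algebra structure on `W^{[*]} = ⨁ₖ (W^{[k]})^*`. -/
instance higherDualGCommRing : DirectSum.GCommRing (HigherDual ρ w) where
  one_mul a := dualOne_mul ρ w a.2
  mul_one a := (dualMul_comm ρ w a.2 (dualOne ρ w)).trans (dualOne_mul ρ w a.2)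
  mul_assoc a b c := dualMul_assoc ρ w a.2 b.2 c.2
  mul_comm a b := dualMul_comm ρ w a.2 b.2
  mul_zero f := by
    change dualMul ρ w _ _ (f ⊗ₜ[K] 0) = 0
    rw [TensorProduct.tmul_zero, map_zero]
  zero_mul g := by
    change dualMul ρ w _ _ (0 ⊗ₜ[K] g) = 0
    rw [TensorProduct.zero_tmul, map_zero]
  mul_add f g h := by
    change dualMul ρ w _ _ (f ⊗ₜ[K] (g + h)) = dualMul ρ w _ _ _ + dualMul ρ w _ _ _
    rw [TensorProduct.tmul_add, map_add]
  add_mul f g h := by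
    change dualMul ρ w _ _ ((f + g) ⊗ₜ[K] h) = dualMul ρ w _ _ _ + dualMul ρ w _ _ _
    rw [TensorProduct.add_tmul, map_add]
  natCast n := (n : K) • dualOne ρ w
  natCast_zero := by simp
  natCast_succ n := by push_cast; rw [add_smul, one_smul]; rfl
  intCast n := (n : K) • dualOne ρ w
  intCast_ofNat n := by simp
  intCast_negSucc_ofNat n := by
    rw [Int.cast_negSucc]
    exact neg_smul (M := HigherDual ρ w 0) _ _

instance higherDualGAlgebra : DirectSum.GAlgebra K (HigherDual ρ w) where
  toFun := (LinearMap.toSpanSingleton K (HigherDual ρ w 0) (dualOne ρ w)).toAddMonoidHom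
  map_one := one_smul K (dualOne ρ w)
  map_mul r s := by
    have h := dualOne_mul ρ w ((r * s) • dualOne ρ w)
    refine h.symm.trans ?_
    change GradedMonoid.mk _ (dualMul ρ w 0 0 (dualOne ρ w ⊗ₜ[K] ((r * s) • dualOne ρ w))) =
      GradedMonoid.mk _ (dualMul ρ w 0 0 ((r • dualOne ρ w) ⊗ₜ[K] (s • dualOne ρ w)))
    rw [TensorProduct.smul_tmul, smul_smul]
  commutes r x := dualMul_comm ρ w _ x.2
  smul_def r x := by
    refine (dualOne_mul ρ w (r • x.2)).symm.trans ?_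
    change GradedMonoid.mk _ (dualMul ρ w 0 _ (dualOne ρ w ⊗ₜ[K] (r • x.2))) =
      GradedMonoid.mk _ (dualMul ρ w 0 _ ((r • dualOne ρ w) ⊗ₜ[K] x.2))
    rw [TensorProduct.smul_tmul]

/-- The graded commutative algebra `W^{[*]} = ⨁ₖ (W^{[k]})^*`. -/
abbrev HigherAlgebra : Type _ := ⨁ k, HigherDual ρ w k

/-- The degree `k` part `(W^{[k]})^*` of the algebra `W^{[*]}`. -/
def higherGrading (k : ℕ) : Submodule K (HigherAlgebra ρ w) :=
  LinearMap.range (DirectSum.lof K ℕ (HigherDual ρ w) k)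

instance higherGradedAlgebra : GradedAlgebra (R := K) (A := HigherAlgebra ρ w) (higherGrading ρ w) where
  one_mem := ⟨dualOne ρ w, rfl⟩
  mul_mem := by
    rintro i j _ _ ⟨f, rfl⟩ ⟨g, rfl⟩
    exact ⟨dualMul ρ w i j (f ⊗ₜ[K] g), (DirectSum.of_mul_of f g).symm⟩
  toDecomposition := DirectSum.Decomposition.ofLinearMap _
    (DirectSum.lmap fun k => (DirectSum.lof K ℕ (HigherDual ρ w) k).rangeRestrict)
    (by
      refine DirectSum.linearMap_ext _ fun k => LinearMap.ext fun f => ?_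
      refine (congrArg (DirectSum.coeLinearMap (higherGrading ρ w))
        (DirectSum.lmap_lof _ k f)).trans ?_
      exact DirectSum.coeLinearMap_lof (higherGrading ρ w) k _)
    (by
      refine DirectSum.linearMap_ext _ fun k => LinearMap.ext fun f => ?_
      obtain ⟨_, f, rfl⟩ := f
      refine (congrArg (DirectSum.lmap fun k => (DirectSum.lof K ℕ (HigherDual ρ w) k).rangeRestrict)
        (DirectSum.coeLinearMap_lof (higherGrading ρ w) k _)).trans ?_
      exact DirectSum.lmap_lof _ k f)

end GradedDual

section CurrentModule

/-- The relation `YX - XY = X` between the two generators `X` (index `0`) and `Y` (index `1`). -/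
inductive CurrentRel : FreeAlgebra ℂ (Fin 2) → FreeAlgebra ℂ (Fin 2) → Prop
  | rel : CurrentRel
      (FreeAlgebra.ι ℂ 1 * FreeAlgebra.ι ℂ 0 - FreeAlgebra.ι ℂ 0 * FreeAlgebra.ι ℂ 1)
      (FreeAlgebra.ι ℂ 0)

/-- The associative algebra `ℂ⟨X, Y⟩` generated by `X`, `Y` with the relation `YX - XY = X`. -/
abbrev CurrentAlg : Type := RingQuot CurrentRel

/-- The algebra `𝔤𝔩_r ⊗ ℂ⟨X, Y⟩`, regarded as a Lie algebra with the commutator bracket. -/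
abbrev CurrentLie (r : ℕ) : Type := Matrix (Fin r) (Fin r) ℂ ⊗[ℂ] CurrentAlg

/-- The action of `X` on `ℂ[t, t⁻¹]`: multiplication by `t`. -/
def laurentX : Module.End ℂ ℂ[T;T⁻¹] := LinearMap.mulLeft ℂ (LaurentPolynomial.T 1)

/-- The action of `Y` on `ℂ[t, t⁻¹]`: the operator `t ∂/∂t`, that is `tⁿ ↦ n tⁿ`. -/
def laurentY : Module.End ℂ ℂ[T;T⁻¹] :=
  Finsupp.lsum ℂ (fun n : ℤ =>
    (n : ℂ) • LinearMap.toSpanSingleton ℂ ℂ[T;T⁻¹] (LaurentPolynomial.T n)) ∘ₗ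
    (AddMonoidAlgebra.coeffLinearEquiv ℂ).toLinearMap

theorem laurentX_T (n : ℤ) : laurentX (LaurentPolynomial.T n) = LaurentPolynomial.T (n + 1) := by
  rw [laurentX, LinearMap.mulLeft_apply, ← LaurentPolynomial.T_add, add_comm]

theorem laurentY_T (n : ℤ) : laurentY (LaurentPolynomial.T n) = (n : ℂ) • LaurentPolynomial.T n := by
  change (AddMonoidAlgebra.single n (1 : ℂ)).coeff.sum
    (fun (m : ℤ) (c : ℂ) => ((m : ℂ) • LinearMap.toSpanSingleton ℂ ℂ[T;T⁻¹]
      (LaurentPolynomial.T m)) c) = _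
  rw [AddMonoidAlgebra.coeff_single, Finsupp.sum_single_index (by simp)]
  simp

theorem laurent_ext {M : Type*} [AddCommGroup M] [Module ℂ M] {f g : ℂ[T;T⁻¹] →ₗ[ℂ] M}
    (h : ∀ n : ℤ, f (LaurentPolynomial.T n) = g (LaurentPolynomial.T n)) : f = g := by
  refine LinearMap.ext fun p => ?_
  induction p using LaurentPolynomial.induction_on' with
  | add p q hp hq => simp [hp, hq]
  | C_mul_T n a => rw [← LaurentPolynomial.smul_eq_C_mul, map_smul, map_smul, h]

/-- The subspace `ℂ[t] ⊆ ℂ[t, t⁻¹]`. -/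
def laurentRegular : Submodule ℂ ℂ[T;T⁻¹] :=
  LinearMap.range (Polynomial.toLaurentAlg (R := ℂ)).toLinearMap

theorem T_mem_laurentRegular (n : ℕ) : (LaurentPolynomial.T n : ℂ[T;T⁻¹]) ∈ laurentRegular :=
  ⟨Polynomial.X ^ n, by simp⟩

theorem laurentRegular_le {N : Submodule ℂ ℂ[T;T⁻¹]}
    (h : ∀ n : ℕ, (LaurentPolynomial.T n : ℂ[T;T⁻¹]) ∈ N) : laurentRegular ≤ N := by
  rintro _ ⟨p, rfl⟩
  induction p using Polynomial.induction_on' with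
  | add p q hp hq => rw [map_add]; exact N.add_mem hp hq
  | monomial n a =>
    have : (Polynomial.toLaurentAlg (R := ℂ)).toLinearMap (Polynomial.monomial n a) =
        a • (LaurentPolynomial.T n : ℂ[T;T⁻¹]) := by
      rw [← Polynomial.C_mul_X_pow_eq_monomial]
      simp [LaurentPolynomial.smul_eq_C_mul]
    rw [this]
    exact N.smul_mem a (h n)

/-- The space `ℂ[t, t⁻¹] / ℂ[t]`. -/
abbrev LaurentTail : Type := ℂ[T;T⁻¹] ⧸ laurentRegular

/-- The class of `t^{-j}` in `ℂ[t, t⁻¹] / ℂ[t]`. -/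
def tailPow (j : ℕ) : LaurentTail := laurentRegular.mkQ (LaurentPolynomial.T (-(j : ℤ)))

/-- The action of `X` on `ℂ[t, t⁻¹] / ℂ[t]`. -/
def tailX : Module.End ℂ LaurentTail :=
  laurentRegular.mapQ laurentRegular laurentX (laurentRegular_le fun n => by
    rw [Submodule.mem_comap, laurentX_T]
    exact_mod_cast T_mem_laurentRegular (n + 1))

/-- The action of `Y` on `ℂ[t, t⁻¹] / ℂ[t]`. -/
def tailY : Module.End ℂ LaurentTail :=
  laurentRegular.mapQ laurentRegular laurentY (laurentRegular_le fun n => by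
    rw [Submodule.mem_comap, laurentY_T]
    exact Submodule.smul_mem _ _ (T_mem_laurentRegular n))

theorem tail_relation : tailY * tailX - tailX * tailY = tailX := by
  refine Submodule.linearMap_qext _ (laurent_ext fun n => ?_)
  simp only [tailX, tailY, LinearMap.comp_apply, LinearMap.sub_apply, Module.End.mul_apply,
    Submodule.mkQ_apply, Submodule.mapQ_apply, laurentX_T, laurentY_T, map_smul]
  rw [← Submodule.Quotient.mk_sub, ← sub_smul]
  simp

/-- The representation of `ℂ⟨X, Y⟩` in `ℂ[t, t⁻¹] / ℂ[t]`. -/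
def tailRep : CurrentAlg →ₐ[ℂ] Module.End ℂ LaurentTail :=
  RingQuot.liftAlgHom ℂ ⟨FreeAlgebra.lift ℂ ![tailX, tailY], by
    rintro _ _ ⟨⟩
    simpa using tail_relation⟩

/-- The space `V ⊗ ℂ[t, t⁻¹] / ℂ[t]`, where `V = ℂʳ`. -/
abbrev LoopTail (r : ℕ) : Type := (Fin r → ℂ) ⊗[ℂ] LaurentTail

/-- The action of `𝔤𝔩_r ⊗ ℂ⟨X, Y⟩` on `V ⊗ ℂ[t, t⁻¹] / ℂ[t]`. -/
def loopRep (r : ℕ) : CurrentLie r →ₐ[ℂ] Module.End ℂ (LoopTail r) :=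
  (Module.endTensorEndAlgHom (R := ℂ) (S := ℂ) (A := ℂ) (M := Fin r → ℂ) (N := LaurentTail)).comp
    (Algebra.TensorProduct.map (Matrix.toLinAlgEquiv' (R := ℂ) (n := Fin r)).toAlgHom tailRep)

theorem loopRep_tmul (r : ℕ) (M : Matrix (Fin r) (Fin r) ℂ) (z : CurrentAlg) (v : Fin r → ℂ)
    (p : LaurentTail) : loopRep r (M ⊗ₜ[ℂ] z) (v ⊗ₜ[ℂ] p) = M.mulVec v ⊗ₜ[ℂ] tailRep z p := by
  have h : (Algebra.TensorProduct.map (Matrix.toLinAlgEquiv' (R := ℂ) (n := Fin r)).toAlgHom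
      tailRep) (M ⊗ₜ[ℂ] z) = Matrix.toLinAlgEquiv' M ⊗ₜ[ℂ] tailRep z :=
    Algebra.TensorProduct.map_tmul _ _ _ _
  rw [loopRep, AlgHom.comp_apply, h]
  rfl

/-- The space `⋀ⁿ (V ⊗ ℂ[t, t⁻¹] / ℂ[t])`. -/
def Wedge (r n : ℕ) : Type := ⋀[ℂ]^n (LoopTail r)

instance (r n : ℕ) : AddCommGroup (Wedge r n) := inferInstanceAs (AddCommGroup (⋀[ℂ]^n (LoopTail r)))

instance (r n : ℕ) : Module ℂ (Wedge r n) := inferInstanceAs (Module ℂ (⋀[ℂ]^n (LoopTail r)))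

/-- The Lie algebra action of `𝔤𝔩_r ⊗ ℂ⟨X, Y⟩` on `⋀ⁿ (V ⊗ ℂ[t, t⁻¹] / ℂ[t])`. -/
def wedgeRep (r n : ℕ) : CurrentLie r →ₗ⁅ℂ⁆ Module.End ℂ (Wedge r n) :=
  (exteriorDer (K := ℂ) (W := LoopTail r) n).comp (loopRep r).toLieHom

/-- The vector `v_{i+1} ⊗ t^{-j}`, where `v_1, …, v_r` is the standard basis of `V`. -/
def loopVec {r : ℕ} (i : Fin r) (j : ℕ) : LoopTail r := Pi.single i 1 ⊗ₜ[ℂ] tailPow j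

/-- The vector `v_ξ`: the wedge product over `i = 1, …, r` and `j = 1, …, ξ_i` (in the
lexicographic order) of `v_i ⊗ t^{-j}`. -/
def wedgeVec {r : ℕ} (ξ : Fin r → ℕ) : Wedge r (∑ i, ξ i) :=
  exteriorPower.ιMulti ℂ (∑ i, ξ i) fun q =>
    loopVec (finSigmaFinEquiv.symm q).1 ((finSigmaFinEquiv.symm q).2 + 1)

/-- The module `V_ξ`, generated by `v_ξ`. -/
def VMod {r : ℕ} (ξ : Fin r → ℕ) : Submodule ℂ (Wedge r (∑ i, ξ i)) :=
  cyclic (wedgeRep r (∑ i, ξ i)) (wedgeVec ξ)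

/-- The action of `𝔤𝔩_r ⊗ ℂ⟨X, Y⟩` on `V_ξ`. -/
def VRep {r : ℕ} (ξ : Fin r → ℕ) : CurrentLie r →ₗ⁅ℂ⁆ Module.End ℂ (VMod ξ) :=
  cyclicRep (wedgeRep r (∑ i, ξ i)) (wedgeVec ξ)

/-- The cyclic vector `v_ξ` of `V_ξ`. -/
def VGen {r : ℕ} (ξ : Fin r → ℕ) : VMod ξ := ⟨wedgeVec ξ, mem_cyclic_self _ _⟩

/-- The module `V_ξ^{[k]}`. -/
abbrev VHigher {r : ℕ} (ξ : Fin r → ℕ) (k : ℕ) :=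
  higher (VRep ξ) (VGen ξ) k

/-- The action of `𝔤𝔩_r ⊗ ℂ⟨X, Y⟩` on `V_ξ^{[k]}`. -/
abbrev VHigherRep {r : ℕ} (ξ : Fin r → ℕ) (k : ℕ) :=
  higherRep (VRep ξ) (VGen ξ) k

/-- The basis vector `u_{q+1}` of `U = V ⊗ (t^{-N} ℂ[t] / ℂ[t])`, for the enumeration
`u_{rj - i + 1} = v_i ⊗ t^{-j}`, `1 ≤ i ≤ r`, `1 ≤ j ≤ N`. -/
def uVec {N r : ℕ} (q : Fin (N * r)) : LoopTail r :=
  loopVec (finProdFinEquiv.symm q).2.rev ((finProdFinEquiv.symm q).1 + 1)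

/-- The coefficient of `t^{-j}` for `j ≥ 1`, as a functional on `ℂ[t, t⁻¹] / ℂ[t]`
(zero for `j = 0`). -/
def tailCoeff (j : ℕ) : LaurentTail →ₗ[ℂ] ℂ :=
  if h : 1 ≤ j then
    laurentRegular.liftQ
      (Finsupp.lapply (-(j : ℤ)) ∘ₗ (AddMonoidAlgebra.coeffLinearEquiv ℂ).toLinearMap)
      (laurentRegular_le fun n => by
        have : (n : ℤ) ≠ -(j : ℤ) := by omega
        change (AddMonoidAlgebra.single (n : ℤ) (1 : ℂ)).coeff (-(j : ℤ)) = 0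
        rw [AddMonoidAlgebra.coeff_single, Finsupp.single_apply, if_neg this])
  else 0

/-- The coordinate at `u_{q+1}`, as a functional on `V ⊗ ℂ[t, t⁻¹] / ℂ[t]`. -/
def uCoord {N r : ℕ} (q : Fin (N * r)) : LoopTail r →ₗ[ℂ] ℂ :=
  LinearMap.mul' ℂ ℂ ∘ₗ TensorProduct.map (LinearMap.proj (finProdFinEquiv.symm q).2.rev)
    (tailCoeff ((finProdFinEquiv.symm q).1 + 1))

theorem tailCoeff_tailPow (j l : ℕ) (hj : 1 ≤ j) :
    tailCoeff j (tailPow l) = if l = j then 1 else 0 := by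
  simp only [tailCoeff, hj, dif_pos, tailPow, Submodule.mkQ_apply, Submodule.liftQ_apply]
  change (AddMonoidAlgebra.single (-(l : ℤ)) (1 : ℂ)).coeff (-(j : ℤ)) = _
  rw [AddMonoidAlgebra.coeff_single, Finsupp.single_apply]
  simp

theorem uCoord_uVec {N r : ℕ} (p q : Fin (N * r)) :
    uCoord p (uVec q) = if p = q then 1 else 0 := by
  simp only [uCoord, uVec, loopVec, LinearMap.comp_apply, TensorProduct.map_tmul,
    LinearMap.mul'_apply, LinearMap.proj_apply, tailCoeff_tailPow _ _ (Nat.le_add_left 1 _)]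
  obtain ⟨⟨a, b⟩, rfl⟩ := finProdFinEquiv.surjective p
  obtain ⟨⟨c, d⟩, rfl⟩ := finProdFinEquiv.surjective q
  simp only [Equiv.symm_apply_apply, EmbeddingLike.apply_eq_iff_eq, Prod.mk.injEq,
    Pi.single_apply, Fin.rev_inj, Nat.add_right_cancel_iff, Fin.val_inj]
  by_cases h1 : a = c <;> by_cases h2 : b = d <;> simp [h1, h2, eq_comm]

/-- The matrix, in the basis `u_1, …, u_{Nr}`, of the action of an element of
`𝔤𝔩_r ⊗ ℂ⟨X, Y⟩` on the invariant subspace `U = V ⊗ (t^{-N} ℂ[t] / ℂ[t])`. -/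
def uMatrix {r : ℕ} (N : ℕ) (a : CurrentLie r) : Matrix (Fin (N * r)) (Fin (N * r)) ℂ :=
  Matrix.of fun p q => uCoord p (loopRep r a (uVec q))

end CurrentModule

section Schubert

attribute [local instance] MvPolynomial.gradedAlgebra

/-- The index set of the Plücker coordinates of `n`-dimensional planes in `ℂᵐ`. -/
abbrev PluckerIndex (m n : ℕ) : Type := {I : Finset (Fin m) // I.card = n}

/-- The elements of `I`, in the increasing order. -/
def PluckerIndex.emb {m n : ℕ} (I : PluckerIndex m n) : Fin n → Fin m := I.1.orderEmbOfFin I.2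

/-- The coordinates of `a₁ ∧ ⋯ ∧ aₙ` in the basis `e_{i₁} ∧ ⋯ ∧ e_{iₙ}`, `i₁ < ⋯ < iₙ`, of
`⋀ⁿ ℂᵐ`. -/
def plucker {m n : ℕ} (a : Fin n → Fin m → ℂ) : PluckerIndex m n → ℂ :=
  fun I => Matrix.det (Matrix.of fun i j => a i (I.emb j))

/-- The operator `⋀ⁿ g` on `⋀ⁿ ℂᵐ`, in the coordinates given by the basis `e_{i₁} ∧ ⋯ ∧ e_{iₙ}`. -/
def compound {m n : ℕ} (g : Matrix (Fin m) (Fin m) ℂ) (x : PluckerIndex m n → ℂ) :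
    PluckerIndex m n → ℂ :=
  fun I => ∑ J, (g.submatrix I.emb J.emb).det * x J

/-- The member `⟨e_1, …, e_d⟩` of the standard flag in `ℂᵐ`. -/
def flag (m d : ℕ) : Submodule ℂ (Fin m → ℂ) :=
  Submodule.span ℂ ((fun q : Fin m => Pi.single q (1 : ℂ)) '' {q | (q : ℕ) < d})

/-- The Schubert variety `Sh_η` for `η = {η_1 < ⋯ < η_n}`, as a set of planes: it consists of the
`n`-dimensional subspaces of `ℂᵐ` whose intersection with `⟨e_1, …, e_{η_i}⟩` has dimension at
least `i` for all `i = 1, …, n`. For `d = η_i` one has `i = #{e ∈ η | e ≤ d}`. -/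
def schubertPlanes (m : ℕ) (η : Finset ℕ) : Set (Submodule ℂ (Fin m → ℂ)) :=
  {P | Module.finrank ℂ P = η.card ∧
    ∀ d ∈ η, (η.filter (· ≤ d)).card ≤ Module.finrank ℂ ↥(P ⊓ flag m d)}

/-- The punctured affine cone over the Schubert variety in its Plücker embedding: all nonzero
multiples of the Plücker vectors of bases of the planes of the Schubert variety. -/
def schubertCone (m : ℕ) (η : Finset ℕ) : Set (PluckerIndex m η.card → ℂ) :=
  {x | ∃ c : ℂ, c ≠ 0 ∧ ∃ a : Fin η.card → Fin m → ℂ,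
    Submodule.span ℂ (Set.range a) ∈ schubertPlanes m η ∧ x = c • plucker a}

/-- The space of global sections of `𝒪(k)` on the projective variety with punctured affine cone
`X`: the functions on `X` which are, locally in the Zariski topology, quotients `p / q` of
homogeneous polynomials with `deg p - deg q = k`. -/
def sections {σ : Type} (X : Set (σ → ℂ)) (k : ℕ) : Submodule ℂ (X → ℂ) where
  carrier := {f | ∀ x : X, ∃ (d : ℕ) (p q : MvPolynomial σ ℂ),
    p.IsHomogeneous (d + k) ∧ q.IsHomogeneous d ∧ MvPolynomial.eval x.1 q ≠ 0 ∧
      ∀ y : X, MvPolynomial.eval y.1 q ≠ 0 →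
        f y = MvPolynomial.eval y.1 p / MvPolynomial.eval y.1 q}
  zero_mem' := fun x => ⟨0, 0, 1, MvPolynomial.isHomogeneous_zero _ _ _,
    MvPolynomial.isHomogeneous_one _ _, by simp, by simp⟩
  add_mem' := by
    intro f g hf hg x
    obtain ⟨d, p, q, hp, hq, hx, h⟩ := hf x
    obtain ⟨d', p', q', hp', hq', hx', h'⟩ := hg x
    refine ⟨d + d', p * q' + q * p', q * q', ?_, hq.mul hq', by simp [hx, hx'], ?_⟩
    · refine MvPolynomial.IsHomogeneous.add ?_ ?_
      · convert hp.mul hq' using 1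
        ring
      · convert hq.mul hp' using 1
        ring
    · intro y hy
      rw [map_mul] at hy
      rw [Pi.add_apply, h y (left_ne_zero_of_mul hy), h' y (right_ne_zero_of_mul hy),
        div_add_div _ _ (left_ne_zero_of_mul hy) (right_ne_zero_of_mul hy)]
      simp
  smul_mem' := by
    intro c f hf x
    obtain ⟨d, p, q, hp, hq, hx, h⟩ := hf x
    refine ⟨d, MvPolynomial.C c * p, q, ?_, hq, hx, ?_⟩
    · simpa using (MvPolynomial.isHomogeneous_C σ c).mul hp
    · intro y hy
      rw [Pi.smul_apply, h y hy, smul_eq_mul, map_mul, MvPolynomial.eval_C, mul_div_assoc]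

/-- For functions `s`, `s'` on the cone `X ⊆ ⋀ⁿ ℂᵐ` over a variety which is invariant under the
one-parameter group `exp (t A)`: the function `s'` is the result of the action of the Lie algebra
element `A` on `s`, that is `s'(x) = d/dt s(exp(-t A) x)` at `t = 0`. -/
def IsLieAction {m n : ℕ} {X : Set (PluckerIndex m n → ℂ)} (A : Matrix (Fin m) (Fin m) ℂ)
    (s s' : X → ℂ) : Prop :=
  ∀ x : X, (∀ t : ℂ, compound (NormedSpace.exp (-(t • A))) x.1 ∈ X) ∧
    HasDerivAt (fun t : ℂ => Function.extend Subtype.val s 0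
      (compound (NormedSpace.exp (-(t • A))) x.1)) (s' x) 0

/-- The projective spectrum of a graded `ℂ`-algebra, as a scheme over `ℂ`. -/
def projOver {A : Type} [CommRing A] [Algebra ℂ A] (𝒜 : ℕ → Submodule ℂ A) [GradedAlgebra 𝒜] :
    Over (Spec (CommRingCat.of ℂ)) :=
  Over.mk (Proj.toSpecZero 𝒜 ≫ Spec.map (CommRingCat.ofHom (algebraMap ℂ (𝒜 0))))

/-- The closed subset of a projective space defined by the polynomials that vanish on the
punctured affine cone `X`. -/
def coneClosed {σ : Type} (X : Set (σ → ℂ)) :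
    TopologicalSpace.Closeds (Proj (MvPolynomial.homogeneousSubmodule σ ℂ)) where
  carrier := ProjectiveSpectrum.zeroLocus (MvPolynomial.homogeneousSubmodule σ ℂ)
    {p | ∀ x ∈ X, MvPolynomial.eval x p = 0}
  isClosed' := ProjectiveSpectrum.isClosed_zeroLocus _ _

/-- The projective variety with punctured affine cone `X`, as a scheme over `ℂ`: the corresponding
closed subset of the projective space with its reduced scheme structure. -/
def projVariety {σ : Type} (X : Set (σ → ℂ)) : Over (Spec (CommRingCat.of ℂ)) :=
  Over.mk ((Scheme.IdealSheafData.vanishingIdeal (coneClosed X)).subschemeι ≫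
    (projOver (MvPolynomial.homogeneousSubmodule σ ℂ)).hom)

/-- The set `η(ξ)` of the numbers `l r - s`, `l = 1, 2, …`, `0 ≤ s < ξᵗ_l`, where
`ξᵗ_l = #{i | ξ_i ≥ l}` is the transposed partition. -/
def eta {r : ℕ} (ξ : Fin r → ℕ) : Finset ℕ :=
  (Finset.Icc 1 (Finset.univ.sup ξ)).biUnion fun l =>
    (Finset.range (Finset.univ.filter fun i => l ≤ ξ i).card).image fun s => l * r - s

/-- The punctured affine cone over the Schubert variety `Sh_{η(ξ)}` of planes in
`U = ⟨u_1, …, u_{Nr}⟩`, where `N = ξ_1` is the largest part of `ξ`. -/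
abbrev etaCone {r : ℕ} (ξ : Fin r → ℕ) :
    Set (PluckerIndex (Finset.univ.sup ξ * r) (eta ξ).card → ℂ) :=
  schubertCone (Finset.univ.sup ξ * r) (eta ξ)

end Schubert

end HigherLevel

end

/-!
The highest vector of the Schubert variety `Sh_η`, `η = η(ξ)`, is the wedge product of the basis
vectors `u_e`, `e ∈ η`, and this is `v_ξ` up to sign (`exists_wedgeVec_eq`). Two properties of the
action of the current algebra on `U` matter. First, every subspace `⟨u_1, …, u_{lr}⟩` is invariant,
and these subspaces suffice to preserve the Schubert variety, because the elements of `η` between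
`(l - 1) r` and `lr` are consecutive and end at `lr` (`compound_exp_mem_etaCone`). Secondly, all
strictly triangular matrices act, since `X` shifts the powers of `t` and interpolation polynomials
in `Y` are projections to single powers of `t` (`exists_uMatrix_transvection`). The structure
`SchubertModel` records exactly this, and the rest of the argument uses nothing else.

Let `W` be the cyclic module generated by the highest vector. The module `W^{[k]}` is the span of
the `k`-th powers of the points of the cone over the Schubert variety (`span_point`). On the one
hand, a dense part of the cone is reached from the highest vector by changing one row of a matrix in
echelon form at a time; each change is the exponential of a nilpotent transvection, and acts on the
tensor power by a polynomial in that transvection, so that the powers lie in `W^{[k]}`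
(`echelonCone_induction`, `tprod_add_mem`, `tprod_kappa_mem`). On the other hand, the span is a
submodule, because a functional that vanishes on the cone has zero derivative along the orbits of
the one-parameter groups. Hence the dual of `W^{[k]}` is the space of those functions on the cone
which are restrictions of homogeneous polynomials of degree `k`, and the algebra `W^{[*]}` is the
homogeneous coordinate ring of the Schubert variety.

It remains to see that all sections of `𝒪(k)` are restrictions of polynomials
(`mem_sections_iff`). By the Nullstellensatz, a section becomes polynomial after multiplication by
a power of the highest Plücker coordinate `p_τ` (`exists_pow_mul_section`); here one uses that the
cone is closed in the chart `p_τ ≠ 0`. The factors `p_τ` are then cancelled one by one, which is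
possible since a polynomial that vanishes where `p_τ = 0` is divisible by `p_τ` on the Schubert
variety (`exists_factor`). This follows from standard monomial theory: the Plücker relations rewrite
every polynomial in terms of standard monomials (`exists_standard`), and those standard monomials
which do not vanish on a Schubert variety are linearly independent on it (`standard_independent`).

Finally, the surjection from the polynomial ring to `W^{[*]}` is a closed immersion of projective
spectra. As `W^{[*]}` is reduced, it identifies `Proj W^{[*]}` with the zero locus of the kernel
with its reduced structure, which is the Schubert variety (`nonempty_projOver_iso`).
-/

noncomputable section

namespace HigherLevel

/-! ### Plücker coordinates and alternating maps -/

section Pluecker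

variable {m n : ℕ}

theorem PluckerIndex.emb_strictMono (I : PluckerIndex m n) : StrictMono I.emb :=
  (I.1.orderEmbOfFin I.2).strictMono

theorem PluckerIndex.emb_injective (I : PluckerIndex m n) : Function.Injective I.emb :=
  I.emb_strictMono.injective

theorem PluckerIndex.mem_iff (I : PluckerIndex m n) (q : Fin m) : q ∈ I.1 ↔ ∃ i, I.emb i = q := by
  have := Finset.range_orderEmbOfFin I.1 I.2
  rw [← Finset.mem_coe, ← this]
  rfl

theorem PluckerIndex.ext_emb {I J : PluckerIndex m n} (h : I.emb = J.emb) : I = J := by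
  refine Subtype.ext (Finset.ext fun q => ?_)
  rw [I.mem_iff, J.mem_iff, h]

theorem exists_emb_comp_perm (f : Fin n → Fin m) (hf : Function.Injective f) :
    ∃ (I : PluckerIndex m n) (σ : Equiv.Perm (Fin n)), f = I.emb ∘ σ := by
  classical
  let I : PluckerIndex m n := ⟨Finset.univ.image f, by
    rw [Finset.card_image_of_injective _ hf, Finset.card_univ, Fintype.card_fin]⟩
  have h : ∀ i, ∃ j, I.emb j = f i := fun i =>
    (I.mem_iff _).1 (Finset.mem_image_of_mem f (Finset.mem_univ i))
  choose g hg using h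
  have hgi : Function.Injective g := fun i j hij => hf (by rw [← hg i, ← hg j, hij])
  exact ⟨I, Equiv.ofBijective g (Finite.injective_iff_bijective.1 hgi),
    funext fun i => (hg i).symm⟩

/-- A Plücker coordinate as an alternating form. -/
def pluckerForm (I : PluckerIndex m n) : (Fin m → ℂ) [⋀^Fin n]→ₗ[ℂ] ℂ :=
  Matrix.detRowAlternating.compLinearMap (LinearMap.funLeft ℂ ℂ I.emb)

theorem pluckerForm_apply (I : PluckerIndex m n) (a : Fin n → Fin m → ℂ) :
    pluckerForm I a = plucker a I := rfl

theorem plucker_single (I J : PluckerIndex m n) :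
    plucker (fun i => Pi.single (J.emb i) 1) I = if I = J then 1 else 0 := by
  classical
  split_ifs with h
  · subst h
    have : (Matrix.of fun i j => (Pi.single (I.emb i) 1 : Fin m → ℂ) (I.emb j)) = 1 := by
      ext i j
      simp [Matrix.one_apply, Pi.single_apply, I.emb_injective.eq_iff, eq_comm]
    rw [plucker, this, Matrix.det_one]
  · have : ∃ q ∈ J.1, q ∉ I.1 := by
      by_contra! hc
      exact h (Subtype.ext (Finset.eq_of_subset_of_card_le hc (by rw [I.2, J.2])).symm)
    obtain ⟨q, hq, hq'⟩ := this
    obtain ⟨i, rfl⟩ := (J.mem_iff q).1 hq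
    refine Matrix.det_eq_zero_of_row_eq_zero i fun j => ?_
    have : I.emb j ≠ J.emb i := fun h => hq' ((I.mem_iff _).2 ⟨j, h⟩)
    simp [this]

/-- An alternating map on `ℂᵐ` factors through the Plücker coordinates. The Cauchy–Binet formula
and the identification of Plücker vectors with decomposable multivectors are instances of this. -/
theorem alternating_eq_sum_plucker {M : Type*} [AddCommGroup M] [Module ℂ M]
    (g : (Fin m → ℂ) [⋀^Fin n]→ₗ[ℂ] M) (a : Fin n → Fin m → ℂ) :
    g a = ∑ I, plucker a I • g fun i => Pi.single (I.emb i) 1 := by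
  classical
  let h : (Fin m → ℂ) [⋀^Fin n]→ₗ[ℂ] M := ∑ I : PluckerIndex m n,
    (LinearMap.toSpanSingleton ℂ M (g fun i => Pi.single (I.emb i) 1)).compAlternatingMap
      (pluckerForm I)
  have hh : ∀ a, h a = ∑ I, plucker a I • g fun i => Pi.single (I.emb i) 1 := fun a => by
    have : ∀ s : Finset (PluckerIndex m n), (∑ I ∈ s,
        (LinearMap.toSpanSingleton ℂ M (g fun i => Pi.single (I.emb i) 1)).compAlternatingMap
          (pluckerForm I)) a = ∑ I ∈ s, plucker a I • g fun i => Pi.single (I.emb i) 1 := fun s => by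
      induction s using Finset.induction_on with
      | empty => simp
      | insert I s hI ih =>
        rw [Finset.sum_insert hI, Finset.sum_insert hI, AlternatingMap.add_apply, ih]
        rfl
    exact this Finset.univ
  rw [← hh]
  refine DFunLike.congr_fun (Module.Basis.ext_alternating (Pi.basisFun ℂ (Fin m)) fun v hv => ?_) a
  obtain ⟨J, σ, rfl⟩ := exists_emb_comp_perm v hv
  change g ((fun i => Pi.basisFun ℂ (Fin m) (J.emb i)) ∘ σ) =
    h ((fun i => Pi.basisFun ℂ (Fin m) (J.emb i)) ∘ σ)
  rw [AlternatingMap.map_perm, AlternatingMap.map_perm, hh]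
  simp [plucker_single]

/-- The Cauchy–Binet formula: `⋀ⁿ g` maps `a₁ ∧ ⋯ ∧ aₙ` to `g a₁ ∧ ⋯ ∧ g aₙ`. -/
theorem compound_plucker (g : Matrix (Fin m) (Fin m) ℂ) (a : Fin n → Fin m → ℂ) :
    compound g (plucker a) = plucker fun i => g.mulVec (a i) := by
  funext I
  have := alternating_eq_sum_plucker ((pluckerForm I).compLinearMap g.mulVecLin) a
  simp only [AlternatingMap.compLinearMap_apply, pluckerForm_apply, Matrix.mulVecLin_apply,
    smul_eq_mul] at this
  rw [this, compound]
  refine Finset.sum_congr rfl fun J _ => ?_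
  rw [mul_comm]
  congr 1
  rw [plucker, ← Matrix.det_transpose]
  congr 1
  ext i j
  simp

theorem compound_smul (g : Matrix (Fin m) (Fin m) ℂ) (c : ℂ) (x : PluckerIndex m n → ℂ) :
    compound g (c • x) = c • compound g x := by
  funext I
  simp only [compound, Pi.smul_apply, smul_eq_mul, Finset.mul_sum]
  exact Finset.sum_congr rfl fun J _ => by ring

/-! ### Straightening -/

/-- The sum of the elements of an index of a Plücker coordinate. -/
def PluckerIndex.weight (I : PluckerIndex m n) : ℕ := ∑ i, (I.emb i : ℕ)

/-- The Bruhat order on the indices of the Plücker coordinates: comparison of the entries of the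
increasing sequences. (The order `≤` on this type is the inclusion of sets.) -/
def PluckerIndex.Below (I J : PluckerIndex m n) : Prop := ∀ i, I.emb i ≤ J.emb i

theorem PluckerIndex.Below.refl (I : PluckerIndex m n) : I.Below I := fun _ => le_rfl

theorem PluckerIndex.Below.antisymm {I J : PluckerIndex m n} (h : I.Below J) (h' : J.Below I) :
    I = J := PluckerIndex.ext_emb (funext fun i => le_antisymm (h i) (h' i))

/-- The minor with columns `f 1, …, f n`. -/
def columnMinor (f : Fin n → Fin m) (a : Fin n → Fin m → ℂ) : ℂ :=
  Matrix.det (Matrix.of fun i j => a i (f j))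

theorem columnMinor_emb (I : PluckerIndex m n) (a : Fin n → Fin m → ℂ) :
    columnMinor I.emb a = plucker a I := rfl

theorem columnMinor_comp_perm (f : Fin n → Fin m) (σ : Equiv.Perm (Fin n))
    (a : Fin n → Fin m → ℂ) :
    columnMinor (f ∘ σ) a = (Equiv.Perm.sign σ : ℤ) * columnMinor f a :=
  Matrix.det_permute' σ (Matrix.of fun i j => a i (f j))

/-- A minor is zero, or it is a Plücker coordinate up to sign. -/
theorem columnMinor_cases (f : Fin n → Fin m) :
    (∀ a, columnMinor f a = 0) ∨ ∃ (I : PluckerIndex m n) (σ : Equiv.Perm (Fin n)),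
      f = I.emb ∘ σ ∧ I.weight = ∑ i, (f i : ℕ) ∧
      ∀ a, columnMinor f a = (Equiv.Perm.sign σ : ℤ) * plucker a I := by
  by_cases hf : Function.Injective f
  · obtain ⟨I, σ, rfl⟩ := exists_emb_comp_perm f hf
    refine Or.inr ⟨I, σ, rfl, ?_, fun a => columnMinor_comp_perm _ _ _⟩
    exact (Equiv.sum_comp σ fun i => (I.emb i : ℕ)).symm
  · left
    intro a
    simp only [Function.Injective, not_forall] at hf
    obtain ⟨i, j, hij, hne⟩ := hf
    exact Matrix.det_zero_of_column_eq hne fun k => by simp [hij]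

end Pluecker

section Exchange

variable {m n : ℕ}

/-- The columns `I_i`, `i ≥ s`, and `J_j`, `j ≤ s`: altogether `n + 1` of them. -/
def exchangeColumn (I J : PluckerIndex m n) (s : Fin n) :
    {i : Fin n // s ≤ i} ⊕ {j : Fin n // j ≤ s} → Fin m :=
  Sum.elim (fun i => I.emb i) fun j => J.emb j

/-- The sequence `I` after a permutation of the `n + 1` columns of `exchangeColumn`. -/
def exchangeLeft (I J : PluckerIndex m n) (s : Fin n)
    (σ : Equiv.Perm ({i : Fin n // s ≤ i} ⊕ {j : Fin n // j ≤ s})) : Fin n → Fin m :=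
  fun i => if h : s ≤ i then exchangeColumn I J s (σ (Sum.inl ⟨i, h⟩)) else I.emb i

/-- The sequence `J` after a permutation of the `n + 1` columns of `exchangeColumn`. -/
def exchangeRight (I J : PluckerIndex m n) (s : Fin n)
    (σ : Equiv.Perm ({i : Fin n // s ≤ i} ⊕ {j : Fin n // j ≤ s})) : Fin n → Fin m :=
  fun j => if h : j ≤ s then exchangeColumn I J s (σ (Sum.inr ⟨j, h⟩)) else J.emb j

theorem card_exchange (s : Fin n) :
    Fintype.card ({i : Fin n // s ≤ i} ⊕ {j : Fin n // j ≤ s}) = n + 1 := by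
  have h1 : Fintype.card {i : Fin n // s ≤ i} = n - s := by
    rw [Fintype.card_subtype]
    have : (Finset.univ.filter fun i : Fin n => s ≤ i) = Finset.Ici s := by ext; simp
    rw [this, Fin.card_Ici]
  have h2 : Fintype.card {j : Fin n // j ≤ s} = s + 1 := by
    rw [Fintype.card_subtype]
    have : (Finset.univ.filter fun i : Fin n => i ≤ s) = Finset.Iic s := by ext; simp
    rw [this, Fin.card_Iic]
  rw [Fintype.card_sum, h1, h2]
  omega

/-- The Plücker relation: the alternating sum over the permutations of `n + 1` columns, which is an
alternating function of `n + 1` vectors in `ℂⁿ`, vanishes. -/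
theorem exchange_sum (I J : PluckerIndex m n) (s : Fin n) (a : Fin n → Fin m → ℂ) :
    ∑ σ, ((Equiv.Perm.sign σ : ℤ) : ℂ) *
      (columnMinor (exchangeLeft I J s σ) a * columnMinor (exchangeRight I J s σ) a) = 0 := by
  classical
  let D : MultilinearMap ℂ (fun _ : Fin n => Fin n → ℂ) ℂ :=
    (Matrix.detRowAlternating : (Fin n → ℂ) [⋀^Fin n]→ₗ[ℂ] ℂ).toMultilinearMap
  let col : Fin m → Fin n → ℂ := fun q i => a i q
  have hD : ∀ f : Fin n → Fin m, D (fun i => col (f i)) = columnMinor f a := fun f => by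
    rw [columnMinor, ← Matrix.det_transpose]
    rfl
  let M := (LinearMap.mul' ℂ ℂ).compMultilinearMap
    ((D.domDomRestrict (s ≤ ·) fun i => col (I.emb i)).domCoprod
      (D.domDomRestrict (· ≤ s) fun j => col (J.emb j)))
  have h0 := (MultilinearMap.alternatization M).map_linearDependent
    (fun x => col (exchangeColumn I J s x)) fun h => by
      have := h.fintype_card_le_finrank
      rw [card_exchange, Module.finrank_fin_fun] at this
      omega
  rw [MultilinearMap.alternatization_apply] at h0
  rw [← h0]
  refine Finset.sum_congr rfl fun σ _ => ?_
  have hL : (fun i => col (exchangeLeft I J s σ i)) = fun i => if h : s ≤ i then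
      col (exchangeColumn I J s (σ (Sum.inl ⟨i, h⟩))) else col (I.emb i) := by
    funext i
    by_cases h : s ≤ i <;> simp [exchangeLeft, h]
  have hR : (fun i => col (exchangeRight I J s σ i)) = fun i => if h : i ≤ s then
      col (exchangeColumn I J s (σ (Sum.inr ⟨i, h⟩))) else col (J.emb i) := by
    funext i
    by_cases h : i ≤ s <;> simp [exchangeRight, h]
  rw [Units.smul_def, zsmul_eq_mul, ← hD, ← hD, hL, hR]
  rfl

/-- The permutations that preserve the two groups of columns all contribute the same term. -/
theorem exchange_sumCongr (I J : PluckerIndex m n) (s : Fin n)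
    (σ₁ : Equiv.Perm {i : Fin n // s ≤ i}) (σ₂ : Equiv.Perm {j : Fin n // j ≤ s})
    (a : Fin n → Fin m → ℂ) :
    ((Equiv.Perm.sign (Equiv.Perm.sumCongr σ₁ σ₂) : ℤ) : ℂ) *
      (columnMinor (exchangeLeft I J s (Equiv.Perm.sumCongr σ₁ σ₂)) a *
        columnMinor (exchangeRight I J s (Equiv.Perm.sumCongr σ₁ σ₂)) a) =
      plucker a I * plucker a J := by
  have hL : exchangeLeft I J s (Equiv.Perm.sumCongr σ₁ σ₂) =
      I.emb ∘ Equiv.Perm.ofSubtype σ₁ := by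
    funext i
    by_cases h : s ≤ i
    · simp [exchangeLeft, h, exchangeColumn, Equiv.Perm.ofSubtype_apply_of_mem]
    · simp [exchangeLeft, h, Equiv.Perm.ofSubtype_apply_of_not_mem]
  have hR : exchangeRight I J s (Equiv.Perm.sumCongr σ₁ σ₂) =
      J.emb ∘ Equiv.Perm.ofSubtype σ₂ := by
    funext i
    by_cases h : i ≤ s
    · simp [exchangeRight, h, exchangeColumn, Equiv.Perm.ofSubtype_apply_of_mem]
    · simp [exchangeRight, h, Equiv.Perm.ofSubtype_apply_of_not_mem]
  rw [hL, hR, columnMinor_comp_perm, columnMinor_comp_perm, columnMinor_emb, columnMinor_emb,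
    Equiv.Perm.sign_ofSubtype, Equiv.Perm.sign_ofSubtype, Equiv.Perm.sign_sumCongr]
  have h1 : (((Equiv.Perm.sign σ₁ : ℤ)) : ℂ) * (Equiv.Perm.sign σ₁ : ℤ) = 1 := by
    rw [← Int.cast_mul, Int.units_coe_mul_self, Int.cast_one]
  have h2 : (((Equiv.Perm.sign σ₂ : ℤ)) : ℂ) * (Equiv.Perm.sign σ₂ : ℤ) = 1 := by
    rw [← Int.cast_mul, Int.units_coe_mul_self, Int.cast_one]
  push_cast
  linear_combination (((Equiv.Perm.sign σ₂ : ℤ)) : ℂ) * (Equiv.Perm.sign σ₂ : ℤ) *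
    plucker a I * plucker a J * h1 + plucker a I * plucker a J * h2

theorem sum_exchange (I J : PluckerIndex m n) (s : Fin n)
    (σ : Equiv.Perm ({i : Fin n // s ≤ i} ⊕ {j : Fin n // j ≤ s})) :
    ∑ i, (exchangeLeft I J s σ i : ℕ) + ∑ i, (exchangeRight I J s σ i : ℕ) =
      I.weight + J.weight := by
  classical
  have key : ∀ τ : Equiv.Perm ({i : Fin n // s ≤ i} ⊕ {j : Fin n // j ≤ s}),
      ∑ i, (exchangeLeft I J s τ i : ℕ) + ∑ i, (exchangeRight I J s τ i : ℕ) =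
      ∑ x, (exchangeColumn I J s x : ℕ) + (∑ i : {i : Fin n // ¬ s ≤ i}, (I.emb i : ℕ) +
        ∑ i : {i : Fin n // ¬ i ≤ s}, (J.emb i : ℕ)) := by
    intro τ
    rw [← Equiv.sum_comp τ fun x => (exchangeColumn I J s x : ℕ), Fintype.sum_sum_type,
      ← Fintype.sum_subtype_add_sum_subtype (s ≤ ·) fun i => (exchangeLeft I J s τ i : ℕ),
      ← Fintype.sum_subtype_add_sum_subtype (· ≤ s) fun i => (exchangeRight I J s τ i : ℕ)]
    have e1 : ∀ i : {i : Fin n // s ≤ i}, exchangeLeft I J s τ i =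
      exchangeColumn I J s (τ (Sum.inl i)) := fun i => by simp [exchangeLeft, i.2]
    have e2 : ∀ i : {i : Fin n // ¬ s ≤ i}, exchangeLeft I J s τ i = I.emb i :=
      fun i => by simp only [exchangeLeft, i.2, dif_neg, not_false_eq_true]
    have e3 : ∀ i : {i : Fin n // i ≤ s}, exchangeRight I J s τ i =
      exchangeColumn I J s (τ (Sum.inr i)) := fun i => by simp [exchangeRight, i.2]
    have e4 : ∀ i : {i : Fin n // ¬ i ≤ s}, exchangeRight I J s τ i = J.emb i :=
      fun i => by simp only [exchangeRight, i.2, dif_neg, not_false_eq_true]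
    simp only [e1, e2, e3, e4]
    ring
  rw [key, ← key 1]
  congr 1
  · refine Finset.sum_congr rfl fun i _ => ?_
    by_cases h : s ≤ i <;> simp [exchangeLeft, h, exchangeColumn]
  · refine Finset.sum_congr rfl fun i _ => ?_
    by_cases h : i ≤ s <;> simp [exchangeRight, h, exchangeColumn]

/-- If `J_s < I_s`, then the columns `J_j`, `j ≤ s`, are smaller than the columns `I_i`, `i ≥ s`, and
a permutation that mixes the two groups lowers the weight of the first factor. -/
theorem sum_exchangeLeft_lt (I J : PluckerIndex m n) (s : Fin n) (hs : J.emb s < I.emb s)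
    (σ : Equiv.Perm ({i : Fin n // s ≤ i} ⊕ {j : Fin n // j ≤ s}))
    (hσ : σ ∉ (Equiv.Perm.sumCongrHom {i : Fin n // s ≤ i} {j : Fin n // j ≤ s}).range) :
    ∑ i, (exchangeLeft I J s σ i : ℕ) < I.weight := by
  classical
  have hmaps : ¬ Set.MapsTo σ (Set.range Sum.inl) (Set.range Sum.inl) :=
    mt Equiv.Perm.mem_sumCongrHom_range_of_perm_mapsTo_inl hσ
  set f : {i : Fin n // s ≤ i} ⊕ {j : Fin n // j ≤ s} → ℕ := fun x => exchangeColumn I J s x with hf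
  set A : Finset ({i : Fin n // s ≤ i} ⊕ {j : Fin n // j ≤ s}) := Finset.univ.map ⟨Sum.inl, Sum.inl_injective⟩ with hA
  -- `B` consists of the columns that take the places of the columns `I_i`, `i ≥ s`.
  set B := A.map σ.toEmbedding with hB
  have hcard : B.card = A.card := Finset.card_map _
  have hAlow : ∀ x ∈ A, (I.emb s : ℕ) ≤ f x := by
    simp only [hA, Finset.mem_map, Finset.mem_univ, true_and, Function.Embedding.coeFn_mk]
    rintro _ ⟨i, rfl⟩
    exact I.emb_strictMono.monotone i.2
  have hBhigh : ∀ x ∉ A, f x < I.emb s := by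
    rintro (i | j) hx
    · exact absurd (Finset.mem_map_of_mem ⟨Sum.inl, Sum.inl_injective⟩ (Finset.mem_univ i)) hx
    · exact lt_of_le_of_lt (J.emb_strictMono.monotone j.2) hs
  have hne : (B \ A).Nonempty := by
    rw [Finset.sdiff_nonempty]
    intro hBA
    refine hmaps ?_
    rintro _ ⟨i, rfl⟩
    have := hBA (Finset.mem_map_of_mem σ.toEmbedding
      (Finset.mem_map_of_mem ⟨Sum.inl, Sum.inl_injective⟩ (Finset.mem_univ i)))
    simp only [hA, Finset.mem_map, Finset.mem_univ, true_and, Function.Embedding.coeFn_mk] at this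
    exact this
  have hlt : ∑ x ∈ B, f x < ∑ x ∈ A, f x := by
    rw [← Finset.sum_sdiff_lt_sum_sdiff]
    have hc : (B \ A).card = (A \ B).card := Finset.card_sdiff_comm hcard
    calc ∑ x ∈ B \ A, f x < ∑ x ∈ B \ A, (I.emb s : ℕ) :=
          Finset.sum_lt_sum_of_nonempty hne fun x hx => hBhigh x (Finset.mem_sdiff.1 hx).2
      _ = ∑ x ∈ A \ B, (I.emb s : ℕ) := by rw [Finset.sum_const, Finset.sum_const, hc]
      _ ≤ _ := Finset.sum_le_sum fun x hx => hAlow x (Finset.mem_sdiff.1 hx).1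
  rw [PluckerIndex.weight,
    ← Fintype.sum_subtype_add_sum_subtype (s ≤ ·) fun i => (exchangeLeft I J s σ i : ℕ),
    ← Fintype.sum_subtype_add_sum_subtype (s ≤ ·) fun i => (I.emb i : ℕ)]
  have e1 : ∀ i : {i : Fin n // s ≤ i}, (exchangeLeft I J s σ i : ℕ) =
      f (σ (Sum.inl i)) := fun i => by simp [exchangeLeft, i.2, hf]
  have e2 : ∀ i : {i : Fin n // ¬ s ≤ i}, exchangeLeft I J s σ i = I.emb i :=
    fun i => by simp only [exchangeLeft, i.2, dif_neg, not_false_eq_true]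
  simp only [e1, e2]
  simp only [hB, hA, Finset.sum_map, Function.Embedding.coeFn_mk] at hlt
  exact Nat.add_lt_add_right hlt _

/-- A product of two incomparable Plücker coordinates is a combination of products whose factors
have weights further apart. -/
theorem plucker_mul_mem_span (I J : PluckerIndex m n) (h : ¬ I.Below J) (hw : I.weight ≤ J.weight) :
    (fun a : Fin n → Fin m → ℂ => plucker a I * plucker a J) ∈
      Submodule.span ℂ {f | ∃ I' J' : PluckerIndex m n,
        I.weight ^ 2 + J.weight ^ 2 < I'.weight ^ 2 + J'.weight ^ 2 ∧
        f = fun a => plucker a I' * plucker a J'} := by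
  classical
  simp only [PluckerIndex.Below, not_forall, not_le] at h
  obtain ⟨s, hs⟩ := h
  set G := (Equiv.Perm.sumCongrHom {i : Fin n // s ≤ i} {j : Fin n // j ≤ s}).range with hG
  set S := Submodule.span ℂ {f | ∃ I' J' : PluckerIndex m n,
        I.weight ^ 2 + J.weight ^ 2 < I'.weight ^ 2 + J'.weight ^ 2 ∧
        f = fun a : Fin n → Fin m → ℂ => plucker a I' * plucker a J'} with hS
  let F : Equiv.Perm ({i : Fin n // s ≤ i} ⊕ {j : Fin n // j ≤ s}) → (Fin n → Fin m → ℂ) → ℂ :=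
    fun σ a => ((Equiv.Perm.sign σ : ℤ) : ℂ) *
      (columnMinor (exchangeLeft I J s σ) a * columnMinor (exchangeRight I J s σ) a)
  have hFG : ∀ σ ∈ G, F σ = fun a => plucker a I * plucker a J := by
    rintro _ ⟨⟨σ₁, σ₂⟩, rfl⟩
    exact funext fun a => exchange_sumCongr I J s σ₁ σ₂ a
  have hFS : ∀ σ ∉ G, F σ ∈ S := by
    intro σ hσ
    have hlt := sum_exchangeLeft_lt I J s hs σ hσ
    have hsum := sum_exchange I J s σ
    rcases columnMinor_cases (exchangeLeft I J s σ) with h0 | ⟨I', σ₁, -, hI', h1⟩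
    · have : F σ = 0 := funext fun a => by simp [F, h0]
      rw [this]
      exact S.zero_mem
    rcases columnMinor_cases (exchangeRight I J s σ) with h0 | ⟨J', σ₂, -, hJ', h2⟩
    · have : F σ = 0 := funext fun a => by simp [F, h0]
      rw [this]
      exact S.zero_mem
    have : F σ = (((Equiv.Perm.sign σ : ℤ) : ℂ) * (Equiv.Perm.sign σ₁ : ℤ) *
        (Equiv.Perm.sign σ₂ : ℤ)) • fun a => plucker a I' * plucker a J' := funext fun a => by
      simp only [F, h1, h2, Pi.smul_apply, smul_eq_mul]
      ring
    rw [this]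
    refine S.smul_mem _ (Submodule.subset_span ⟨I', J', ?_, rfl⟩)
    rw [← hI', ← hJ'] at hsum
    rw [← hI'] at hlt
    -- The sum of the two weights is unchanged, and the smaller weight has decreased.
    nlinarith
  -- Solve the Plücker relation for the terms that preserve the two groups of columns.
  have hsum : ∑ σ, F σ = 0 := funext fun a => by
    simpa [F] using exchange_sum I J s a
  rw [← Finset.sum_filter_add_sum_filter_not Finset.univ (· ∈ G)] at hsum
  have h1 : ∑ σ with σ ∈ G, F σ =
      ((Finset.univ.filter (· ∈ G)).card : ℂ) • fun a => plucker a I * plucker a J := by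
    rw [Finset.sum_congr rfl fun σ hσ => hFG σ (Finset.mem_filter.1 hσ).2, Finset.sum_const,
      Nat.cast_smul_eq_nsmul]
  have hne : ((Finset.univ.filter (· ∈ G)).card : ℂ) ≠ 0 := by
    rw [Nat.cast_ne_zero, Finset.card_ne_zero]
    exact ⟨1, Finset.mem_filter.2 ⟨Finset.mem_univ _, G.one_mem⟩⟩
  have h2 : ∑ σ with σ ∉ G, F σ ∈ S :=
    S.sum_mem fun σ hσ => hFS σ (Finset.mem_filter.1 hσ).2
  rw [h1] at hsum
  rw [← S.smul_mem_iff hne, eq_neg_of_add_eq_zero_left hsum]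
  exact S.neg_mem h2

end Exchange

/-! ### Standard monomials -/

section Standard

variable {m n : ℕ}

/-- The exponents of the standard monomials of degree `k`: the Plücker coordinates which occur are
pairwise comparable. -/
def standardExponents (m n k : ℕ) : Set (PluckerIndex m n →₀ ℕ) :=
  {d | d.degree = k ∧ ∀ I J, d I ≠ 0 → d J ≠ 0 → I.Below J ∨ J.Below I}

/-- Linear combinations of standard monomials of degree `k`. -/
def standardPolys (m n k : ℕ) : Submodule ℂ (MvPolynomial (PluckerIndex m n) ℂ) :=
  MvPolynomial.restrictSupport ℂ (standardExponents m n k)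

theorem mem_standardPolys {k : ℕ} {S : MvPolynomial (PluckerIndex m n) ℂ} :
    S ∈ standardPolys m n k ↔ ∀ d, S.coeff d ≠ 0 → d ∈ standardExponents m n k := by
  simp only [standardPolys, MvPolynomial.mem_restrictSupport_iff, Set.subset_def, Finset.mem_coe,
    MvPolynomial.mem_support_iff]

theorem isHomogeneous_of_degree {σ : Type*} {S : MvPolynomial σ ℂ} {k : ℕ}
    (h : ∀ d, S.coeff d ≠ 0 → d.degree = k) : S.IsHomogeneous k := by
  intro d hd
  rw [← h d hd, Finsupp.degree_eq_weight_one]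
  rfl

theorem degree_of_isHomogeneous {σ : Type*} {S : MvPolynomial σ ℂ} {k : ℕ} (h : S.IsHomogeneous k)
    {d : σ →₀ ℕ} (hd : S.coeff d ≠ 0) : d.degree = k := by
  rw [← h hd, Finsupp.degree_eq_weight_one]
  rfl

theorem isHomogeneous_of_mem_standardPolys {k : ℕ} {S : MvPolynomial (PluckerIndex m n) ℂ}
    (h : S ∈ standardPolys m n k) : S.IsHomogeneous k :=
  isHomogeneous_of_degree fun d hd => (mem_standardPolys.1 h d hd).1

/-- The restriction of polynomials to the Plücker vectors. -/
def pluckerEval (m n : ℕ) :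
    MvPolynomial (PluckerIndex m n) ℂ →ₐ[ℂ] ((Fin n → Fin m → ℂ) → ℂ) :=
  MvPolynomial.aeval fun I a => plucker a I

theorem pluckerEval_apply (P : MvPolynomial (PluckerIndex m n) ℂ) (a : Fin n → Fin m → ℂ) :
    pluckerEval m n P a = MvPolynomial.eval (plucker a) P := by
  have : ((Pi.evalAlgHom ℂ (fun _ : Fin n → Fin m → ℂ => ℂ) a).comp (pluckerEval m n)) =
      MvPolynomial.aeval (plucker a) := by
    refine MvPolynomial.algHom_ext fun I => ?_
    simp [pluckerEval]
  have h := DFunLike.congr_fun this P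
  simpa [MvPolynomial.aeval_eq_eval] using h

/-- The measure of the spread of the weights in a monomial, which grows under straightening. -/
def spread (d : PluckerIndex m n →₀ ℕ) : ℕ := ∑ I, d I * I.weight ^ 2

theorem weight_le (I : PluckerIndex m n) : I.weight ≤ n * m := by
  have := Finset.sum_le_card_nsmul Finset.univ (fun i => (I.emb i : ℕ)) m
    fun i _ => (I.emb i).2.le
  simpa [PluckerIndex.weight] using this

theorem spread_le (d : PluckerIndex m n →₀ ℕ) : spread d ≤ d.degree * (n * m) ^ 2 := by
  rw [Finsupp.degree_eq_sum, Finset.sum_mul]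
  exact Finset.sum_le_sum fun I _ =>
    Nat.mul_le_mul_left _ (Nat.pow_le_pow_left (weight_le I) 2)

theorem spread_add (d e : PluckerIndex m n →₀ ℕ) : spread (d + e) = spread d + spread e := by
  simp [spread, add_mul, Finset.sum_add_distrib]

theorem spread_single (I : PluckerIndex m n) : spread (Finsupp.single I 1) = I.weight ^ 2 := by
  classical
  simp [spread, Finsupp.single_apply]

theorem monomial_mem_map_standard (k : ℕ) (d : PluckerIndex m n →₀ ℕ) (hd : d.degree = k) :
    pluckerEval m n (MvPolynomial.monomial d 1) ∈
      (standardPolys m n k).map (pluckerEval m n).toLinearMap := by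
  -- Induction on the distance of the spread from its maximal possible value.
  induction hN : k * (n * m) ^ 2 - spread d using Nat.strong_induction_on generalizing d with
  | _ N ih =>
    subst hN
    by_cases hc : ∀ I J, d I ≠ 0 → d J ≠ 0 → I.Below J ∨ J.Below I
    · refine Submodule.mem_map_of_mem (f := (pluckerEval m n).toLinearMap) ?_
      refine mem_standardPolys.2 fun e he => ?_
      classical
      rw [MvPolynomial.coeff_monomial] at he
      obtain rfl : d = e := by
        by_contra hne
        exact he (if_neg hne)
      exact ⟨hd, hc⟩
    · push Not at hc
      obtain ⟨I, J, hI, hJ, hIJ, hJI⟩ := hc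
      -- Exchange the names so that the first index has the smaller weight.
      obtain ⟨I, J, hI, hJ, hIJ, hne, hw⟩ : ∃ I J, d I ≠ 0 ∧ d J ≠ 0 ∧ ¬ I.Below J ∧ I ≠ J ∧
          I.weight ≤ J.weight := by
        have hne : I ≠ J := fun h => hIJ (h ▸ PluckerIndex.Below.refl I)
        rcases le_total I.weight J.weight with h | h
        · exact ⟨I, J, hI, hJ, hIJ, hne, h⟩
        · exact ⟨J, I, hJ, hI, hJI, hne.symm, h⟩
      obtain ⟨e, he⟩ : ∃ e, d = e + Finsupp.single I 1 + Finsupp.single J 1 := by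
        classical
        refine ⟨d - Finsupp.single I 1 - Finsupp.single J 1, ?_⟩
        ext K
        simp only [Finsupp.add_apply, Finsupp.tsub_apply, Finsupp.single_apply]
        by_cases h1 : I = K <;> by_cases h2 : J = K
        · exact absurd (h1.trans h2.symm) hne
        · subst h1; simp [h2]; omega
        · subst h2; simp [h1]; omega
        · simp [h1, h2]
      have hsplit : ∀ K L : PluckerIndex m n, pluckerEval m n
          (MvPolynomial.monomial (e + Finsupp.single K 1 + Finsupp.single L 1) 1) =
          pluckerEval m n (MvPolynomial.monomial e 1) * fun a => plucker a K * plucker a L := by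
        intro K L
        have : MvPolynomial.monomial (e + Finsupp.single K 1 + Finsupp.single L 1) (1 : ℂ) =
            MvPolynomial.monomial e 1 * (MvPolynomial.X K * MvPolynomial.X L) := by
          simp [MvPolynomial.X, MvPolynomial.monomial_mul, add_assoc]
        rw [this, map_mul, map_mul]
        simp only [pluckerEval, MvPolynomial.aeval_X]
        rfl
      have hmem := plucker_mul_mem_span I J hIJ hw
      rw [he, hsplit]
      have hle : Submodule.map (LinearMap.mulLeft ℂ (pluckerEval m n (MvPolynomial.monomial e 1)))
          (Submodule.span ℂ {f | ∃ I' J' : PluckerIndex m n,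
            I.weight ^ 2 + J.weight ^ 2 < I'.weight ^ 2 + J'.weight ^ 2 ∧
            f = fun a => plucker a I' * plucker a J'}) ≤
          (standardPolys m n k).map (pluckerEval m n).toLinearMap := by
        rw [Submodule.map_span_le]
        rintro _ ⟨I', J', hlt, rfl⟩
        rw [LinearMap.mulLeft_apply, ← hsplit]
        have hdeg : (e + Finsupp.single I' 1 + Finsupp.single J' 1).degree = k := by
          rw [← hd, he]
          simp [map_add, Finsupp.degree_single]
        refine ih _ ?_ _ hdeg rfl
        have h1 := spread_le (e + Finsupp.single I' 1 + Finsupp.single J' 1)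
        rw [hdeg] at h1
        have h2 : spread d < spread (e + Finsupp.single I' 1 + Finsupp.single J' 1) := by
          rw [he]
          simp only [spread_add, spread_single]
          omega
        omega
      exact hle (Submodule.mem_map_of_mem (f := LinearMap.mulLeft ℂ _) hmem)

/-- Straightening: every homogeneous polynomial agrees with a combination of standard monomials on
all Plücker vectors. -/
theorem exists_standard {k : ℕ} {P : MvPolynomial (PluckerIndex m n) ℂ} (hP : P.IsHomogeneous k) :
    ∃ S ∈ standardPolys m n k, ∀ a : Fin n → Fin m → ℂ,
      MvPolynomial.eval (plucker a) S = MvPolynomial.eval (plucker a) P := by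
  have : pluckerEval m n P ∈ (standardPolys m n k).map (pluckerEval m n).toLinearMap := by
    rw [P.as_sum, map_sum]
    refine Submodule.sum_mem _ fun d hd => ?_
    have h1 : MvPolynomial.monomial d (P.coeff d) = P.coeff d • MvPolynomial.monomial d (1 : ℂ) := by
      rw [MvPolynomial.smul_monomial, smul_eq_mul, mul_one]
    rw [h1, map_smul]
    exact Submodule.smul_mem _ _ (monomial_mem_map_standard k d
      (degree_of_isHomogeneous hP (MvPolynomial.mem_support_iff.1 hd)))
  obtain ⟨S, hS, h⟩ := this
  exact ⟨S, hS, fun a => by rw [← pluckerEval_apply, ← pluckerEval_apply]; exact congrFun h a⟩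

/-- The matrices in echelon form of type `τ`: the `i`-th row lies in the member of the standard
flag spanned by the vectors up to the `τ_i`-th one. -/
def Echelon (τ : PluckerIndex m n) (a : Fin n → Fin m → ℂ) : Prop :=
  ∀ i j, τ.emb i < j → a i j = 0

theorem Echelon.mono {τ κ : PluckerIndex m n} (h : κ.Below τ) {a : Fin n → Fin m → ℂ}
    (ha : Echelon κ a) : Echelon τ a := fun i j hj => ha i j ((h i).trans_lt hj)

theorem echelon_single (τ : PluckerIndex m n) : Echelon τ fun i => Pi.single (τ.emb i) 1 :=
  fun i j hj => by simp [hj.ne]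

theorem Echelon.columnMinor_eq_zero {τ : PluckerIndex m n} {a : Fin n → Fin m → ℂ}
    (ha : Echelon τ a) {f : Fin n → Fin m} {i : Fin n} (hf : ∀ j, i ≤ j → τ.emb i < f j) :
    columnMinor f a = 0 := by
  -- A permutation moves some row `l ≤ i` to a column `≥ i`, where its entry vanishes.
  rw [columnMinor, ← Matrix.det_transpose, Matrix.det_apply]
  refine Finset.sum_eq_zero fun σ _ => ?_
  suffices h : ∃ l, l ≤ i ∧ i ≤ σ l by
    obtain ⟨l, hl, hσ⟩ := h
    have : ∏ j, (Matrix.of fun i j => a i (f j)).transpose (σ j) j = 0 :=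
      Finset.prod_eq_zero (Finset.mem_univ l) (ha l _
        ((τ.emb_strictMono.monotone hl).trans_lt (hf _ hσ)))
    rw [this, smul_zero]
  by_contra! hc
  have hmap : ∀ l ∈ Finset.Iic i, σ l ∈ Finset.Iio i := fun l hl =>
    Finset.mem_Iio.2 (hc l (Finset.mem_Iic.1 hl))
  have := Finset.card_le_card_of_injOn σ hmap σ.injective.injOn
  rw [Fin.card_Iic, Fin.card_Iio] at this
  omega

theorem Echelon.plucker_eq_zero {τ : PluckerIndex m n} {a : Fin n → Fin m → ℂ}
    (ha : Echelon τ a) {I : PluckerIndex m n} (hI : ¬ I.Below τ) : plucker a I = 0 := by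
  simp only [PluckerIndex.Below, not_forall, not_le] at hI
  obtain ⟨i, hi⟩ := hI
  exact ha.columnMinor_eq_zero fun j hj => hi.trans_le (I.emb_strictMono.monotone hj)

/-- The substitution of the Plücker coordinates of the generic matrix in echelon form. -/
def genericEval (τ : PluckerIndex m n) :
    MvPolynomial (PluckerIndex m n) ℂ →ₐ[ℂ] MvPolynomial (Fin n × Fin m) ℂ :=
  MvPolynomial.aeval fun I => Matrix.det (Matrix.of fun i j =>
    if τ.emb i < I.emb j then 0 else MvPolynomial.X (i, I.emb j))

theorem eval_genericEval (τ : PluckerIndex m n) (y : Fin n × Fin m → ℂ)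
    (P : MvPolynomial (PluckerIndex m n) ℂ) :
    MvPolynomial.eval y (genericEval τ P) =
      MvPolynomial.eval (plucker fun i j => if τ.emb i < j then 0 else y (i, j)) P := by
  have : (MvPolynomial.aeval y : MvPolynomial (Fin n × Fin m) ℂ →ₐ[ℂ] ℂ).comp (genericEval τ) =
      MvPolynomial.aeval (plucker fun i j => if τ.emb i < j then 0 else y (i, j)) := by
    refine MvPolynomial.algHom_ext fun I => ?_
    rw [AlgHom.comp_apply, genericEval, MvPolynomial.aeval_X, AlgHom.map_det, MvPolynomial.aeval_X,
      plucker]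
    congr 1
    ext i j
    by_cases h : τ.emb i < I.emb j <;> simp [h]
  simpa [MvPolynomial.aeval_eq_eval] using DFunLike.congr_fun this P

theorem genericEval_eq_zero_iff (τ : PluckerIndex m n) (P : MvPolynomial (PluckerIndex m n) ℂ) :
    genericEval τ P = 0 ↔ ∀ a, Echelon τ a → MvPolynomial.eval (plucker a) P = 0 := by
  constructor
  · intro h a ha
    have h' := eval_genericEval τ (fun q => a q.1 q.2) P
    rw [h, map_zero] at h'
    rw [h']
    congr 3
    funext i j
    by_cases hij : τ.emb i < j
    · simp [hij, ha i j hij]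
    · simp [hij]
  · intro h
    refine MvPolynomial.funext fun y => ?_
    rw [eval_genericEval, map_zero]
    exact h _ fun i j hij => by simp [hij]

/-- A Schubert variety is irreducible. -/
theorem eval_eq_zero_of_mul {τ : PluckerIndex m n} {P Q : MvPolynomial (PluckerIndex m n) ℂ}
    (h : ∀ a, Echelon τ a → MvPolynomial.eval (plucker a) P * MvPolynomial.eval (plucker a) Q = 0) :
    (∀ a, Echelon τ a → MvPolynomial.eval (plucker a) P = 0) ∨
      ∀ a, Echelon τ a → MvPolynomial.eval (plucker a) Q = 0 := by
  rw [← genericEval_eq_zero_iff, ← genericEval_eq_zero_iff, ← mul_eq_zero, ← map_mul,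
    genericEval_eq_zero_iff]
  simpa using h

theorem eval_eq_zero_of_X_mul {τ : PluckerIndex m n} {P : MvPolynomial (PluckerIndex m n) ℂ}
    (h : ∀ a, Echelon τ a → plucker a τ * MvPolynomial.eval (plucker a) P = 0) :
    ∀ a, Echelon τ a → MvPolynomial.eval (plucker a) P = 0 := by
  rcases eval_eq_zero_of_mul (P := MvPolynomial.X τ) (Q := P) (by simpa using h) with h | h
  · have := h _ (echelon_single τ)
    rw [MvPolynomial.eval_X, plucker_single, if_pos rfl] at this
    exact absurd this one_ne_zero
  · exact h

theorem eval_eq_zero_of_not_below {τ : PluckerIndex m n} {R : MvPolynomial (PluckerIndex m n) ℂ}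
    (h : ∀ d, R.coeff d ≠ 0 → ∃ I, d I ≠ 0 ∧ ¬ I.Below τ) {a : Fin n → Fin m → ℂ}
    (ha : Echelon τ a) : MvPolynomial.eval (plucker a) R = 0 := by
  rw [MvPolynomial.eval_eq]
  refine Finset.sum_eq_zero fun d hd => ?_
  obtain ⟨I, hI, hI'⟩ := h d (MvPolynomial.mem_support_iff.1 hd)
  rw [Finset.prod_eq_zero (Finsupp.mem_support_iff.2 hI), mul_zero]
  rw [ha.plucker_eq_zero hI', zero_pow hI]

/-- A nontrivial standard monomial has a largest factor. -/
theorem exists_top {k : ℕ} {d : PluckerIndex m n →₀ ℕ} (hd : d ∈ standardExponents m n (k + 1)) :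
    ∃ K, d K ≠ 0 ∧ ∀ I, d I ≠ 0 → I.Below K := by
  have hne : d.support.Nonempty := by
    rw [Finsupp.support_nonempty_iff]
    rintro rfl
    simpa using hd.1
  obtain ⟨K, hK, hmax⟩ := d.support.exists_max_image PluckerIndex.weight hne
  refine ⟨K, Finsupp.mem_support_iff.1 hK, fun I hI => ?_⟩
  rcases hd.2 I K hI (Finsupp.mem_support_iff.1 hK) with h | h
  · exact h
  · have hw := hmax I (Finsupp.mem_support_iff.2 hI)
    have : K = I := by
      refine PluckerIndex.ext_emb (funext fun i => ?_)
      by_contra hi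
      refine absurd hw (not_le.2 (Finset.sum_lt_sum (fun j _ => h j) ⟨i, Finset.mem_univ i, ?_⟩))
      exact lt_of_le_of_ne (h i) fun e => hi (Fin.ext e)
    exact this ▸ PluckerIndex.Below.refl _

/-- Suppose that the terms of a combination of standard monomials vanish on the Schubert varieties of
all `K < τ`, because they have a factor `p_I` with `I ≰ K`. Then the terms that are not divisible by
`p_τ` vanish on the Schubert variety of `τ`: their largest factor `p_K` satisfies `K ≰ τ`. -/
theorem not_below_of_coeff_eq_zero {k : ℕ} {τ : PluckerIndex m n}
    {S : MvPolynomial (PluckerIndex m n) ℂ} (hS : S ∈ standardPolys m n (k + 1))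
    (h : ∀ K : PluckerIndex m n, K.Below τ → K ≠ τ →
      ∀ d, S.coeff d ≠ 0 → ∃ I, d I ≠ 0 ∧ ¬ I.Below K)
    {d : PluckerIndex m n →₀ ℕ} (hd : S.coeff d ≠ 0) (hdτ : d τ = 0) :
    ∃ I, d I ≠ 0 ∧ ¬ I.Below τ := by
  obtain ⟨K, hK, hmax⟩ := exists_top (mem_standardPolys.1 hS d hd)
  by_cases hKτ : K.Below τ
  · obtain ⟨I, hI, hI'⟩ := h K hKτ (fun h => hK (h ▸ hdτ)) d hd
    exact absurd (hmax I hI) hI'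
  · exact ⟨K, hK, hKτ⟩

theorem divMonomial_mem_standardPolys {k : ℕ} {τ : PluckerIndex m n}
    {S : MvPolynomial (PluckerIndex m n) ℂ} (hS : S ∈ standardPolys m n (k + 1)) :
    S.divMonomial (Finsupp.single τ 1) ∈ standardPolys m n k := by
  refine mem_standardPolys.2 fun d hd => ?_
  rw [MvPolynomial.coeff_divMonomial] at hd
  have h := mem_standardPolys.1 hS _ hd
  refine ⟨?_, fun I J hI hJ => h.2 I J ?_ ?_⟩
  · have := h.1
    rw [map_add, Finsupp.degree_single] at this
    omega
  · simp [hI]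
  · simp [hJ]

theorem coeff_modMonomial_ne_zero {τ : PluckerIndex m n} {S : MvPolynomial (PluckerIndex m n) ℂ}
    {d : PluckerIndex m n →₀ ℕ} (hd : (S.modMonomial (Finsupp.single τ 1)).coeff d ≠ 0) :
    S.coeff d ≠ 0 ∧ d τ = 0 := by
  by_cases hle : Finsupp.single τ 1 ≤ d
  · exact absurd (MvPolynomial.coeff_modMonomial_of_le S hle) hd
  · rw [MvPolynomial.coeff_modMonomial_of_not_le S hle] at hd
    refine ⟨hd, ?_⟩
    rw [Finsupp.single_le_iff] at hle
    omega

theorem eval_divMonomial_add {τ : PluckerIndex m n} (S : MvPolynomial (PluckerIndex m n) ℂ)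
    (a : Fin n → Fin m → ℂ) :
    MvPolynomial.eval (plucker a) S =
      plucker a τ * MvPolynomial.eval (plucker a) (S.divMonomial (Finsupp.single τ 1)) +
        MvPolynomial.eval (plucker a) (S.modMonomial (Finsupp.single τ 1)) := by
  conv_lhs => rw [← MvPolynomial.divMonomial_add_modMonomial_single S τ]
  simp

/-- The standard monomials which do not vanish on a Schubert variety are linearly independent
on it. -/
theorem standard_independent (k : ℕ) (τ : PluckerIndex m n)
    {S : MvPolynomial (PluckerIndex m n) ℂ} (hS : S ∈ standardPolys m n k)
    (h : ∀ a, Echelon τ a → MvPolynomial.eval (plucker a) S = 0) :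
    ∀ d, S.coeff d ≠ 0 → ∃ I, d I ≠ 0 ∧ ¬ I.Below τ := by
  induction k generalizing τ S with
  | zero =>
    intro d hd
    exfalso
    have hd0 : d = 0 := by
      have := (mem_standardPolys.1 hS d hd).1
      rwa [Finsupp.degree_eq_zero_iff] at this
    have hSC : S = MvPolynomial.C (S.coeff 0) := by
      ext e
      by_cases he : S.coeff e = 0
      · by_cases h0 : 0 = e
        · subst h0; simp
        · simp [MvPolynomial.coeff_C, h0, he]
      · have := (mem_standardPolys.1 hS e he).1
        rw [Finsupp.degree_eq_zero_iff] at this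
        subst this
        simp
    have := h _ (echelon_single τ)
    rw [hSC, MvPolynomial.eval_C] at this
    exact hd (hd0 ▸ this)
  | succ k ih =>
    -- A second induction shows that the terms vanish on the smaller Schubert varieties.
    induction hw : τ.weight using Nat.strong_induction_on generalizing τ with
    | _ w ihw =>
      subst hw
      have hsmall : ∀ K : PluckerIndex m n, K.Below τ → K ≠ τ →
          ∀ d, S.coeff d ≠ 0 → ∃ I, d I ≠ 0 ∧ ¬ I.Below K := by
        intro K hK hne
        refine ihw K.weight ?_ K (fun a ha => h a (ha.mono hK)) rfl
        obtain ⟨i, hi⟩ : ∃ i, K.emb i ≠ τ.emb i := by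
          by_contra! hc
          exact hne (PluckerIndex.ext_emb (funext hc))
        exact Finset.sum_lt_sum (fun j _ => hK j) ⟨i, Finset.mem_univ i, lt_of_le_of_ne (hK i) (by
          simpa [Fin.ext_iff] using hi)⟩
      have hrem : ∀ d, S.coeff d ≠ 0 → d τ = 0 → ∃ I, d I ≠ 0 ∧ ¬ I.Below τ := fun d hd hdτ =>
        not_below_of_coeff_eq_zero hS hsmall hd hdτ
      -- On the Schubert variety, the polynomial is `p_τ` times a quotient of smaller degree.
      have hquot := ih τ (divMonomial_mem_standardPolys (τ := τ) hS)
        (eval_eq_zero_of_X_mul fun a ha => by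
          have h1 := eval_divMonomial_add (τ := τ) S a
          rw [h a ha, eval_eq_zero_of_not_below (fun d hd => hrem d
            (coeff_modMonomial_ne_zero hd).1 (coeff_modMonomial_ne_zero hd).2) ha, add_zero] at h1
          exact h1.symm)
      intro d hd
      by_cases hdτ : d τ = 0
      · exact hrem d hd hdτ
      · have hle : Finsupp.single τ 1 ≤ d := by
          rw [Finsupp.single_le_iff]
          omega
        obtain ⟨I, hI, hI'⟩ := hquot (d - Finsupp.single τ 1) (by
          rwa [MvPolynomial.coeff_divMonomial, add_tsub_cancel_of_le hle])
        refine ⟨I, fun h0 => hI ?_, hI'⟩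
        simp [h0]

/-- On the Schubert variety of `τ`, the homogeneous ideal of the divisor `p_τ = 0` (with its
reduced structure) is generated by `p_τ`. -/
theorem exists_factor {k : ℕ} {τ : PluckerIndex m n} {P : MvPolynomial (PluckerIndex m n) ℂ}
    (hP : P.IsHomogeneous (k + 1))
    (h : ∀ a, Echelon τ a → plucker a τ = 0 → MvPolynomial.eval (plucker a) P = 0) :
    ∃ Q : MvPolynomial (PluckerIndex m n) ℂ, Q.IsHomogeneous k ∧ ∀ a, Echelon τ a →
      MvPolynomial.eval (plucker a) P = plucker a τ * MvPolynomial.eval (plucker a) Q := by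
  obtain ⟨S, hS, hSP⟩ := exists_standard hP
  refine ⟨S.divMonomial (Finsupp.single τ 1),
    isHomogeneous_of_mem_standardPolys (divMonomial_mem_standardPolys hS), fun a ha => ?_⟩
  have hsmall : ∀ K : PluckerIndex m n, K.Below τ → K ≠ τ →
      ∀ d, S.coeff d ≠ 0 → ∃ I, d I ≠ 0 ∧ ¬ I.Below K := by
    intro K hK hne
    refine standard_independent (k + 1) K hS fun b hb => ?_
    rw [hSP]
    exact h b (hb.mono hK) (hb.plucker_eq_zero fun hτ => hne (hK.antisymm hτ))
  rw [← hSP, eval_divMonomial_add (τ := τ) S a, eval_eq_zero_of_not_below (fun d hd =>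
    not_below_of_coeff_eq_zero hS hsmall (coeff_modMonomial_ne_zero hd).1
      (coeff_modMonomial_ne_zero hd).2) ha, add_zero]

end Standard

/-! ### Homogeneous polynomials on cones -/

section Homogeneous

variable {σ : Type*}

theorem eval_smul_of_isHomogeneous {P : MvPolynomial σ ℂ} {k : ℕ} (hP : P.IsHomogeneous k) (c : ℂ)
    (x : σ → ℂ) : MvPolynomial.eval (c • x) P = c ^ k * MvPolynomial.eval x P := by
  rw [MvPolynomial.eval_eq, MvPolynomial.eval_eq, Finset.mul_sum]
  refine Finset.sum_congr rfl fun d hd => ?_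
  rw [← degree_of_isHomogeneous hP (MvPolynomial.mem_support_iff.1 hd), Finsupp.degree_apply,
    ← Finset.prod_pow_eq_pow_sum]
  simp only [Pi.smul_apply, smul_eq_mul, mul_pow, Finset.prod_mul_distrib]
  ring

theorem eval_zero_of_isHomogeneous {P : MvPolynomial σ ℂ} {k : ℕ} (hP : P.IsHomogeneous k)
    (hk : k ≠ 0) : MvPolynomial.eval 0 P = 0 := by
  simpa [hk] using eval_smul_of_isHomogeneous hP 0 0

/-- A homogeneous component of a polynomial is determined by the values on a punctured line. -/
theorem eval_homogeneousComponent {P : MvPolynomial σ ℂ} {x : σ → ℂ} {b : ℂ} {e : ℕ}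
    (h : ∀ t : ℂ, t ≠ 0 → MvPolynomial.eval (t • x) P = t ^ e * b) :
    MvPolynomial.eval x (MvPolynomial.homogeneousComponent e P) = b := by
  let q : Polynomial ℂ := ∑ i ∈ Finset.range (P.totalDegree + 1),
    Polynomial.monomial i (MvPolynomial.eval x (MvPolynomial.homogeneousComponent i P))
  have hq : ∀ t : ℂ, q.eval t = MvPolynomial.eval (t • x) P := by
    intro t
    conv_rhs => rw [← MvPolynomial.sum_homogeneousComponent P]
    rw [map_sum, Polynomial.eval_finsetSum]
    refine Finset.sum_congr rfl fun i _ => ?_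
    rw [Polynomial.eval_monomial,
      eval_smul_of_isHomogeneous (MvPolynomial.homogeneousComponent_isHomogeneous i P), mul_comm]
  have hqe : q = Polynomial.monomial e b := by
    refine Polynomial.eq_of_infinite_eval_eq _ _ (Set.Infinite.mono (s := {0}ᶜ) ?_
      (Set.finite_singleton (0 : ℂ)).infinite_compl)
    intro t ht
    change q.eval t = _
    rw [hq, h t ht, Polynomial.eval_monomial, mul_comm]
  have hc : q.coeff e = MvPolynomial.eval x (MvPolynomial.homogeneousComponent e P) := by
    simp only [q, Polynomial.finsetSum_coeff, Polynomial.coeff_monomial, Finset.sum_ite_eq',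
      Finset.mem_range]
    split_ifs with he
    · rfl
    · rw [MvPolynomial.homogeneousComponent_eq_zero _ _ (by omega), map_zero]
  rw [← hc, hqe, Polynomial.coeff_monomial, if_pos rfl]

end Homogeneous

/-! ### Sections over a Schubert variety -/

section Sections

variable {m n : ℕ}

/-- The punctured cone over the Schubert variety of `τ`, as the set of the multiples of the
Plücker vectors of the matrices in echelon form. -/
def echelonCone (τ : PluckerIndex m n) : Set (PluckerIndex m n → ℂ) :=
  {x | ∃ c : ℂ, c ≠ 0 ∧ ∃ a, Echelon τ a ∧ plucker a ≠ 0 ∧ x = c • plucker a}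

variable {τ : PluckerIndex m n}

theorem smul_mem_echelonCone {x : PluckerIndex m n → ℂ} (hx : x ∈ echelonCone τ) {t : ℂ}
    (ht : t ≠ 0) : t • x ∈ echelonCone τ := by
  obtain ⟨c, hc, a, ha, h0, rfl⟩ := hx
  exact ⟨t * c, mul_ne_zero ht hc, a, ha, h0, by rw [smul_smul]⟩

theorem plucker_mem_echelonCone {a : Fin n → Fin m → ℂ} (ha : Echelon τ a) (h0 : plucker a ≠ 0) :
    plucker a ∈ echelonCone τ := ⟨1, one_ne_zero, a, ha, h0, (one_smul _ _).symm⟩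

theorem eval_echelonCone_eq_zero {P : MvPolynomial (PluckerIndex m n) ℂ} {k : ℕ}
    (hP : P.IsHomogeneous k) (h : ∀ a, Echelon τ a → MvPolynomial.eval (plucker a) P = 0)
    {x : PluckerIndex m n → ℂ} (hx : x ∈ echelonCone τ) : MvPolynomial.eval x P = 0 := by
  obtain ⟨c, hc, a, ha, h0, rfl⟩ := hx
  rw [eval_smul_of_isHomogeneous hP, h a ha, mul_zero]

theorem polynomial_mem_sections {X : Set (PluckerIndex m n → ℂ)} {P : MvPolynomial (PluckerIndex m n) ℂ}
    {k : ℕ} (hP : P.IsHomogeneous k) : (fun x : X => MvPolynomial.eval x.1 P) ∈ sections X k :=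
  fun _ => ⟨0, P, 1, by rwa [zero_add], MvPolynomial.isHomogeneous_one _ _, by simp, by simp⟩

/-- A section that vanishes on the open cell vanishes. -/
theorem section_eq_zero {k : ℕ} {g : echelonCone τ → ℂ} (hg : g ∈ sections (echelonCone τ) k)
    (h : ∀ x : echelonCone τ, x.1 τ * g x = 0) : g = 0 := by
  funext x
  obtain ⟨d, p, q, hp, hq, hqx, hpq⟩ := hg x
  have hprod : ∀ a, Echelon τ a → plucker a τ * MvPolynomial.eval (plucker a) (q * p) = 0 := by
    intro a ha
    by_cases h0 : plucker a = 0
    · simp [h0]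
    · by_cases hqa : MvPolynomial.eval (plucker a) q = 0
      · simp [hqa]
      · have h1 := hpq ⟨_, plucker_mem_echelonCone ha h0⟩ hqa
        have h2 := h ⟨_, plucker_mem_echelonCone ha h0⟩
        rw [h1] at h2
        rw [map_mul, mul_left_comm]
        have h3 : plucker a τ * MvPolynomial.eval (plucker a) p = 0 := by
          have := congrArg (· * MvPolynomial.eval (plucker a) q) h2
          simpa [mul_assoc, div_mul_cancel₀ _ hqa] using this
        rw [h3, mul_zero]
  rcases eval_eq_zero_of_mul (by simpa using eval_eq_zero_of_X_mul hprod) with h | h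
  · exact absurd (eval_echelonCone_eq_zero hq h x.2) hqx
  · rw [hpq x hqx, eval_echelonCone_eq_zero hp h x.2, zero_div]
    rfl

theorem section_smul {k : ℕ} {f : echelonCone τ → ℂ} (hf : f ∈ sections (echelonCone τ) k)
    (x : echelonCone τ) {t : ℂ} (ht : t ≠ 0) :
    f ⟨t • x.1, smul_mem_echelonCone x.2 ht⟩ = t ^ k * f x := by
  obtain ⟨d, p, q, hp, hq, hqx, hpq⟩ := hf x
  have hqt : MvPolynomial.eval (t • x.1) q ≠ 0 := by
    rw [eval_smul_of_isHomogeneous hq]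
    exact mul_ne_zero (pow_ne_zero _ ht) hqx
  have e1 := hpq ⟨t • x.1, smul_mem_echelonCone x.2 ht⟩ hqt
  have e2 := hpq x hqx
  have e3 := eval_smul_of_isHomogeneous hp t x.1
  have e4 := eval_smul_of_isHomogeneous hq t x.1
  rw [e1, e2]
  change MvPolynomial.eval (t • x.1) p / MvPolynomial.eval (t • x.1) q = _
  rw [e3, e4, pow_add, mul_assoc, mul_div_mul_left _ _ (pow_ne_zero _ ht), mul_div_assoc]

/-- The linear form whose value on a Plücker vector is the minor with the columns `τ`, the `i`-th
of them replaced by the column `q`. -/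
theorem exists_columnForm (τ : PluckerIndex m n) (i : Fin n) (q : Fin m) :
    ∃ Q : MvPolynomial (PluckerIndex m n) ℂ, Q.IsHomogeneous 1 ∧ ∀ a : Fin n → Fin m → ℂ,
      MvPolynomial.eval (plucker a) Q = columnMinor (Function.update τ.emb i q) a := by
  rcases columnMinor_cases (Function.update τ.emb i q) with h | ⟨I, σ, -, -, h⟩
  · exact ⟨0, MvPolynomial.isHomogeneous_zero _ _ _, fun a => by simp [h]⟩
  · refine ⟨MvPolynomial.C ((Equiv.Perm.sign σ : ℤ) : ℂ) * MvPolynomial.X I, ?_, fun a => ?_⟩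
    · have := (MvPolynomial.isHomogeneous_C (PluckerIndex m n) ((Equiv.Perm.sign σ : ℤ) : ℂ)).mul
        (MvPolynomial.isHomogeneous_X ℂ I)
      rwa [zero_add] at this
    · simp [h]

/-- Cramer's rule: the Plücker coordinates in terms of those which differ from `p_τ` by one
column. -/
theorem plucker_mul_pow (τ J : PluckerIndex m n) (a : Fin n → Fin m → ℂ) :
    plucker a J * plucker a τ ^ n = plucker a τ *
      Matrix.det (Matrix.of fun i j => columnMinor (Function.update τ.emb i (J.emb j)) a) := by
  set A : Matrix (Fin n) (Fin n) ℂ := Matrix.of fun i j => a i (τ.emb j) with hA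
  set B : Matrix (Fin n) (Fin n) ℂ := Matrix.of fun i j => a i (J.emb j) with hB
  have hC : (Matrix.of fun i j => columnMinor (Function.update τ.emb i (J.emb j)) a) =
      A.adjugate * B := by
    ext i j
    have h1 : (A.adjugate * B) i j = A.cramer (fun l => a l (J.emb j)) i := by
      rw [Matrix.cramer_eq_adjugate_mulVec]
      rfl
    rw [h1, Matrix.cramer_apply, Matrix.of_apply, columnMinor]
    congr 1
    ext k l
    rcases eq_or_ne l i with rfl | hl
    · simp
    · simp [hl, hA]
  have hdet : A.det * A.adjugate.det = A.det ^ n := by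
    rw [← Matrix.det_mul, Matrix.mul_adjugate, Matrix.det_smul, Matrix.det_one, mul_one,
      Fintype.card_fin]
  rw [hC, Matrix.det_mul, ← mul_assoc, show plucker a τ = A.det from rfl, hdet, mul_comm]
  rfl

/-- A zero of all polynomials that vanish on the cone lies in the cone if it lies in the affine
chart `p_τ ≠ 0`. -/
theorem mem_echelonCone_of_ne_zero {y : PluckerIndex m n → ℂ} (hy : y τ ≠ 0)
    (h : ∀ P : MvPolynomial (PluckerIndex m n) ℂ,
      (∀ x ∈ echelonCone τ, MvPolynomial.eval x P = 0) → MvPolynomial.eval y P = 0) :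
    y ∈ echelonCone τ := by
  -- The entries of the matrix `a` are the coordinates of `y` in the places that differ from `τ` by
  -- one column.
  choose Q hQ hQe using exists_columnForm (m := m) τ
  let a : Fin n → Fin m → ℂ := fun i q => MvPolynomial.eval y (Q i q)
  have ha : Echelon τ a := by
    intro i q hq
    refine h _ fun x hx => eval_echelonCone_eq_zero (hQ i q) (fun b hb => ?_) hx
    rw [hQe]
    refine hb.columnMinor_eq_zero (i := i) fun j hj => ?_
    rcases eq_or_lt_of_le hj with rfl | hj
    · simpa using hq
    · rw [Function.update_of_ne hj.ne']
      exact τ.emb_strictMono hj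
  have hJ : ∀ J, y J * y τ ^ n = y τ * plucker a J := by
    intro J
    let E : MvPolynomial (PluckerIndex m n) ℂ := MvPolynomial.X J * MvPolynomial.X τ ^ n -
      MvPolynomial.X τ * Matrix.det (Matrix.of fun i j => Q i (J.emb j))
    have hE : ∀ z, MvPolynomial.eval z E = z J * z τ ^ n - z τ *
        Matrix.det (Matrix.of fun i j => MvPolynomial.eval z (Q i (J.emb j))) := by
      intro z
      simp only [E, map_sub, map_mul, map_pow, MvPolynomial.eval_X, RingHom.map_det]
      rfl
    have := h E fun x hx => by
      obtain ⟨c, hc, b, hb, h0, rfl⟩ := hx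
      have h1 : (Matrix.of fun i j => MvPolynomial.eval (c • plucker b) (Q i (J.emb j))) =
          c • Matrix.of fun i j => columnMinor (Function.update τ.emb i (J.emb j)) b := by
        ext i j
        simp [eval_smul_of_isHomogeneous (hQ i _), hQe]
      rw [hE, h1, Matrix.det_smul, Fintype.card_fin]
      have h2 := plucker_mul_pow τ J b
      simp only [Pi.smul_apply, smul_eq_mul]
      linear_combination c ^ (n + 1) * h2
    rw [hE, sub_eq_zero] at this
    exact this
  have hpow : y τ ^ n ≠ 0 := pow_ne_zero _ hy
  refine ⟨y τ / y τ ^ n, div_ne_zero hy hpow, a, ha, fun h0 => ?_, funext fun J => ?_⟩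
  · have := hJ τ
    rw [h0, Pi.zero_apply, mul_zero] at this
    exact mul_ne_zero hy hpow this
  · rw [Pi.smul_apply, smul_eq_mul, div_mul_eq_mul_div, eq_div_iff hpow, hJ]

/-- By the Nullstellensatz, a section becomes polynomial after multiplication by a power
of `p_τ`. -/
theorem exists_pow_mul_section {k : ℕ} {f : echelonCone τ → ℂ}
    (hf : f ∈ sections (echelonCone τ) k) :
    ∃ (d : ℕ) (P : MvPolynomial (PluckerIndex m n) ℂ), P.IsHomogeneous (d + k) ∧
      ∀ x : echelonCone τ, x.1 τ ^ d * f x = MvPolynomial.eval x.1 P := by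
  -- The ideal of denominators of `f`.
  let I : Ideal (MvPolynomial (PluckerIndex m n) ℂ) :=
    { carrier := {h | ∃ P, ∀ x : echelonCone τ, MvPolynomial.eval x.1 h * f x =
        MvPolynomial.eval x.1 P}
      zero_mem' := ⟨0, fun x => by simp⟩
      add_mem' := by
        rintro g h ⟨P, hP⟩ ⟨Q, hQ⟩
        exact ⟨P + Q, fun x => by rw [map_add, add_mul, hP, hQ, map_add]⟩
      smul_mem' := by
        rintro c h ⟨P, hP⟩
        exact ⟨c * P, fun x => by rw [smul_eq_mul, map_mul, mul_assoc, hP, map_mul]⟩ }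
  have hrad : MvPolynomial.X τ ∈ I.radical := by
    rw [← MvPolynomial.vanishingIdeal_zeroLocus_eq_radical (K := ℂ) I]
    intro y hy
    simp only [MvPolynomial.mem_zeroLocus_iff, MvPolynomial.aeval_eq_eval] at hy
    rw [MvPolynomial.aeval_X]
    by_contra hyτ
    have hyX : y ∈ echelonCone τ := mem_echelonCone_of_ne_zero hyτ fun P hP =>
      hy P ⟨0, fun x => by rw [hP x.1 x.2, zero_mul, map_zero]⟩
    obtain ⟨d, p, q, hp, hq, hqy, hpq⟩ := hf ⟨y, hyX⟩
    -- The identity `q f = p` is known only where `q ≠ 0`, hence the square.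
    have := hy (q * q) ⟨q * p, fun x => by
      by_cases hx : MvPolynomial.eval x.1 q = 0
      · simp [hx]
      · rw [hpq x hx, map_mul, map_mul, mul_assoc, mul_div_cancel₀ _ hx]⟩
    have h2 : MvPolynomial.eval y q * MvPolynomial.eval y q = 0 := by rw [← map_mul]; exact this
    exact hqy (mul_self_eq_zero.1 h2)
  obtain ⟨d, P, hP⟩ := hrad
  refine ⟨d, MvPolynomial.homogeneousComponent (d + k) P,
    MvPolynomial.homogeneousComponent_isHomogeneous _ _, fun x => ?_⟩
  refine (eval_homogeneousComponent fun t ht => ?_).symm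
  have := hP ⟨t • x.1, smul_mem_echelonCone x.2 ht⟩
  rw [section_smul hf x ht] at this
  rw [← this]
  simp only [map_pow, MvPolynomial.eval_X, Pi.smul_apply, smul_eq_mul]
  ring

/-- Projective normality: the sections of `𝒪(k)` over a Schubert variety are the restrictions of
homogeneous polynomials of degree `k`. -/
theorem mem_sections_iff {k : ℕ} {f : echelonCone τ → ℂ} :
    f ∈ sections (echelonCone τ) k ↔ ∃ P : MvPolynomial (PluckerIndex m n) ℂ, P.IsHomogeneous k ∧
      ∀ x : echelonCone τ, f x = MvPolynomial.eval x.1 P := by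
  constructor
  · intro hf
    obtain ⟨d, hd⟩ := exists_pow_mul_section hf
    -- The factors `p_τ` are removed one by one.
    induction d with
    | zero =>
      obtain ⟨P, hP, h⟩ := hd
      exact ⟨P, by rwa [zero_add] at hP, fun x => by rw [← h x, pow_zero, one_mul]⟩
    | succ d ih =>
      obtain ⟨P, hP, h⟩ := hd
      rw [add_right_comm] at hP
      obtain ⟨Q, hQ, hPQ⟩ := exists_factor (τ := τ) hP fun a ha haτ => by
        by_cases h0 : plucker a = 0
        · rw [h0]
          exact eval_zero_of_isHomogeneous hP (Nat.succ_ne_zero _)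
        · have := h ⟨_, plucker_mem_echelonCone ha h0⟩
          rw [← this]
          change plucker a τ ^ (d + 1) * _ = 0
          rw [haτ, zero_pow (Nat.succ_ne_zero d), zero_mul]
      refine ih ⟨Q, hQ, fun x => ?_⟩
      have hsec : (fun x : echelonCone τ => x.1 τ ^ d * f x - MvPolynomial.eval x.1 Q) ∈
          sections (echelonCone τ) (d + k) := by
        refine Submodule.sub_mem _ (fun x => ?_) (polynomial_mem_sections hQ)
        obtain ⟨e, p, q, hp, hq, hqx, hpq⟩ := hf x
        refine ⟨e, MvPolynomial.X τ ^ d * p, q, ?_, hq, hqx, fun y hy => ?_⟩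
        · have := ((MvPolynomial.isHomogeneous_X ℂ τ).pow d).mul hp
          rwa [one_mul, add_left_comm] at this
        · simp [hpq y hy, mul_div_assoc]
      have := section_eq_zero hsec fun y => by
        obtain ⟨y, c, hc, a, ha, h0, rfl⟩ := y
        have h1 := h ⟨_, c, hc, a, ha, h0, rfl⟩
        rw [eval_smul_of_isHomogeneous hP, hPQ a ha] at h1
        rw [eval_smul_of_isHomogeneous hQ]
        simp only [Pi.smul_apply, smul_eq_mul] at h1 ⊢
        linear_combination h1
      exact sub_eq_zero.1 (congrFun this x)
  · rintro ⟨P, hP, h⟩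
    rw [show f = fun x => MvPolynomial.eval x.1 P from funext h]
    exact polynomial_mem_sections hP

end Sections

/-! ### The cone over a Schubert variety and its symmetries -/

section Planes

variable {m n : ℕ}

theorem mem_flag {d : ℕ} {v : Fin m → ℂ} : v ∈ flag m d ↔ ∀ q : Fin m, d ≤ q → v q = 0 := by
  constructor
  · intro hv q hq
    have : flag m d ≤ LinearMap.ker (LinearMap.proj (R := ℂ) (φ := fun _ : Fin m => ℂ) q) := by
      rw [flag, Submodule.span_le]
      rintro _ ⟨p, hp, rfl⟩
      have : p ≠ q := by
        rintro rfl
        exact absurd hp (not_lt.2 hq)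
      simp [this.symm]
    exact this hv
  · intro h
    rw [← Finset.univ_sum_single v]
    refine Submodule.sum_mem _ fun q _ => ?_
    by_cases hq : d ≤ q
    · rw [h q hq, Pi.single_zero]
      exact Submodule.zero_mem _
    · have : (Pi.single q (v q) : Fin m → ℂ) = v q • Pi.single q 1 := by
        rw [← Pi.single_smul, smul_eq_mul, mul_one]
      rw [this]
      exact Submodule.smul_mem _ _ (Submodule.subset_span ⟨q, not_le.1 hq, rfl⟩)

theorem finrank_flag {d : ℕ} (hd : d ≤ m) : Module.finrank ℂ (flag m d) = d := by
  have hli : LinearIndependent ℂ fun i : Fin d => (Pi.single (Fin.castLE hd i) 1 : Fin m → ℂ) := by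
    have := (Pi.basisFun ℂ (Fin m)).linearIndependent.comp _ (Fin.castLE_injective hd)
    convert this using 1
    funext i
    simp
  have : flag m d = Submodule.span ℂ
      (Set.range fun i : Fin d => (Pi.single (Fin.castLE hd i) 1 : Fin m → ℂ)) := by
    rw [flag]
    congr 1
    ext v
    constructor
    · rintro ⟨q, hq, rfl⟩
      exact ⟨⟨q, hq⟩, rfl⟩
    · rintro ⟨i, rfl⟩
      exact ⟨Fin.castLE hd i, i.2, rfl⟩
  rw [this, finrank_span_eq_card hli, Fintype.card_fin]

theorem flag_mono {d e : ℕ} (h : d ≤ e) : flag m d ≤ flag m e := fun _ hv =>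
  mem_flag.2 fun q hq => mem_flag.1 hv q (h.trans hq)

theorem finrank_inf_flag_le (P : Submodule ℂ (Fin m → ℂ)) {d e : ℕ} (hde : d ≤ e) (he : e ≤ m) :
    Module.finrank ℂ ↥(P ⊓ flag m e) ≤ Module.finrank ℂ ↥(P ⊓ flag m d) + (e - d) := by
  have h := Submodule.finrank_sup_add_finrank_inf_eq (P ⊓ flag m e) (flag m d)
  have h1 : P ⊓ flag m e ⊓ flag m d = P ⊓ flag m d := by
    rw [inf_assoc, inf_eq_right.2 (flag_mono hde)]
  have h2 : Module.finrank ℂ ↥(P ⊓ flag m e ⊔ flag m d) ≤ Module.finrank ℂ (flag m e) :=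
    Submodule.finrank_mono (sup_le inf_le_right (flag_mono hde))
  rw [h1, finrank_flag (hde.trans he)] at h
  rw [finrank_flag he] at h2
  omega

theorem plucker_ne_zero_iff (a : Fin n → Fin m → ℂ) :
    plucker a ≠ 0 ↔ LinearIndependent ℂ a := by
  constructor
  · intro h
    by_contra hli
    exact h (funext fun I => (pluckerForm I).map_linearDependent a hli)
  · intro hli h0
    -- The determinant composed with a left inverse is `1` on independent vectors, and it is a
    -- combination of the Plücker coordinates.
    obtain ⟨g, hg⟩ := LinearMap.exists_leftInverse_of_injective (Finsupp.linearCombination ℂ a)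
      (LinearMap.ker_eq_bot.2 hli)
    have h1 := alternating_eq_sum_plucker
      ((Matrix.detRowAlternating : (Fin n → ℂ) [⋀^Fin n]→ₗ[ℂ] ℂ).compLinearMap
        (Finsupp.linearEquivFunOnFinite ℂ ℂ (Fin n) ∘ₗ g)) a
    simp only [h0, Pi.zero_apply, zero_smul, Finset.sum_const_zero] at h1
    have h2 : (fun i => (Finsupp.linearEquivFunOnFinite ℂ ℂ (Fin n) ∘ₗ g) (a i)) =
        (1 : Matrix (Fin n) (Fin n) ℂ) := by
      funext i j
      have : g (a i) = Finsupp.single i 1 := by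
        have := LinearMap.congr_fun hg (Finsupp.single i 1)
        simpa using this
      rw [LinearMap.comp_apply, this, Matrix.one_apply]
      simp [Finsupp.single_apply]
    rw [AlternatingMap.compLinearMap_apply, h2] at h1
    exact one_ne_zero ((Matrix.det_one (R := ℂ) (n := Fin n)).symm.trans h1)

theorem exists_smul_plucker {a b : Fin n → Fin m → ℂ}
    (h : ∀ i, a i ∈ Submodule.span ℂ (Set.range b)) : ∃ c : ℂ, plucker a = c • plucker b := by
  have h' : ∀ i, ∃ M : Fin n → ℂ, ∑ j, M j • b j = a i := fun i =>
    (Submodule.mem_span_range_iff_exists_fun ℂ).1 (h i)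
  choose M hM using h'
  refine ⟨(Matrix.of M).det, funext fun I => ?_⟩
  have : (Matrix.of fun i j => a i (I.emb j)) =
      Matrix.of M * Matrix.of fun i j => b i (I.emb j) := by
    ext i j
    simp [← hM, Matrix.mul_apply]
  rw [plucker, this, Matrix.det_mul]
  rfl

/-- The set `η` as an index of a Plücker coordinate, with the numbering of the basis vectors that
starts from zero. -/
def shiftIndex (m : ℕ) (η : Finset ℕ) (hη : ∀ e ∈ η, 1 ≤ e ∧ e ≤ m) : PluckerIndex m η.card :=
  ⟨Finset.univ.filter fun q : Fin m => (q : ℕ) + 1 ∈ η, by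
    refine Finset.card_bij (fun q _ => (q : ℕ) + 1) (fun q hq => (Finset.mem_filter.1 hq).2) ?_ ?_
    · intro p _ q _ h
      exact Fin.ext (Nat.succ_injective h)
    · intro e he
      obtain ⟨h1, h2⟩ := hη e he
      refine ⟨⟨e - 1, by omega⟩, Finset.mem_filter.2 ⟨Finset.mem_univ _, ?_⟩, ?_⟩
      · simpa [Nat.sub_add_cancel h1] using he
      · simp [Nat.sub_add_cancel h1]⟩

variable {η : Finset ℕ} (hη : ∀ e ∈ η, 1 ≤ e ∧ e ≤ m)

theorem shiftIndex_mem (i : Fin η.card) : ((shiftIndex m η hη).emb i : ℕ) + 1 ∈ η :=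
  (Finset.mem_filter.1 (((shiftIndex m η hη).mem_iff _).2 ⟨i, rfl⟩)).2

theorem exists_shiftIndex {e : ℕ} (he : e ∈ η) :
    ∃ i, ((shiftIndex m η hη).emb i : ℕ) + 1 = e := by
  obtain ⟨h1, h2⟩ := hη e he
  have : (⟨e - 1, by omega⟩ : Fin m) ∈ (shiftIndex m η hη).1 :=
    Finset.mem_filter.2 ⟨Finset.mem_univ _, by simpa [Nat.sub_add_cancel h1] using he⟩
  obtain ⟨i, hi⟩ := ((shiftIndex m η hη).mem_iff _).1 this
  exact ⟨i, by rw [hi]; exact Nat.sub_add_cancel h1⟩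

theorem card_filter_shiftIndex (i : Fin η.card) :
    (η.filter (· ≤ ((shiftIndex m η hη).emb i : ℕ) + 1)).card = i + 1 := by
  have : η.filter (· ≤ ((shiftIndex m η hη).emb i : ℕ) + 1) =
      (Finset.Iic i).image fun j => ((shiftIndex m η hη).emb j : ℕ) + 1 := by
    ext e
    simp only [Finset.mem_filter, Finset.mem_image, Finset.mem_Iic]
    constructor
    · rintro ⟨he, hle⟩
      obtain ⟨j, rfl⟩ := exists_shiftIndex hη he
      exact ⟨j, (shiftIndex m η hη).emb_strictMono.le_iff_le.1
        (Fin.le_def.2 (Nat.le_of_succ_le_succ hle)), rfl⟩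
    · rintro ⟨j, hj, rfl⟩
      exact ⟨shiftIndex_mem hη j, Nat.succ_le_succ ((shiftIndex m η hη).emb_strictMono.monotone hj)⟩
  rw [this, Finset.card_image_of_injective, Fin.card_Iic]
  intro j k h
  exact (shiftIndex m η hη).emb_injective (Fin.ext (Nat.succ_injective h))

theorem mem_schubertPlanes_iff {P : Submodule ℂ (Fin m → ℂ)} :
    P ∈ schubertPlanes m η ↔ Module.finrank ℂ P = η.card ∧ ∀ i : Fin η.card,
      i + 1 ≤ Module.finrank ℂ ↥(P ⊓ flag m ((shiftIndex m η hη).emb i + 1)) := by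
  refine and_congr_right fun _ => ⟨fun h i => ?_, fun h d hd => ?_⟩
  · rw [← card_filter_shiftIndex hη i]
    exact h _ (shiftIndex_mem hη i)
  · obtain ⟨i, rfl⟩ := exists_shiftIndex hη hd
    rw [card_filter_shiftIndex hη i]
    exact h i

/-- Vectors in general position in an increasing sequence of subspaces. -/
theorem exists_linearIndependent_mem {V : Type*} [AddCommGroup V] [Module ℂ V]
    [FiniteDimensional ℂ V] (Q : ℕ → Submodule ℂ V) (k : ℕ)
    (hQ : ∀ i < k, i + 1 ≤ Module.finrank ℂ (Q i)) :
    ∃ b : Fin k → V, LinearIndependent ℂ b ∧ ∀ i : Fin k, b i ∈ Q i := by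
  induction k with
  | zero => exact ⟨Fin.elim0, linearIndependent_empty_type, fun i => i.elim0⟩
  | succ k ih =>
    obtain ⟨b, hb, hbQ⟩ := ih fun i hi => hQ i (by omega)
    obtain ⟨v, hv, hvb⟩ : ∃ v ∈ Q k, v ∉ Submodule.span ℂ (Set.range b) := by
      by_contra! hc
      have h1 := Submodule.finrank_mono (show Q k ≤ Submodule.span ℂ (Set.range b) from hc)
      rw [finrank_span_eq_card hb, Fintype.card_fin] at h1
      have := hQ k (by omega)
      omega
    refine ⟨Fin.snoc b v, linearIndependent_finSnoc.2 ⟨hb, hvb⟩, fun i => ?_⟩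
    refine Fin.lastCases ?_ (fun i => ?_) i
    · simpa using hv
    · simpa using hbQ i

/-- The planes of a Schubert variety are those spanned by the rows of matrices in echelon form. -/
theorem schubertCone_eq : schubertCone m η = echelonCone (shiftIndex m η hη) := by
  ext x
  constructor
  · rintro ⟨c, hc, a, ha, rfl⟩
    obtain ⟨hfin, hdim⟩ := (mem_schubertPlanes_iff hη).1 ha
    have hli : LinearIndependent ℂ a :=
      linearIndependent_iff_card_eq_finrank_span.2 (by rw [Fintype.card_fin]; exact hfin.symm)
    obtain ⟨b, hb, hbQ⟩ := exists_linearIndependent_mem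
      (fun i => if h : i < η.card then Submodule.span ℂ (Set.range a) ⊓
        flag m ((shiftIndex m η hη).emb ⟨i, h⟩ + 1) else ⊥) η.card fun i hi => by
          rw [dif_pos hi]
          exact hdim ⟨i, hi⟩
    simp only [Fin.is_lt, dif_pos, Fin.eta, Submodule.mem_inf] at hbQ
    have hspan : Submodule.span ℂ (Set.range b) = Submodule.span ℂ (Set.range a) := by
      refine Submodule.eq_of_le_of_finrank_eq (Submodule.span_le.2 ?_) ?_
      · rintro _ ⟨i, rfl⟩
        exact (hbQ i).1
      · rw [finrank_span_eq_card hb, finrank_span_eq_card hli]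
    obtain ⟨e, he⟩ := exists_smul_plucker (a := a) (b := b) fun i => by
      rw [hspan]
      exact Submodule.subset_span ⟨i, rfl⟩
    have ha0 := (plucker_ne_zero_iff a).2 hli
    have he0 : e ≠ 0 := by
      rintro rfl
      exact ha0 (by rw [he, zero_smul])
    exact ⟨c * e, mul_ne_zero hc he0, b, fun i j hj => mem_flag.1 (hbQ i).2 j hj,
      (plucker_ne_zero_iff b).2 hb, by rw [he, smul_smul]⟩
  · rintro ⟨c, hc, a, ha, h0, rfl⟩
    have hli := (plucker_ne_zero_iff a).1 h0
    refine ⟨c, hc, a, (mem_schubertPlanes_iff hη).2 ⟨?_, fun i => ?_⟩, rfl⟩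
    · rw [finrank_span_eq_card hli, Fintype.card_fin]
    · have hle : i + 1 ≤ η.card := i.2
      have hli' := hli.comp _ (Fin.castLE_injective hle)
      have := Submodule.finrank_mono (show Submodule.span ℂ (Set.range (a ∘ Fin.castLE hle)) ≤
          Submodule.span ℂ (Set.range a) ⊓ flag m ((shiftIndex m η hη).emb i + 1) from by
        rw [Submodule.span_le]
        rintro _ ⟨j, rfl⟩
        refine ⟨Submodule.subset_span ⟨_, rfl⟩, mem_flag.2 fun q hq => ha _ q ?_⟩
        refine lt_of_le_of_lt ((shiftIndex m η hη).emb_strictMono.monotone ?_)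
          (Fin.lt_def.2 (Nat.lt_of_succ_le hq))
        exact Fin.le_def.2 (Nat.le_of_lt_succ j.2))
      rwa [finrank_span_eq_card hli', Fintype.card_fin] at this

/-- A linear automorphism preserves a Schubert variety if it preserves those members of the flag
which bound the intervals of consecutive elements of `η` from above. -/
theorem compound_mem_schubertCone {g : Matrix (Fin m) (Fin m) ℂ} (hg : IsUnit g)
    (h : ∀ d ∈ η, ∃ e ∈ η, d ≤ e ∧ Finset.Ioc d e ⊆ η ∧ e ≤ m ∧ ∀ v ∈ flag m e, g.mulVec v ∈ flag m e)
    {x : PluckerIndex m η.card → ℂ} (hx : x ∈ schubertCone m η) :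
    compound g x ∈ schubertCone m η := by
  obtain ⟨c, hc, a, ⟨hfin, hdim⟩, rfl⟩ := hx
  rw [compound_smul, compound_plucker]
  have hinj : Function.Injective g.mulVecLin := Matrix.mulVec_injective_iff_isUnit.2 hg
  have hspan : Submodule.span ℂ (Set.range fun i => g.mulVec (a i)) =
      (Submodule.span ℂ (Set.range a)).map g.mulVecLin := by
    rw [Submodule.map_span, ← Set.range_comp]
    rfl
  refine ⟨c, hc, _, ⟨?_, fun d hd => ?_⟩, rfl⟩
  · rw [hspan]
    exact (Submodule.equivMapOfInjective _ hinj _).symm.finrank_eq.trans hfin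
  · rw [hspan]
    obtain ⟨e, he, hde, hIoc, hem, hge⟩ := h d hd
    have h1 := finrank_inf_flag_le ((Submodule.span ℂ (Set.range a)).map g.mulVecLin) hde hem
    have h2 : Module.finrank ℂ ↥(Submodule.span ℂ (Set.range a) ⊓ flag m e) ≤
        Module.finrank ℂ ↥((Submodule.span ℂ (Set.range a)).map g.mulVecLin ⊓ flag m e) := by
      rw [(Submodule.equivMapOfInjective _ hinj _).finrank_eq]
      refine Submodule.finrank_mono ?_
      rintro _ ⟨v, hv, rfl⟩
      exact ⟨⟨v, hv.1, rfl⟩, hge v hv.2⟩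
    -- The condition for `e` implies that for `d`, since `d + 1, …, e` all lie in `η`.
    have h3 : (η.filter (· ≤ d)).card + (e - d) ≤ (η.filter (· ≤ e)).card := by
      rw [← Nat.card_Ioc, ← Finset.card_union_of_disjoint]
      · refine Finset.card_le_card fun q hq => ?_
        rcases Finset.mem_union.1 hq with hq | hq
        · rw [Finset.mem_filter] at hq ⊢
          exact ⟨hq.1, hq.2.trans hde⟩
        · exact Finset.mem_filter.2 ⟨hIoc hq, (Finset.mem_Ioc.1 hq).2⟩
      · rw [Finset.disjoint_left]
        intro q hq hq'
        exact absurd (Finset.mem_filter.1 hq).2 (not_le.2 (Finset.mem_Ioc.1 hq').1)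
    have h4 := hdim e he
    omega

/-- The exponential of an endomorphism preserves its invariant subspaces. -/
theorem exp_mulVec_mem {P : Submodule ℂ (Fin m → ℂ)} {A : Matrix (Fin m) (Fin m) ℂ}
    (h : ∀ v ∈ P, A.mulVec v ∈ P) {v : Fin m → ℂ} (hv : v ∈ P) :
    (NormedSpace.exp A).mulVec v ∈ P := by
  let _ : NormedRing (Matrix (Fin m) (Fin m) ℂ) := Matrix.linftyOpNormedRing
  let _ : NormedAlgebra ℂ (Matrix (Fin m) (Fin m) ℂ) := Matrix.linftyOpNormedAlgebra
  have hpow : ∀ k : ℕ, (A ^ k).mulVec v ∈ P := by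
    intro k
    induction k with
    | zero => simpa using hv
    | succ k ih =>
      rw [pow_succ', ← Matrix.mulVec_mulVec]
      exact h _ ih
  have hsum := NormedSpace.exp_series_hasSum_exp' (𝕂 := ℂ) A
  have hsum' := hsum.map (AddMonoidHom.mk' (fun M : Matrix (Fin m) (Fin m) ℂ => M.mulVec v)
    fun M N => Matrix.add_mulVec M N v) (by
      change Continuous fun M : Matrix (Fin m) (Fin m) ℂ => M.mulVec v
      fun_prop)
  refine (Submodule.closed_of_finiteDimensional P).mem_of_tendsto hsum'
    (Filter.Eventually.of_forall fun s => ?_)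
  refine P.sum_mem fun k _ => ?_
  change (((k.factorial : ℂ)⁻¹) • A ^ k).mulVec v ∈ P
  rw [Matrix.smul_mulVec]
  exact P.smul_mem _ (hpow k)

end Planes

/-! ### Multilinear functions of vectors and their derivatives -/

section Multilinear

variable {κ : Type*} [Fintype κ] {k : ℕ}

theorem multilinear_expand [DecidableEq κ] {M : Type*} [AddCommGroup M] [Module ℂ M]
    (f : MultilinearMap ℂ (fun _ : Fin k => κ → ℂ) M) (v : Fin k → κ → ℂ) :
    f v = ∑ p : Fin k → κ, (∏ i, v i (p i)) • f fun i => Pi.single (p i) 1 := by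
  have hv : v = fun i => ∑ q, v i q • (Pi.single q 1 : κ → ℂ) := by
    funext i
    conv_lhs => rw [← Finset.univ_sum_single (v i)]
    refine Finset.sum_congr rfl fun q _ => ?_
    rw [← Pi.single_smul, smul_eq_mul, mul_one]
  conv_lhs => rw [hv, MultilinearMap.map_sum]
  exact Finset.sum_congr rfl fun p _ => f.map_smul_univ _ _

theorem multilinear_continuous (f : MultilinearMap ℂ (fun _ : Fin k => κ → ℂ) ℂ) :
    Continuous f := by
  classical
  have : (f : (Fin k → κ → ℂ) → ℂ) = fun v =>
      ∑ p : Fin k → κ, (∏ i, v i (p i)) • f fun i => Pi.single (p i) 1 :=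
    funext (multilinear_expand f)
  rw [this]
  fun_prop

theorem hasDerivAt_multilinear (f : MultilinearMap ℂ (fun _ : Fin k => κ → ℂ) ℂ)
    {y : Fin k → ℂ → κ → ℂ} {y' : Fin k → κ → ℂ} {t : ℂ} (hy : ∀ i, HasDerivAt (y i) (y' i) t) :
    HasDerivAt (fun s => f fun i => y i s)
      (∑ i, f (Function.update (fun j => y j t) i (y' i))) t := by
  let F : ContinuousMultilinearMap ℂ (fun _ : Fin k => κ → ℂ) ℂ := ⟨f, multilinear_continuous f⟩
  have := (HasFDerivAt.multilinear_comp F fun i => (hy i).hasFDerivAt).hasDerivAt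
  refine this.congr_deriv ?_
  rw [sum_apply]
  refine Finset.sum_congr rfl fun i _ => ?_
  change f (Function.update (fun j => y j t) i ((1 : ℂ) • y' i)) = _
  rw [one_smul]

theorem hasDerivAt_exp_mulVec {m : ℕ} (A : Matrix (Fin m) (Fin m) ℂ) (v : Fin m → ℂ) :
    HasDerivAt (fun t : ℂ => (NormedSpace.exp (-(t • A))).mulVec v) (-(A.mulVec v)) 0 := by
  let _ : NormedRing (Matrix (Fin m) (Fin m) ℂ) := Matrix.linftyOpNormedRing
  let _ : NormedAlgebra ℂ (Matrix (Fin m) (Fin m) ℂ) := Matrix.linftyOpNormedAlgebra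
  have h := hasDerivAt_exp_smul_const (𝕂 := ℂ) (-A) (0 : ℂ)
  rw [zero_smul, NormedSpace.exp_zero, one_mul] at h
  let e : Matrix (Fin m) (Fin m) ℂ →ₗ[ℂ] (Fin m → ℂ) :=
    { toFun := fun M => M.mulVec v
      map_add' := fun M N => Matrix.add_mulVec M N v
      map_smul' := fun c M => Matrix.smul_mulVec c M v }
  have h2 := (LinearMap.toContinuousLinearMap e).hasFDerivAt.comp_hasDerivAt (0 : ℂ) h
  have h3 : (LinearMap.toContinuousLinearMap e) (-A) = -(A.mulVec v) := Matrix.neg_mulVec v A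
  refine (h2.congr_deriv h3).congr_of_eventuallyEq (Filter.Eventually.of_forall fun t => ?_)
  change (NormedSpace.exp (-(t • A))).mulVec v = (NormedSpace.exp (t • -A)).mulVec v
  rw [smul_neg]

/-- The infinitesimal action of a matrix on decomposable multivectors. -/
theorem hasDerivAt_compound {m n : ℕ} (A : Matrix (Fin m) (Fin m) ℂ) (a : Fin n → Fin m → ℂ) :
    HasDerivAt (fun t : ℂ => compound (NormedSpace.exp (-(t • A))) (plucker a))
      (-∑ i, plucker (Function.update a i (A.mulVec (a i)))) 0 := by
  rw [hasDerivAt_pi]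
  intro I
  have h := hasDerivAt_multilinear (pluckerForm I).toMultilinearMap
    fun i => hasDerivAt_exp_mulVec A (a i)
  simp only [zero_smul, neg_zero, NormedSpace.exp_zero, Matrix.one_mulVec] at h
  refine (h.congr_deriv ?_).congr_of_eventuallyEq (Filter.Eventually.of_forall fun t => ?_)
  · rw [Pi.neg_apply, Finset.sum_apply, ← Finset.sum_neg_distrib]
    exact Finset.sum_congr rfl fun i _ => (pluckerForm I).map_update_neg a i _
  · exact congrFun (compound_plucker _ a) I

end Multilinear

/-! ### Unipotent operators on tensor powers -/

section Unipotent

variable {E : Type*} [AddCommGroup E] [Module ℂ E]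

/-- If `D x = z` and `D z = 0`, then a subspace of the tensor power that is stable under `D` and
contains `x ⊗ ⋯ ⊗ x` contains `(x + z) ⊗ ⋯ ⊗ (x + z)`, because this is the image of `x ⊗ ⋯ ⊗ x`
under the exponential of `D`. -/
theorem tprod_add_mem {k : ℕ} {D : Module.End ℂ E} {x z : E} (hx : D x = z) (hz : D z = 0)
    {C : Submodule ℂ (⨂[ℂ]^k E)} (hC : ∀ y ∈ C, tensorDer (Fin k) D y ∈ C)
    (h : PiTensorProduct.tprod ℂ (fun _ : Fin k => x) ∈ C) :
    PiTensorProduct.tprod ℂ (fun _ : Fin k => x + z) ∈ C := by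
  classical
  let g : Finset (Fin k) → ⨂[ℂ]^k E := fun s =>
    PiTensorProduct.tprod ℂ (s.piecewise (fun _ => z) fun _ => x)
  have hg : ∀ s, tensorDer (Fin k) D (g s) = ∑ i ∈ sᶜ, g (insert i s) := by
    intro s
    rw [tensorDer_tprod, ← Finset.sum_add_sum_compl s, Finset.sum_eq_zero, zero_add]
    · refine Finset.sum_congr rfl fun i hi => ?_
      rw [Finset.mem_compl] at hi
      simp only [g]
      rw [Finset.piecewise_insert, Finset.piecewise_eq_of_notMem _ _ _ hi, hx]
    · intro i hi
      rw [Finset.piecewise_eq_of_mem _ _ _ hi, hz]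
      exact MultilinearMap.map_coord_zero _ i (Function.update_self _ _ _)
  -- The elementary symmetric terms `T j` satisfy `D (T j) = (j + 1) T (j + 1)`.
  let T : ℕ → ⨂[ℂ]^k E := fun j => ∑ s ∈ Finset.powersetCard j Finset.univ, g s
  have hT : ∀ j, tensorDer (Fin k) D (T j) = ((j + 1 : ℕ) : ℂ) • T (j + 1) := by
    intro j
    simp only [T, map_sum, hg]
    rw [Finset.smul_sum]
    have : ∀ s ∈ Finset.powersetCard (j + 1) (Finset.univ : Finset (Fin k)),
        ((j + 1 : ℕ) : ℂ) • g s = ∑ i ∈ s, g s := by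
      intro s hs
      rw [Finset.sum_const, (Finset.mem_powersetCard.1 hs).2, Nat.cast_smul_eq_nsmul]
    rw [Finset.sum_congr rfl this, Finset.sum_sigma', Finset.sum_sigma']
    refine Finset.sum_bij' (fun p _ => ⟨insert p.2 p.1, p.2⟩) (fun p _ => ⟨p.1.erase p.2, p.2⟩)
      ?_ ?_ ?_ ?_ ?_
    · rintro ⟨s, i⟩ h
      simp only [Finset.mem_sigma, Finset.mem_powersetCard, Finset.mem_compl] at h ⊢
      exact ⟨⟨Finset.subset_univ _, by rw [Finset.card_insert_of_notMem h.2, h.1.2]⟩,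
        Finset.mem_insert_self _ _⟩
    · rintro ⟨s, i⟩ h
      simp only [Finset.mem_sigma, Finset.mem_powersetCard, Finset.mem_compl] at h ⊢
      exact ⟨⟨Finset.subset_univ _, by rw [Finset.card_erase_of_mem h.2, h.1.2]; rfl⟩,
        Finset.notMem_erase _ _⟩
    · rintro ⟨s, i⟩ h
      simp only [Finset.mem_sigma, Finset.mem_compl] at h
      simp [Finset.erase_insert h.2]
    · rintro ⟨s, i⟩ h
      simp only [Finset.mem_sigma] at h
      simp [Finset.insert_erase h.2]
    · rintro ⟨s, i⟩ _
      rfl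
  have hTC : ∀ j, T j ∈ C := by
    intro j
    induction j with
    | zero => simpa [T, g] using h
    | succ j ih =>
      have := hC _ ih
      rw [hT] at this
      exact (C.smul_mem_iff (Nat.cast_ne_zero.2 (Nat.succ_ne_zero j))).1 this
  have hsum : PiTensorProduct.tprod ℂ (fun _ : Fin k => x + z) =
      ∑ j ∈ Finset.range (k + 1), T j := by
    have h1 := (PiTensorProduct.tprod ℂ : MultilinearMap ℂ (fun _ : Fin k => E) _).map_add_univ
      (fun _ => z) fun _ => x
    rw [show (fun _ : Fin k => x + z) = (fun _ => z) + fun _ => x from funext fun _ => add_comm x z,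
      h1, ← Finset.powerset_univ, Finset.sum_powerset, Finset.card_univ, Fintype.card_fin]
  rw [hsum]
  exact C.sum_mem fun j _ => hTC j

end Unipotent

/-! ### Reaching a Schubert variety by transvections -/

section Reach

variable {m n : ℕ}

theorem plucker_update_add (b : Fin n → Fin m → ℂ) (i : Fin n) (v w : Fin m → ℂ) :
    plucker (Function.update b i (v + w)) =
      plucker (Function.update b i v) + plucker (Function.update b i w) :=
  funext fun I => (pluckerForm I).map_update_add b i v w

theorem plucker_smul_rows (c : Fin n → ℂ) (a : Fin n → Fin m → ℂ) :
    plucker (fun i => c i • a i) = (∏ i, c i) • plucker a :=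
  funext fun I => (pluckerForm I).toMultilinearMap.map_smul_univ c a

theorem plucker_continuous : Continuous (plucker : (Fin n → Fin m → ℂ) → PluckerIndex m n → ℂ) := by
  unfold plucker
  refine continuous_pi fun I => ?_
  refine Continuous.matrix_det ?_
  refine continuous_matrix fun i j => ?_
  change Continuous fun a : Fin n → Fin m → ℂ => a i (I.emb j)
  fun_prop

/-- A closed conical condition that is preserved by adding to the `i`-th vector, as long as it is
the basis vector `e_{τ_i}`, combinations of the previous basis vectors, holds on the whole
Schubert variety of `τ` if it holds at the point `e_{τ_1} ∧ ⋯ ∧ e_{τ_n}`. -/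
theorem echelonCone_induction {τ : PluckerIndex m n} {p : (PluckerIndex m n → ℂ) → Prop}
    (hbase : p (plucker fun i => Pi.single (τ.emb i) 1))
    (hsmul : ∀ (c : ℂ) x, p x → p (c • x)) (hclosed : IsClosed {x | p x})
    (hstep : ∀ (b : Fin n → Fin m → ℂ) (i : Fin n) (w : Fin m → ℂ),
      (∀ j, b j (τ.emb i) = if j = i then 1 else 0) → (∀ q, τ.emb i ≤ q → w q = 0) →
      p (plucker b) → p (plucker (Function.update b i (b i + w))))
    {x : PluckerIndex m n → ℂ} (hx : x ∈ echelonCone τ) : p x := by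
  obtain ⟨c, -, a, ha, -, rfl⟩ := hx
  refine hsmul c _ ?_
  -- Matrices with ones in the pivot positions are obtained by changing the rows one after another.
  have hunit : ∀ a, Echelon τ a → (∀ i, a i (τ.emb i) = 1) → p (plucker a) := by
    intro a ha h1
    have hl : ∀ l ≤ n, p (plucker fun i => if (i : ℕ) < l then a i else Pi.single (τ.emb i) 1) := by
      intro l
      induction l with
      | zero => intro _; simpa using hbase
      | succ l ih =>
        intro hl
        have hs := hstep _ ⟨l, hl⟩ (a ⟨l, hl⟩ - Pi.single (τ.emb ⟨l, hl⟩) 1) (fun j => ?_)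
          (fun q hq => ?_) (ih (Nat.le_of_succ_le hl))
        · convert hs using 2
          funext i
          rcases eq_or_ne i ⟨l, hl⟩ with rfl | hi
          · simp
          · have : (i : ℕ) ≠ l := fun h => hi (Fin.ext h)
            rw [Function.update_of_ne hi]
            by_cases h : (i : ℕ) < l
            · simp [h, Nat.lt_succ_of_lt h]
            · rw [if_neg h, if_neg (by omega)]
        · rcases lt_trichotomy j ⟨l, hl⟩ with h | rfl | h
          · rw [if_pos (Fin.lt_def.1 h), if_neg h.ne, ha j _ (τ.emb_strictMono h)]
          · simp
          · have h' : ¬ (j : ℕ) < l := by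
              have := Fin.lt_def.1 h
              simp only at this
              omega
            rw [if_neg h', if_neg h.ne', Pi.single_eq_of_ne (τ.emb_strictMono h).ne]
        · rcases eq_or_lt_of_le hq with rfl | hq
          · simp [h1]
          · simp [ha _ q hq, hq.ne']
    simpa using hl n le_rfl
  have hpivot : ∀ a, Echelon τ a → (∀ i, a i (τ.emb i) ≠ 0) → p (plucker a) := by
    intro a ha h0
    have := hsmul (∏ i, a i (τ.emb i)) _ (hunit (fun i => (a i (τ.emb i))⁻¹ • a i)
      (fun i j hj => by simp [ha i j hj]) fun i => by simp [h0 i])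
    rw [← plucker_smul_rows] at this
    simpa [smul_smul, h0] using this
  -- Every matrix in echelon form is a limit of such matrices with nonzero pivots.
  let γ : ℂ → Fin n → Fin m → ℂ := fun t i => a i + t • Pi.single (τ.emb i) 1
  have hγ : Continuous fun t => plucker (γ t) := by
    refine plucker_continuous.comp (continuous_pi fun i => ?_)
    fun_prop
  have h0 : plucker (γ 0) = plucker a := by simp [γ]
  rw [← h0]
  refine hclosed.mem_of_tendsto (f := fun t => plucker (γ t)) (b := nhdsWithin 0 {0}ᶜ)
    (hγ.tendsto 0 |>.mono_left nhdsWithin_le_nhds) ?_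
  have hfin : ({t : ℂ | ∃ i, γ t i (τ.emb i) = 0}).Finite := by
    refine Set.Finite.subset (Set.finite_range fun i => -(a i (τ.emb i))) ?_
    rintro t ⟨i, hi⟩
    refine ⟨i, ?_⟩
    simp only [γ, Pi.add_apply, Pi.smul_apply, Pi.single_eq_same, smul_eq_mul, mul_one] at hi
    linear_combination -hi
  have hev : ∀ᶠ t in nhdsWithin (0 : ℂ) {0}ᶜ, t ∉ {t : ℂ | ∃ i, γ t i (τ.emb i) = 0} := by
    have h1 := (hfin.subset (Set.sdiff_subset (t := {0}))).isClosed.compl_mem_nhds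
      (show (0 : ℂ) ∉ {t : ℂ | ∃ i, γ t i (τ.emb i) = 0} \ {0} from fun h => h.2 rfl)
    filter_upwards [nhdsWithin_le_nhds h1, self_mem_nhdsWithin] with t ht ht0 hmem
    exact ht ⟨hmem, ht0⟩
  filter_upwards [hev] with t ht
  refine hpivot _ (fun i j hj => ?_) fun i hi => ht ⟨i, hi⟩
  simp [γ, ha i j hj, hj.ne']

end Reach

/-! ### Modules generated by the highest vector of a Schubert variety -/

section Model

variable {L Z : Type*} [LieRing L] [LieAlgebra ℂ L] [AddCommGroup Z] [Module ℂ Z] {m n : ℕ}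

/-- The Leibniz derivative of a decomposable multivector, in Plücker coordinates. -/
def pluckerDer (A : Matrix (Fin m) (Fin m) ℂ) (a : Fin n → Fin m → ℂ) : PluckerIndex m n → ℂ :=
  ∑ i, plucker (Function.update a i (A.mulVec (a i)))

/-- A representation `S` of `L` that extends `⋀ⁿ ℂᵐ`, on which `L` acts by matrices, and such that
`w` is the vector `e_{τ_1} ∧ ⋯ ∧ e_{τ_n}` of `⋀ⁿ ℂᵐ` up to a scalar. The matrices are required to
generate one-parameter groups that preserve the Schubert variety of `τ`, and to include the
transvections `v ↦ v_{τ_i} u`, where `u` is a combination of the basis vectors before `e_{τ_i}`. -/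
structure SchubertModel (τ : PluckerIndex m n) (S : L →ₗ⁅ℂ⁆ Module.End ℂ Z) (w : Z) where
  /-- The wedge product of vectors of `ℂᵐ`. -/
  form : (Fin m → ℂ) [⋀^Fin n]→ₗ[ℂ] Z
  /-- A linear extension of the Plücker coordinates. -/
  coord : Z →ₗ[ℂ] (PluckerIndex m n → ℂ)
  /-- The matrix by which an element of `L` acts on `ℂᵐ`. -/
  mat : L → Matrix (Fin m) (Fin m) ℂ
  /-- The ratio of `w` and the highest vector. -/
  scalar : ℂ
  coord_form : ∀ a, coord (form a) = plucker a
  act_form : ∀ a v, S a (form v) = ∑ i, form (Function.update v i ((mat a).mulVec (v i)))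
  scalar_ne_zero : scalar ≠ 0
  gen_eq : w = scalar • form fun i => Pi.single (τ.emb i) 1
  stable : ∀ a (t : ℂ), ∀ x ∈ echelonCone τ,
    compound (NormedSpace.exp (-(t • mat a))) x ∈ echelonCone τ
  transvection : ∀ (i : Fin n) (u : Fin m → ℂ), (∀ q, τ.emb i ≤ q → u q = 0) →
    ∃ a, ∀ v, (mat a).mulVec v = v (τ.emb i) • u

namespace SchubertModel

variable {τ : PluckerIndex m n} {S : L →ₗ⁅ℂ⁆ Module.End ℂ Z} {w : Z} (M : SchubertModel τ S w)

/-- The inclusion of `⋀ⁿ ℂᵐ`. -/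
def incl : (PluckerIndex m n → ℂ) →ₗ[ℂ] Z :=
  Fintype.linearCombination ℂ fun I : PluckerIndex m n => M.form fun i => Pi.single (I.emb i) 1

theorem incl_plucker (a : Fin n → Fin m → ℂ) : M.incl (plucker a) = M.form a := by
  rw [alternating_eq_sum_plucker M.form a]
  rfl

theorem coord_incl_plucker (a : Fin n → Fin m → ℂ) : M.coord (M.incl (plucker a)) = plucker a := by
  rw [incl_plucker, coord_form]

theorem act_incl_plucker (a : L) (b : Fin n → Fin m → ℂ) :
    S a (M.incl (plucker b)) = M.incl (pluckerDer (M.mat a) b) := by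
  rw [incl_plucker, act_form, pluckerDer, map_sum]
  simp only [incl_plucker]

theorem exists_retraction (N : Submodule ℂ Z) : ∃ p : Z →ₗ[ℂ] N, ∀ x : N, p x = x := by
  obtain ⟨p, hp⟩ := N.subtype.exists_leftInverse_of_injective N.ker_subtype
  exact ⟨p, fun x => LinearMap.congr_fun hp x⟩

/-- A linear map from `⋀ⁿ ℂᵐ` to the module generated by `w`, which is the inclusion on the
multivectors that lie in this module. -/
def kappa : (PluckerIndex m n → ℂ) →ₗ[ℂ] cyclic S w :=
  (exists_retraction (cyclic S w)).choose ∘ₗ M.incl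

theorem kappa_coe {x : PluckerIndex m n → ℂ} (hx : M.incl x ∈ cyclic S w) :
    (M.kappa x : Z) = M.incl x :=
  congrArg Subtype.val ((exists_retraction (cyclic S w)).choose_spec ⟨_, hx⟩)

theorem rep_kappa_plucker (a : L) {b : Fin n → Fin m → ℂ}
    (hb : M.incl (plucker b) ∈ cyclic S w) :
    cyclicRep S w a (M.kappa (plucker b)) = M.kappa (pluckerDer (M.mat a) b) := by
  have h : M.incl (pluckerDer (M.mat a) b) ∈ cyclic S w := by
    rw [← act_incl_plucker]
    exact map_mem_cyclic S w a hb
  refine Subtype.ext ?_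
  rw [cyclicRep_coe, kappa_coe M hb, kappa_coe M h, act_incl_plucker]

/-- The generator of `S`, as an element of the module that it generates. -/
theorem gen_eq_kappa :
    (⟨w, mem_cyclic_self S w⟩ : cyclic S w) =
      M.kappa (M.scalar • plucker fun i => Pi.single (τ.emb i) 1) := by
  have h : M.incl (M.scalar • plucker fun i => Pi.single (τ.emb i) 1) = w := by
    rw [map_smul, incl_plucker, ← M.gen_eq]
  refine Subtype.ext ?_
  rw [kappa_coe M (by rw [h]; exact mem_cyclic_self S w), h]

theorem isClosed_tprod {k : ℕ} (C : Submodule ℂ (⨂[ℂ]^k (cyclic S w))) :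
    IsClosed {x | PiTensorProduct.tprod ℂ (fun _ : Fin k => M.kappa x) ∈ C} := by
  have h : {x | PiTensorProduct.tprod ℂ (fun _ : Fin k => M.kappa x) ∈ C} =
      ⋂ F : {F : Module.Dual ℂ (⨂[ℂ]^k (cyclic S w)) // C ≤ LinearMap.ker F},
        {x | F.1 (PiTensorProduct.tprod ℂ fun _ : Fin k => M.kappa x) = 0} := by
    ext x
    simp only [Set.mem_ofPred_eq, Set.mem_iInter]
    refine ⟨fun h F => F.2 h, fun h => ?_⟩
    by_contra hx
    obtain ⟨F, hF, hC⟩ := Submodule.exists_le_ker_of_notMem hx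
    exact hF (h ⟨F, hC⟩)
  rw [h]
  refine isClosed_iInter fun F => ?_
  have hc := multilinear_continuous
    ((F.1.compMultilinearMap (PiTensorProduct.tprod ℂ)).compLinearMap fun _ : Fin k => M.kappa)
  exact isClosed_singleton.preimage
    (hc.comp (continuous_pi fun _ : Fin k => continuous_id (X := PluckerIndex m n → ℂ)))

/-- The module generated by the highest vector contains the cone over the Schubert variety, and
the submodule of its tensor power generated by the power of the highest vector contains the powers
of all points of the cone. -/
theorem tprod_kappa_mem (k : ℕ) {x : PluckerIndex m n → ℂ} (hx : x ∈ echelonCone τ) :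
    M.incl x ∈ cyclic S w ∧ PiTensorProduct.tprod ℂ (fun _ : Fin k => M.kappa x) ∈
      higher (cyclicRep S w) ⟨w, mem_cyclic_self S w⟩ k := by
  have hsmul : ∀ (c : ℂ) x, (M.incl x ∈ cyclic S w ∧
      PiTensorProduct.tprod ℂ (fun _ : Fin k => M.kappa x) ∈
        higher (cyclicRep S w) ⟨w, mem_cyclic_self S w⟩ k) →
      (M.incl (c • x) ∈ cyclic S w ∧
      PiTensorProduct.tprod ℂ (fun _ : Fin k => M.kappa (c • x)) ∈
        higher (cyclicRep S w) ⟨w, mem_cyclic_self S w⟩ k) := by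
    rintro c x ⟨h1, h2⟩
    rw [map_smul, map_smul, MultilinearMap.map_smul_univ _ (fun _ => c)]
    exact ⟨Submodule.smul_mem _ c h1, Submodule.smul_mem _ _ h2⟩
  refine echelonCone_induction (p := fun x => M.incl x ∈ cyclic S w ∧
    PiTensorProduct.tprod ℂ (fun _ : Fin k => M.kappa x) ∈
      higher (cyclicRep S w) ⟨w, mem_cyclic_self S w⟩ k) ?_ hsmul ?_ ?_ hx
  · have h := hsmul M.scalar⁻¹ (M.scalar • plucker fun i => Pi.single (τ.emb i) 1) ⟨?_, ?_⟩
    · rwa [smul_smul, inv_mul_cancel₀ M.scalar_ne_zero, one_smul] at h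
    · rw [map_smul, incl_plucker, ← M.gen_eq]
      exact mem_cyclic_self S w
    · rw [← gen_eq_kappa]
      exact mem_cyclic_self _ _
  · exact ((cyclic S w).comap M.incl).closed_of_finiteDimensional.inter
      (M.isClosed_tprod (higher (cyclicRep S w) ⟨w, mem_cyclic_self S w⟩ k))
  · rintro b i u hb hu ⟨h1, h2⟩
    -- The transvection `D` for `u` maps the multivector `x` of `b` to the multivector `z` with `u`
    -- in the place `i`, and `D z = 0`.
    obtain ⟨a, ha⟩ := M.transvection i u hu
    have hx : pluckerDer (M.mat a) b = plucker (Function.update b i u) := by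
      rw [pluckerDer, Finset.sum_eq_single i, ha, hb, if_pos rfl, one_smul]
      · intro j _ hj
        rw [ha, hb, if_neg hj, zero_smul]
        exact funext fun I => (pluckerForm I).map_coord_zero j (Function.update_self _ _ _)
      · simp
    have hz : pluckerDer (M.mat a) (Function.update b i u) = 0 := by
      have h0 : ∀ j, (M.mat a).mulVec (Function.update b i u j) = 0 := by
        intro j
        rw [ha]
        rcases eq_or_ne j i with rfl | hj
        · rw [Function.update_self, hu _ le_rfl, zero_smul]
        · rw [Function.update_of_ne hj, hb, if_neg hj, zero_smul]
      refine Finset.sum_eq_zero fun j _ => funext fun I => ?_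
      rw [h0]
      exact (pluckerForm I).map_coord_zero j (Function.update_self _ _ _)
    have h3 := M.rep_kappa_plucker a h1
    rw [hx] at h3
    have h4 : M.incl (plucker (Function.update b i u)) ∈ cyclic S w := by
      rw [← hx, ← act_incl_plucker]
      exact map_mem_cyclic S w a h1
    have h5 := M.rep_kappa_plucker a h4
    rw [hz, map_zero] at h5
    rw [plucker_update_add, Function.update_eq_self, map_add, map_add]
    exact ⟨Submodule.add_mem _ h1 h4,
      tprod_add_mem h3 h5 (fun y hy => map_mem_cyclic (tensorRep (cyclicRep S w) k) _ a hy) h2⟩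

theorem incl_mem {x : PluckerIndex m n → ℂ} (hx : x ∈ echelonCone τ) : M.incl x ∈ cyclic S w :=
  (M.tprod_kappa_mem 0 hx).1

theorem coord_kappa {x : PluckerIndex m n → ℂ} (hx : x ∈ echelonCone τ) :
    M.coord (M.kappa x : Z) = x := by
  rw [kappa_coe M (M.incl_mem hx)]
  obtain ⟨c, -, a, -, -, rfl⟩ := hx
  rw [map_smul, map_smul, coord_incl_plucker]

/-- The `k`-th power of a point of the cone over the Schubert variety. -/
def point (k : ℕ) (x : echelonCone τ) :
    higher (cyclicRep S w) ⟨w, mem_cyclic_self S w⟩ k :=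
  ⟨_, (M.tprod_kappa_mem k x.2).2⟩

/-- The operators of the one-parameter group of `a` differentiate to the action of `a` on the
powers of points of the cone. -/
theorem hasDerivAt_tprod {k : ℕ} (F : Module.Dual ℂ (⨂[ℂ]^k (cyclic S w))) (a : L)
    (x : echelonCone τ) :
    HasDerivAt (fun t : ℂ => F (PiTensorProduct.tprod ℂ fun _ : Fin k =>
        M.kappa (compound (NormedSpace.exp (-(t • M.mat a))) x.1)))
      (-F (tensorRep (cyclicRep S w) k a
        (PiTensorProduct.tprod ℂ fun _ : Fin k => M.kappa x.1))) 0 := by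
  obtain ⟨x, hx⟩ := x
  have hx' := hx
  obtain ⟨c, hc, b, hb, hb0, rfl⟩ := hx'
  have h1 : HasDerivAt (fun t : ℂ =>
      compound (NormedSpace.exp (-(t • M.mat a))) (c • plucker b))
      (-(c • pluckerDer (M.mat a) b)) 0 := by
    have h := (hasDerivAt_compound (M.mat a) b).const_smul c
    rw [smul_neg] at h
    refine h.congr_of_eventuallyEq (Filter.Eventually.of_forall fun t => ?_)
    exact compound_smul _ c _
  have h2 := hasDerivAt_multilinear
    ((F.compMultilinearMap (PiTensorProduct.tprod ℂ)).compLinearMap fun _ : Fin k => M.kappa)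
    fun _ => h1
  refine h2.congr_deriv ?_
  have h3 : cyclicRep S w a (M.kappa (c • plucker b)) =
      M.kappa (c • pluckerDer (M.mat a) b) := by
    rw [map_smul, map_smul, map_smul,
      M.rep_kappa_plucker a (M.incl_mem (plucker_mem_echelonCone hb hb0))]
  have h4 : compound (NormedSpace.exp (-((0 : ℂ) • M.mat a))) (c • plucker b) = c • plucker b := by
    rw [compound_smul, compound_plucker]
    simp
  change _ = -F (tensorDer (Fin k) (cyclicRep S w a) _)
  rw [tensorDer_tprod, map_sum, ← Finset.sum_neg_distrib]
  refine Finset.sum_congr rfl fun i _ => ?_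
  rw [h3, ← map_neg F, ← (PiTensorProduct.tprod ℂ).map_update_neg]
  simp only [MultilinearMap.compLinearMap_apply, LinearMap.compMultilinearMap_apply, h4]
  congr 2
  funext j
  rcases eq_or_ne j i with rfl | hj
  · simp
  · simp [hj]

/-- The module `W^{[k]}` is spanned by the `k`-th powers of the points of the cone over the
Schubert variety. The span of these powers is a submodule since a functional that vanishes on it
vanishes along the orbits of one-parameter groups. -/
theorem span_point (k : ℕ) : Submodule.span ℂ (Set.range (M.point k)) = ⊤ := by
  let N : Submodule ℂ (⨂[ℂ]^k (cyclic S w)) := Submodule.span ℂ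
    (Set.range fun x : echelonCone τ => PiTensorProduct.tprod ℂ fun _ : Fin k => M.kappa x.1)
  have hle : higher (cyclicRep S w) ⟨w, mem_cyclic_self S w⟩ k ≤ N := by
    refine cyclic_le _ _ ?_ fun a y hy => ?_
    · rw [M.gen_eq_kappa]
      refine Submodule.subset_span ⟨⟨_, smul_mem_echelonCone (plucker_mem_echelonCone
        (echelon_single τ) fun h => ?_) M.scalar_ne_zero⟩, rfl⟩
      have := congrFun h τ
      rw [plucker_single] at this
      simp at this
    · induction hy using Submodule.span_induction with
      | zero => rw [map_zero]; exact N.zero_mem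
      | add y z _ _ hy hz => rw [map_add]; exact N.add_mem hy hz
      | smul c y _ hy => rw [map_smul]; exact N.smul_mem c hy
      | mem y hy =>
        obtain ⟨x, rfl⟩ := hy
        by_contra hx
        obtain ⟨F, hF, hN⟩ := Submodule.exists_le_ker_of_notMem hx
        have h := M.hasDerivAt_tprod F a x
        have h0 : (fun t : ℂ => F (PiTensorProduct.tprod ℂ fun _ : Fin k =>
            M.kappa (compound (NormedSpace.exp (-(t • M.mat a))) x.1))) = fun _ => 0 :=
          funext fun t => hN (Submodule.subset_span ⟨⟨_, M.stable a t x.1 x.2⟩, rfl⟩)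
        rw [h0] at h
        exact hF (neg_eq_zero.1 (h.unique (hasDerivAt_const 0 0)))
  rw [eq_top_iff]
  rintro ⟨y, hy⟩ -
  have h : (higher (cyclicRep S w) ⟨w, mem_cyclic_self S w⟩ k).subtype ⟨y, hy⟩ ∈
      (Submodule.span ℂ (Set.range (M.point k))).map
        (higher (cyclicRep S w) ⟨w, mem_cyclic_self S w⟩ k).subtype := by
    rw [Submodule.map_span, ← Set.range_comp]
    exact hle hy
  obtain ⟨z, hz, hzy⟩ := h
  obtain rfl : z = ⟨y, hy⟩ := Subtype.ext hzy
  exact hz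

/-- Evaluation of functionals on `W^{[k]}` at the points of the cone. -/
def theta (k : ℕ) : HigherDual (cyclicRep S w) ⟨w, mem_cyclic_self S w⟩ k →ₗ[ℂ]
    (echelonCone τ → ℂ) where
  toFun f x := f (M.point k x)
  map_add' _ _ := rfl
  map_smul' _ _ := rfl

theorem theta_injective (k : ℕ) : Function.Injective (M.theta k) := fun _ _ h =>
  LinearMap.ext_on_range (M.span_point k) (congrFun h)

/-- A functional on `W^{[k]}` is given on the cone by a homogeneous polynomial. -/
theorem exists_polynomial {k : ℕ} (f : HigherDual (cyclicRep S w) ⟨w, mem_cyclic_self S w⟩ k) :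
    ∃ P : MvPolynomial (PluckerIndex m n) ℂ, P.IsHomogeneous k ∧
      ∀ x : echelonCone τ, M.theta k f x = MvPolynomial.eval x.1 P := by
  classical
  obtain ⟨F, rfl⟩ := higherDual_exists_extend _ _ f
  let g := (F.compMultilinearMap (PiTensorProduct.tprod ℂ)).compLinearMap fun _ : Fin k => M.kappa
  refine ⟨∑ p : Fin k → PluckerIndex m n, MvPolynomial.C (g fun i => Pi.single (p i) 1) *
    ∏ i, MvPolynomial.X (p i), ?_, fun x => ?_⟩
  · refine MvPolynomial.IsHomogeneous.sum _ _ _ fun p _ => ?_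
    have h := MvPolynomial.IsHomogeneous.prod (Finset.univ : Finset (Fin k))
      (fun i => (MvPolynomial.X (p i) : MvPolynomial (PluckerIndex m n) ℂ)) (fun _ => 1)
      fun i _ => MvPolynomial.isHomogeneous_X ℂ (p i)
    simpa using (MvPolynomial.isHomogeneous_C _ _).mul h
  · have h := multilinear_expand g fun _ => x.1
    refine h.trans ?_
    rw [map_sum]
    refine Finset.sum_congr rfl fun p _ => ?_
    rw [map_mul, MvPolynomial.eval_C, map_prod, smul_eq_mul, mul_comm]
    simp

/-- Evaluation of the elements of the algebra `W^{[*]}` at a point of the cone. -/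
def evalHom (x : echelonCone τ) :
    HigherAlgebra (cyclicRep S w) ⟨w, mem_cyclic_self S w⟩ →ₐ[ℂ] ℂ :=
  DirectSum.toAlgebra ℂ (HigherDual (cyclicRep S w) ⟨w, mem_cyclic_self S w⟩)
    (fun k => LinearMap.proj x ∘ₗ M.theta k) (formOne_tprod _) (by
      intro i j f g
      obtain ⟨F, rfl⟩ := higherDual_exists_extend _ _ f
      obtain ⟨G, rfl⟩ := higherDual_exists_extend _ _ g
      exact (LinearMap.congr_fun (dualMul_restrict _ _ F G) (M.point (i + j) x)).trans
        (formMul_tprod F G _))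

theorem evalHom_lof (x : echelonCone τ) {k : ℕ}
    (f : HigherDual (cyclicRep S w) ⟨w, mem_cyclic_self S w⟩ k) :
    M.evalHom x (DirectSum.lof ℂ ℕ _ k f) = M.theta k f x :=
  DirectSum.toAddMonoid_of (fun k => (LinearMap.proj x ∘ₗ M.theta k).toAddMonoidHom) k f

/-- The functionals on `W^{[1]} = W` given by the Plücker coordinates. -/
def coordDual (I : PluckerIndex m n) :
    HigherDual (cyclicRep S w) ⟨w, mem_cyclic_self S w⟩ 1 :=
  (LinearMap.proj I ∘ₗ M.coord ∘ₗ (cyclic S w).subtype ∘ₗ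
    (PiTensorProduct.subsingletonEquiv (R := ℂ) (s := fun _ => cyclic S w)
      (0 : Fin 1)).toLinearMap) ∘ₗ
    (higher (cyclicRep S w) ⟨w, mem_cyclic_self S w⟩ 1).subtype

theorem theta_coordDual (I : PluckerIndex m n) (x : echelonCone τ) :
    M.theta 1 (M.coordDual I) x = x.1 I := by
  change M.coord ((PiTensorProduct.subsingletonEquiv (R := ℂ) (0 : Fin 1)
    (PiTensorProduct.tprod ℂ fun _ => M.kappa x.1) : cyclic S w) : Z) I = _
  rw [PiTensorProduct.subsingletonEquiv_apply_tprod, M.coord_kappa x.2]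

/-- The homomorphism from the homogeneous coordinate ring of the projective space to the algebra
`W^{[*]}`. -/
def ringMap : MvPolynomial (PluckerIndex m n) ℂ →ₐ[ℂ]
    HigherAlgebra (cyclicRep S w) ⟨w, mem_cyclic_self S w⟩ :=
  MvPolynomial.aeval fun I => DirectSum.lof ℂ ℕ _ 1 (M.coordDual I)

theorem evalHom_ringMap (x : echelonCone τ) (P : MvPolynomial (PluckerIndex m n) ℂ) :
    M.evalHom x (M.ringMap P) = MvPolynomial.eval x.1 P := by
  have h : (M.evalHom x).comp M.ringMap = MvPolynomial.aeval x.1 := by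
    refine MvPolynomial.algHom_ext fun I => ?_
    simp [ringMap, evalHom_lof, theta_coordDual]
  exact (AlgHom.congr_fun h P).trans
    (RingHom.congr_fun (MvPolynomial.coe_aeval_eq_eval x.1) P)

theorem ringMap_mem {P : MvPolynomial (PluckerIndex m n) ℂ} {k : ℕ} (hP : P.IsHomogeneous k) :
    M.ringMap P ∈ higherGrading (cyclicRep S w) ⟨w, mem_cyclic_self S w⟩ k := by
  rw [P.as_sum, map_sum]
  refine Submodule.sum_mem _ fun d hd => ?_
  rw [MvPolynomial.monomial_eq, ← MvPolynomial.algebraMap_eq, map_mul, AlgHom.commutes,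
    ← Algebra.smul_def]
  refine Submodule.smul_mem _ _ ?_
  have h := SetLike.prod_pow_mem_graded
    (higherGrading (cyclicRep S w) ⟨w, mem_cyclic_self S w⟩) (F := d.support) (fun _ => 1)
    (fun I => M.ringMap (MvPolynomial.X I)) d fun I _ => ⟨M.coordDual I, by simp [ringMap]⟩
  rw [← degree_of_isHomogeneous hP (MvPolynomial.mem_support_iff.1 hd), Finsupp.degree_apply]
  rw [Finsupp.prod, map_prod]
  simpa only [map_pow, smul_eq_mul, mul_one] using h

/-- A functional on `W^{[k]}` that agrees with a homogeneous polynomial on the cone is the image of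
this polynomial, because functionals are determined by their values on the cone. -/
theorem ringMap_eq_of_theta {P : MvPolynomial (PluckerIndex m n) ℂ} {k : ℕ}
    (hP : P.IsHomogeneous k) {f : HigherDual (cyclicRep S w) ⟨w, mem_cyclic_self S w⟩ k}
    (h : ∀ x : echelonCone τ, M.theta k f x = MvPolynomial.eval x.1 P) :
    M.ringMap P = DirectSum.lof ℂ ℕ _ k f := by
  obtain ⟨g, hg⟩ := M.ringMap_mem hP
  rw [← hg]
  congr 1
  refine M.theta_injective k (funext fun x => ?_)
  rw [h, ← M.evalHom_ringMap, ← hg, evalHom_lof]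

theorem ringMap_surjective : Function.Surjective M.ringMap := by
  intro a
  induction a using DirectSum.induction_on with
  | zero => exact ⟨0, map_zero _⟩
  | of k f =>
    obtain ⟨P, hP, h⟩ := M.exists_polynomial f
    exact ⟨P, M.ringMap_eq_of_theta hP h⟩
  | add a b ha hb =>
    obtain ⟨P, rfl⟩ := ha
    obtain ⟨Q, rfl⟩ := hb
    exact ⟨P + Q, map_add _ _ _⟩

theorem ringMap_eq_zero_iff {P : MvPolynomial (PluckerIndex m n) ℂ} :
    M.ringMap P = 0 ↔ ∀ x ∈ echelonCone τ, MvPolynomial.eval x P = 0 := by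
  refine ⟨fun h x hx => ?_, fun h => ?_⟩
  · rw [← M.evalHom_ringMap ⟨x, hx⟩, h, map_zero]
  · rw [← MvPolynomial.sum_homogeneousComponent P, map_sum]
    refine Finset.sum_eq_zero fun k _ => ?_
    rw [M.ringMap_eq_of_theta (f := 0) (MvPolynomial.homogeneousComponent_isHomogeneous k P),
      map_zero]
    intro x
    rw [map_zero, eval_homogeneousComponent (b := 0) fun t ht => ?_]
    · rfl
    · rw [mul_zero, h _ (smul_mem_echelonCone x.2 ht)]

/-- The algebra `W^{[*]}` is an algebra of functions on the cone. -/
theorem isReduced_higherAlgebra (M : SchubertModel τ S w) :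
    IsReduced (HigherAlgebra (cyclicRep S w) ⟨w, mem_cyclic_self S w⟩) := by
  refine ⟨fun a ha => ?_⟩
  obtain ⟨P, rfl⟩ := M.ringMap_surjective a
  refine M.ringMap_eq_zero_iff.2 fun x hx => ?_
  rw [← M.evalHom_ringMap ⟨x, hx⟩]
  exact (ha.map (M.evalHom ⟨x, hx⟩)).eq_zero

/-- By projective normality, all sections of `𝒪(k)` come from functionals on `W^{[k]}`. -/
theorem range_theta (k : ℕ) : LinearMap.range (M.theta k) = sections (echelonCone τ) k := by
  ext g
  rw [mem_sections_iff]
  constructor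
  · rintro ⟨f, rfl⟩
    exact M.exists_polynomial f
  · rintro ⟨P, hP, h⟩
    obtain ⟨f, hf⟩ := M.ringMap_mem hP
    refine ⟨f, funext fun x => ?_⟩
    rw [h, ← M.evalHom_ringMap, ← hf, evalHom_lof]

/-- The identification of the dual of `W^{[k]}` with the sections of `𝒪(k)`. -/
def sectionsEquiv (k : ℕ) : HigherDual (cyclicRep S w) ⟨w, mem_cyclic_self S w⟩ k ≃ₗ[ℂ]
    sections (echelonCone τ) k :=
  (LinearEquiv.ofInjective _ (M.theta_injective k)).trans
    (LinearEquiv.ofEq _ _ (M.range_theta k))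

theorem finite_higher (M : SchubertModel τ S w) (k : ℕ) :
    Module.Finite ℂ (higher (cyclicRep S w) ⟨w, mem_cyclic_self S w⟩ k) := by
  let T : (⨂[ℂ]^k (PluckerIndex m n → ℂ)) →ₗ[ℂ] ⨂[ℂ]^k (cyclic S w) :=
    PiTensorProduct.map fun _ => M.kappa
  have h : higher (cyclicRep S w) ⟨w, mem_cyclic_self S w⟩ k ≤ LinearMap.range T := by
    rw [← Submodule.range_subtype (higher (cyclicRep S w) ⟨w, mem_cyclic_self S w⟩ k),
      LinearMap.range_eq_map, ← M.span_point, Submodule.map_span, Submodule.span_le]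
    rintro _ ⟨_, ⟨x, rfl⟩, rfl⟩
    exact ⟨PiTensorProduct.tprod ℂ fun _ => x.1, PiTensorProduct.map_tprod _ _⟩
  exact Submodule.finiteDimensional_of_le h

/-- The module `W^{[k]}` is dual to the module of sections of `𝒪(k)` on the Schubert variety. -/
theorem exists_equiv (k : ℕ) :
    ∃ Φ : higher (cyclicRep S w) ⟨w, mem_cyclic_self S w⟩ k ≃ₗ[ℂ]
        Module.Dual ℂ (sections (echelonCone τ) k),
      ∀ (a : L) (s : sections (echelonCone τ) k), ∃ s' : sections (echelonCone τ) k,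
        IsLieAction (M.mat a) s.1 s'.1 ∧
        ∀ v, Φ (higherRep (cyclicRep S w) ⟨w, mem_cyclic_self S w⟩ k a v) s = -Φ v s' := by
  have := M.finite_higher k
  have : Module.Free ℂ (higher (cyclicRep S w) ⟨w, mem_cyclic_self S w⟩ k) :=
    @Module.Free.of_divisionRing ℂ (higher (cyclicRep S w) ⟨w, mem_cyclic_self S w⟩ k) _
      (Submodule.addCommGroup _) (Submodule.module _)
  refine ⟨(Module.evalEquiv ℂ _).trans (M.sectionsEquiv k).symm.dualMap, fun a s => ?_⟩
  obtain ⟨f, rfl⟩ := (M.sectionsEquiv k).surjective s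
  refine ⟨M.sectionsEquiv k
    (-(f ∘ₗ higherRep (cyclicRep S w) ⟨w, mem_cyclic_self S w⟩ k a)), fun x => ⟨fun t =>
      M.stable a t x.1 x.2, ?_⟩, fun v => ?_⟩
  · obtain ⟨F, rfl⟩ := higherDual_exists_extend _ _ f
    refine (M.hasDerivAt_tprod F a x).congr_of_eventuallyEq
      (Filter.Eventually.of_forall fun t => ?_)
    -- `IsLieAction` extends functions on the cone by zero, which has no effect on the orbit.
    exact Subtype.val_injective.extend_apply _ _ ⟨_, M.stable a t x.1 x.2⟩
  · simp [LinearEquiv.dualMap_apply]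

end SchubertModel

end Model

/-! ### Projective spectra of quotients of graded rings -/

section GradedQuotient

variable {A B : Type} [CommRing A] [Algebra ℂ A] [CommRing B] [Algebra ℂ B]
  {𝒜 : ℕ → Submodule ℂ A} {ℬ : ℕ → Submodule ℂ B} [GradedAlgebra 𝒜] [GradedAlgebra ℬ]

theorem exists_homogeneous_lift {f : 𝒜 →+*ᵍ ℬ} (hf : Function.Surjective f) {i : ℕ} {b : B}
    (hb : b ∈ ℬ i) : ∃ a ∈ 𝒜 i, f a = b := by
  obtain ⟨a, rfl⟩ := hf b
  refine ⟨_, (DirectSum.decompose 𝒜 a i).2, ?_⟩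
  rw [f.map_directSumDecompose, DirectSum.decompose_of_mem_same ℬ hb]

theorem irrelevant_le_map {f : 𝒜 →+*ᵍ ℬ} (hf : Function.Surjective f) :
    HomogeneousIdeal.irrelevant ℬ ≤ (HomogeneousIdeal.irrelevant 𝒜).map f := by
  change (HomogeneousIdeal.irrelevant ℬ).toIdeal ≤ _
  refine (HomogeneousIdeal.toIdeal_irrelevant_le _).2 fun i hi b hb => ?_
  obtain ⟨a, ha, rfl⟩ := exists_homogeneous_lift hf hb
  refine Ideal.mem_map_of_mem _ ?_
  exact (HomogeneousIdeal.mem_irrelevant_iff 𝒜 a).2 (DirectSum.decompose_of_mem_ne 𝒜 ha hi.ne')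

theorem awayMap_surjective {f : 𝒜 →+*ᵍ ℬ} (hf : Function.Surjective f) {i : ℕ} {s : A}
    (hs : s ∈ 𝒜 i) : Function.Surjective (HomogeneousLocalization.Away.map f s) := by
  intro z
  obtain ⟨n, b, hb, rfl⟩ := HomogeneousLocalization.Away.mk_surjective ℬ (f.2 hs) z
  obtain ⟨a, ha, rfl⟩ := exists_homogeneous_lift hf hb
  exact ⟨.mk 𝒜 hs n a ha, HomogeneousLocalization.Away.map_mk f s hs n a ha⟩

/-- A surjection of graded rings induces a closed immersion of projective spectra. -/
theorem isClosedImmersion_projMap {f : 𝒜 →+*ᵍ ℬ} (hf : Function.Surjective f) :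
    IsClosedImmersion (Proj.map f (irrelevant_le_map hf)) := by
  refine @HasAffineProperty.of_iSup_eq_top @IsClosedImmersion _
    IsClosedImmersion.hasAffineProperty _ _ _ _
    (fun s : (Proj.affineOpenCover 𝒜).I₀ => ⟨Proj.basicOpen 𝒜 s.2.1,
      Proj.isAffineOpen_basicOpen 𝒜 s.2.1 s.2.2 s.1.2⟩) ?_ fun s => ?_
  · refine Proj.iSup_basicOpen_eq_top 𝒜 _ ?_
    refine (HomogeneousIdeal.toIdeal_irrelevant_le _).2 fun i hi x hx => ?_
    exact Ideal.subset_span ⟨⟨⟨i, hi⟩, ⟨x, hx⟩⟩, rfl⟩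
  · have hU := Proj.isAffineOpen_basicOpen ℬ (f s.2.1) (f.2 s.2.2) s.1.2
    refine ⟨hU, ?_⟩
    rw [morphismRestrict_appTop]
    have h1 := Proj.awayToSection_comp_appLE f (irrelevant_le_map hf) s.2.2
    have h2 : Function.Surjective (Scheme.Hom.appLE (Proj.map f (irrelevant_le_map hf))
        (Proj.basicOpen 𝒜 s.2.1) (Proj.basicOpen ℬ (f s.2.1)) (by rfl)) := by
      have h3 : Function.Surjective (CommRingCat.ofHom (HomogeneousLocalization.Away.map f s.2.1) ≫
          Proj.awayToSection ℬ (f s.2.1)) :=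
        (ConcreteCategory.bijective_of_isIso
          (Proj.basicOpenIsoAway ℬ (f s.2.1) (f.2 s.2.2) s.1.2).hom).2.comp
          (awayMap_surjective hf s.2.2)
      rw [← h1] at h3
      exact Function.Surjective.of_comp h3
    have h4 : ∀ V : (Proj 𝒜).Opens, V = Proj.basicOpen 𝒜 s.2.1 →
        Function.Surjective (Scheme.Hom.app (Proj.map f (irrelevant_le_map hf)) V) := by
      rintro V rfl
      rw [← Scheme.Hom.appLE_eq_app]
      exact h2
    exact (ConcreteCategory.bijective_of_isIso ((Proj ℬ).presheaf.map (eqToHom _).op)).2.comp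
      (h4 _ (Scheme.Opens.ι_image_top _))

theorem isReduced_proj (h : _root_.IsReduced B) : IsReduced (Proj ℬ) := by
  have : ∀ s : (Proj.affineOpenCover ℬ).I₀, IsReduced ((Proj.affineOpenCover ℬ).openCover.X s) := by
    intro s
    have h1 : _root_.IsReduced (Localization.Away (s.2.1 : B)) :=
      inferInstance
    have h2 : _root_.IsReduced (HomogeneousLocalization.Away ℬ (s.2.1 : B)) :=
      isReduced_of_injective (algebraMap _ (Localization.Away (s.2.1 : B)))
        (HomogeneousLocalization.val_injective _)
    exact inferInstanceAs (IsReduced (Spec (CommRingCat.of (HomogeneousLocalization.Away ℬ (s.2.1 : B)))))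
  exact @IsReduced.of_openCover (Proj ℬ) (Proj.affineOpenCover ℬ).openCover this

theorem range_projMap {f : 𝒜 →+*ᵍ ℬ} (hf : Function.Surjective f) :
    Set.range (Proj.map f (irrelevant_le_map hf)) =
      ProjectiveSpectrum.zeroLocus 𝒜 {a | f a = 0} := by
  ext p
  constructor
  · rintro ⟨q, rfl⟩ a ha
    change f a ∈ q.asHomogeneousIdeal.toIdeal
    rw [ha]
    exact Ideal.zero_mem _
  · intro hp
    have hp' : RingHom.ker (f : A →+* B) ≤ p.asHomogeneousIdeal.toIdeal := fun a ha => hp ha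
    have hpp := p.isPrime
    have hc : (p.asHomogeneousIdeal.map f).comap f = p.asHomogeneousIdeal := by
      refine HomogeneousIdeal.ext ?_
      exact (Ideal.comap_map_of_surjective' (f : A →+* B) hf _).trans (sup_eq_left.2 hp')
    let q : ProjectiveSpectrum ℬ :=
      { asHomogeneousIdeal := p.asHomogeneousIdeal.map f
        isPrime := Ideal.map_isPrime_of_surjective hf hp'
        not_irrelevant_le := fun h => p.not_irrelevant_le (by
          rw [← hc]
          refine fun a ha => h ?_
          rw [HomogeneousIdeal.mem_irrelevant_iff] at ha
          refine (HomogeneousIdeal.mem_irrelevant_iff _ _).2 ?_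
          change (DirectSum.decompose ℬ (f a) 0 : B) = 0
          rw [← f.map_directSumDecompose]
          exact (congrArg f ha).trans (map_zero f)) }
    exact ⟨q, ProjectiveSpectrum.ext hc⟩

theorem projMap_toSpec {f : 𝒜 →+*ᵍ ℬ} (hf : Function.Surjective f)
    (hc : ∀ c : ℂ, f (algebraMap ℂ A c) = algebraMap ℂ B c) :
    Proj.map f (irrelevant_le_map hf) ≫
        Proj.toSpecZero 𝒜 ≫ Spec.map (CommRingCat.ofHom (algebraMap ℂ (𝒜 0))) =
      Proj.toSpecZero ℬ ≫ Spec.map (CommRingCat.ofHom (algebraMap ℂ (ℬ 0))) := by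
  have key : ∀ (i : ℕ) (hi : 0 < i) (s : A) (hs : s ∈ 𝒜 i), Proj.awayι ℬ (f s) (f.2 hs) hi ≫
      Proj.map f (irrelevant_le_map hf) ≫
        Proj.toSpecZero 𝒜 ≫ Spec.map (CommRingCat.ofHom (algebraMap ℂ (𝒜 0))) =
      Proj.awayι ℬ (f s) (f.2 hs) hi ≫
        Proj.toSpecZero ℬ ≫ Spec.map (CommRingCat.ofHom (algebraMap ℂ (ℬ 0))) := by
    intro i hi s hs
    rw [Proj.awayι_comp_map_assoc f _ hi _ hs, Proj.awayι_toSpecZero_assoc,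
      Proj.awayι_toSpecZero_assoc, ← Spec.map_comp, ← Spec.map_comp, ← Spec.map_comp,
      ← CommRingCat.ofHom_comp, ← CommRingCat.ofHom_comp, ← CommRingCat.ofHom_comp]
    congr 2
    ext c
    have h1 : f 1 ∈ Submonoid.powers (f s) := by rw [map_one]; exact Submonoid.one_mem _
    change Localization.mk (f (algebraMap ℂ A c)) (⟨f 1, h1⟩ : Submonoid.powers (f s)) =
      Localization.mk (algebraMap ℂ B c) 1
    rw [hc]
    congr 1
    exact Subtype.ext (map_one f)
  exact (Proj.mapAffineOpenCover f (irrelevant_le_map hf)).openCover.hom_ext _ _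
    fun s => key s.1 s.1.2 s.2 s.2.2

/-- A closed immersion of a reduced scheme is determined by its image. -/
theorem ker_eq_vanishingIdeal {X Y : Scheme.{0}} (f : X ⟶ Y) [IsClosedImmersion f] [IsReduced X]
    (Z : TopologicalSpace.Closeds Y) (h : Set.range f = Z) :
    f.ker = Scheme.IdealSheafData.vanishingIdeal Z := by
  have hr : f.ker.radical = f.ker := by
    refine Scheme.IdealSheafData.ext (funext fun U => ?_)
    rw [Scheme.IdealSheafData.radical_ideal, f.ker_apply]
    exact (RingHom.ker_isRadical_iff_reduced_of_surjective (f.app_surjective U.1 U.2)).2 inferInstance |>.radical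
  have hs : f.ker.support = Z := by
    refine TopologicalSpace.Closeds.ext ?_
    rw [Scheme.Hom.support_ker, ← h]
    exact f.isClosedEmbedding.isClosed_range.closure_eq
  rw [← hr, ← Scheme.IdealSheafData.vanishingIdeal_support, hs]

/-- The projective spectrum of a reduced quotient of a graded ring is the closed subset of the
projective spectrum of this ring defined by the kernel, with its reduced scheme structure. -/
theorem nonempty_projOver_iso {f : 𝒜 →+*ᵍ ℬ} (hf : Function.Surjective f)
    (hc : ∀ c : ℂ, f (algebraMap ℂ A c) = algebraMap ℂ B c) (hB : _root_.IsReduced B)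
    (Z : TopologicalSpace.Closeds (Proj 𝒜))
    (hZ : (Z : Set (Proj 𝒜)) = ProjectiveSpectrum.zeroLocus 𝒜 {a | f a = 0}) :
    Nonempty (projOver ℬ ≅ Over.mk ((Scheme.IdealSheafData.vanishingIdeal Z).subschemeι ≫
      (projOver 𝒜).hom)) := by
  have h1 := isClosedImmersion_projMap hf
  have h2 : IsReduced (Proj ℬ) := isReduced_proj hB
  have h3 : (Scheme.IdealSheafData.vanishingIdeal Z).subschemeι.ker =
      (Proj.map f (irrelevant_le_map hf)).ker := by
    rw [Scheme.IdealSheafData.ker_subschemeι]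
    exact (ker_eq_vanishingIdeal _ Z ((range_projMap hf).trans hZ.symm)).symm
  have h4 := IsClosedImmersion.isIso_lift _ _ h3
  let e : Proj ℬ ≅ (Scheme.IdealSheafData.vanishingIdeal Z).subscheme :=
    asIso (IsClosedImmersion.lift _ _ h3.le)
  have he : e.hom ≫ (Scheme.IdealSheafData.vanishingIdeal Z).subschemeι =
      Proj.map f (irrelevant_le_map hf) := IsClosedImmersion.lift_fac _ _ h3.le
  refine ⟨Over.isoMk e ?_⟩
  have h5 := projMap_toSpec hf hc
  have h6 : e.hom ≫ (Scheme.IdealSheafData.vanishingIdeal Z).subschemeι ≫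
      Proj.toSpecZero 𝒜 ≫ Spec.map (CommRingCat.ofHom (algebraMap ℂ (𝒜 0))) =
      Proj.toSpecZero ℬ ≫ Spec.map (CommRingCat.ofHom (algebraMap ℂ (ℬ 0))) := by
    rw [← Category.assoc, he, h5]
  exact h6

end GradedQuotient

section CoordinateRing

attribute [local instance] MvPolynomial.gradedAlgebra

variable {L Z : Type} [LieRing L] [LieAlgebra ℂ L] [AddCommGroup Z] [Module ℂ Z] {m n : ℕ}
  {τ : PluckerIndex m n} {S : L →ₗ⁅ℂ⁆ Module.End ℂ Z} {w : Z}

/-- The projective spectrum of the algebra `W^{[*]}` is the Schubert variety. -/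
theorem SchubertModel.nonempty_iso (M : SchubertModel τ S w) :
    Nonempty (projOver (higherGrading (cyclicRep S w) ⟨w, mem_cyclic_self S w⟩) ≅
      projVariety (echelonCone τ)) := by
  let f : MvPolynomial.homogeneousSubmodule (PluckerIndex m n) ℂ →+*ᵍ
      higherGrading (cyclicRep S w) ⟨w, mem_cyclic_self S w⟩ :=
    { M.ringMap.toRingHom with map_mem := fun hP => M.ringMap_mem hP }
  refine nonempty_projOver_iso (f := f) M.ringMap_surjective (fun c => M.ringMap.commutes c)
    M.isReduced_higherAlgebra (coneClosed (echelonCone τ)) ?_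
  change ProjectiveSpectrum.zeroLocus _ _ = _
  congr 1
  ext P
  exact M.ringMap_eq_zero_iff.symm

end CoordinateRing

/-! ### The combinatorics of the partition -/

section Partition

variable {r : ℕ} {ξ : Fin r → ℕ}

theorem lt_card_filter_iff (hξ : Antitone ξ) {l s : ℕ} :
    s < (Finset.univ.filter fun i => l ≤ ξ i).card ↔ ∃ i : Fin r, (i : ℕ) = s ∧ l ≤ ξ i := by
  constructor
  · intro h
    have hs : s < r := h.trans_le ((Finset.card_filter_le _ _).trans (by simp))
    refine ⟨⟨s, hs⟩, rfl, ?_⟩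
    by_contra hl
    have hsub : (Finset.univ.filter fun i => l ≤ ξ i) ⊆
        Finset.univ.filter fun i : Fin r => (i : ℕ) < s := by
      intro i hi
      rw [Finset.mem_filter] at hi ⊢
      refine ⟨hi.1, ?_⟩
      by_contra his
      exact hl (hi.2.trans (hξ (Fin.le_def.2 (not_lt.1 his))))
    have := Finset.card_le_card hsub
    rw [Fin.card_filter_val_lt] at this
    omega
  · rintro ⟨i, rfl, hi⟩
    have hsub : Finset.Iic i ⊆ Finset.univ.filter fun i => l ≤ ξ i := by
      intro i' hi'
      exact Finset.mem_filter.2 ⟨Finset.mem_univ _, hi.trans (hξ (Finset.mem_Iic.1 hi'))⟩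
    have := Finset.card_le_card hsub
    rw [Fin.card_Iic] at this
    omega

theorem mem_eta_iff (hξ : Antitone ξ) {e : ℕ} :
    e ∈ eta ξ ↔ ∃ (i : Fin r) (l : ℕ), 1 ≤ l ∧ l ≤ ξ i ∧ e = l * r - i := by
  simp only [eta, Finset.mem_biUnion, Finset.mem_Icc, Finset.mem_image, Finset.mem_range,
    lt_card_filter_iff hξ]
  constructor
  · rintro ⟨l, ⟨hl, -⟩, s, ⟨i, rfl, hi⟩, rfl⟩
    exact ⟨i, l, hl, hi, rfl⟩
  · rintro ⟨i, l, hl, hi, rfl⟩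
    exact ⟨l, ⟨hl, hi.trans (Finset.le_sup (Finset.mem_univ i))⟩, i, ⟨i, rfl, hi⟩, rfl⟩

theorem eta_bounds (hξ : Antitone ξ) {e : ℕ} (he : e ∈ eta ξ) :
    1 ≤ e ∧ e ≤ Finset.univ.sup ξ * r := by
  obtain ⟨i, l, hl, hi, rfl⟩ := (mem_eta_iff hξ).1 he
  have h1 : l * r ≤ Finset.univ.sup ξ * r :=
    Nat.mul_le_mul_right r (hi.trans (Finset.le_sup (Finset.mem_univ i)))
  have h2 : r ≤ l * r := Nat.le_mul_of_pos_left r hl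
  have := i.2
  omega

/-- The set `η(ξ)` contains, with a number in the interval `((l - 1) r, l r]`, all larger numbers
of this interval. -/
theorem eta_block (hξ : Antitone ξ) {d : ℕ} (hd : d ∈ eta ξ) :
    ∃ l ≤ Finset.univ.sup ξ, l * r ∈ eta ξ ∧ d ≤ l * r ∧ Finset.Ioc d (l * r) ⊆ eta ξ := by
  obtain ⟨i, l, hl, hi, rfl⟩ := (mem_eta_iff hξ).1 hd
  have h2 : r ≤ l * r := Nat.le_mul_of_pos_left r hl
  have hr := i.2
  have key : ∀ s ≤ (i : ℕ), l * r - s ∈ eta ξ := fun s hs =>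
    (mem_eta_iff hξ).2 ⟨⟨s, hs.trans_lt hr⟩, l, hl, hi.trans (hξ (Fin.le_def.2 hs)), rfl⟩
  refine ⟨l, hi.trans (Finset.le_sup (Finset.mem_univ i)), key 0 (Nat.zero_le _),
    Nat.sub_le _ _, fun x hx => ?_⟩
  rw [Finset.mem_Ioc] at hx
  have := key (l * r - x) (by omega)
  rwa [Nat.sub_sub_self hx.2] at this

/-- The index in the basis `u_1, …, u_{Nr}` of the vector number `q` in the wedge product `v_ξ`. -/
def wedgeIndex (ξ : Fin r → ℕ) (q : Fin (∑ i, ξ i)) : Fin (Finset.univ.sup ξ * r) :=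
  finProdFinEquiv (⟨(finSigmaFinEquiv.symm q).2, (finSigmaFinEquiv.symm q).2.2.trans_le
    (Finset.le_sup (Finset.mem_univ _))⟩, (finSigmaFinEquiv.symm q).1.rev)

theorem uVec_wedgeIndex (q : Fin (∑ i, ξ i)) :
    uVec (wedgeIndex ξ q) =
      loopVec (finSigmaFinEquiv.symm q).1 ((finSigmaFinEquiv.symm q).2 + 1) := by
  simp [uVec, wedgeIndex]

theorem wedgeIndex_injective : Function.Injective (wedgeIndex ξ) := by
  intro p q h
  simp only [wedgeIndex, EmbeddingLike.apply_eq_iff_eq, Prod.mk.injEq, Fin.mk.injEq,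
    Fin.rev_inj] at h
  refine finSigmaFinEquiv.symm.injective ?_
  generalize finSigmaFinEquiv.symm p = x at h
  generalize finSigmaFinEquiv.symm q = y at h
  obtain ⟨a, b⟩ := x
  obtain ⟨c, d⟩ := y
  obtain ⟨h1, rfl⟩ := h
  simp only at h1
  rw [Fin.ext h1]

theorem wedgeIndex_val (q : Fin (∑ i, ξ i)) :
    (wedgeIndex ξ q : ℕ) + 1 =
      ((finSigmaFinEquiv.symm q).2 + 1) * r - (finSigmaFinEquiv.symm q).1 := by
  have := (finSigmaFinEquiv.symm q).1.2
  simp only [wedgeIndex, finProdFinEquiv_apply_val, Fin.val_rev, Nat.add_mul, Nat.mul_comm r]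
  omega

theorem image_wedgeIndex (hξ : Antitone ξ) :
    (Finset.univ.image fun q => (wedgeIndex ξ q : ℕ) + 1) = eta ξ := by
  ext e
  rw [mem_eta_iff hξ, Finset.mem_image]
  constructor
  · rintro ⟨q, -, rfl⟩
    exact ⟨_, _, Nat.le_add_left 1 _, (finSigmaFinEquiv.symm q).2.2, wedgeIndex_val q⟩
  · rintro ⟨i, l, hl, hi, rfl⟩
    refine ⟨finSigmaFinEquiv ⟨i, ⟨l - 1, by omega⟩⟩, Finset.mem_univ _, ?_⟩
    rw [wedgeIndex_val, Equiv.symm_apply_apply]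
    simp [Nat.sub_add_cancel hl]

theorem sum_eq_card_eta (hξ : Antitone ξ) : ∑ i, ξ i = (eta ξ).card := by
  rw [← image_wedgeIndex hξ, Finset.card_image_of_injective, Finset.card_univ, Fintype.card_fin]
  intro p q h
  exact wedgeIndex_injective (Fin.ext (Nat.succ_injective h))

end Partition

/-! ### The action of the current algebra -/

section Action

variable {r : ℕ}

theorem tailX_tailPow (j : ℕ) : tailX (tailPow (j + 1)) = tailPow j := by
  simp only [tailX, tailPow, Submodule.mkQ_apply, Submodule.mapQ_apply, laurentX_T]
  congr 2
  push_cast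
  ring

theorem tailPow_zero : tailPow 0 = 0 :=
  (Submodule.Quotient.mk_eq_zero _).2 (by simpa using T_mem_laurentRegular 0)

theorem tailY_tailPow (j : ℕ) : tailY (tailPow j) = (-(j : ℂ)) • tailPow j := by
  simp only [tailY, tailPow, Submodule.mkQ_apply, Submodule.mapQ_apply, laurentY_T]
  simp

/-- The generator `X` of the algebra `ℂ⟨X, Y⟩`. -/
def currentX : CurrentAlg := RingQuot.mkAlgHom ℂ CurrentRel (FreeAlgebra.ι ℂ 0)

/-- The generator `Y` of the algebra `ℂ⟨X, Y⟩`. -/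
def currentY : CurrentAlg := RingQuot.mkAlgHom ℂ CurrentRel (FreeAlgebra.ι ℂ 1)

theorem tailRep_mk (z : FreeAlgebra ℂ (Fin 2)) :
    tailRep (RingQuot.mkAlgHom ℂ CurrentRel z) = FreeAlgebra.lift ℂ ![tailX, tailY] z :=
  RingQuot.liftAlgHom_mkAlgHom_apply _ _ _ z

theorem tailRep_currentX : tailRep currentX = tailX := by simp [currentX, tailRep_mk]

theorem tailRep_currentY : tailRep currentY = tailY := by simp [currentY, tailRep_mk]

/-- The subspace `t^{-l} ℂ[t] / ℂ[t]`. -/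
def tailFil (l : ℕ) : Submodule ℂ LaurentTail := Submodule.span ℂ (tailPow '' Set.Iic l)

theorem tailPow_mem {j l : ℕ} (h : j ≤ l) : tailPow j ∈ tailFil l :=
  Submodule.subset_span ⟨j, h, rfl⟩

theorem tailRep_mem (z : CurrentAlg) {l : ℕ} {p : LaurentTail} (hp : p ∈ tailFil l) :
    tailRep z p ∈ tailFil l := by
  obtain ⟨z, rfl⟩ := RingQuot.mkAlgHom_surjective ℂ CurrentRel z
  rw [tailRep_mk]
  induction z using FreeAlgebra.induction generalizing p with
  | grade0 c => simpa using (tailFil l).smul_mem c hp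
  | grade1 i =>
    rw [FreeAlgebra.lift_ι_apply]
    have h : tailFil l ≤ (tailFil l).comap (![tailX, tailY] i) := by
      rw [tailFil, Submodule.span_le]
      rintro _ ⟨j, hj, rfl⟩
      change ![tailX, tailY] i (tailPow j) ∈ tailFil l
      fin_cases i
      · change tailX (tailPow j) ∈ _
        rcases j with _ | j
        · rw [tailPow_zero, map_zero]
          exact Submodule.zero_mem _
        · rw [tailX_tailPow]
          exact tailPow_mem ((Nat.le_succ j).trans hj)
      · change tailY (tailPow j) ∈ _
        rw [tailY_tailPow]
        exact Submodule.smul_mem _ _ (tailPow_mem hj)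
    exact h hp
  | mul a b ha hb =>
    rw [map_mul, Module.End.mul_apply]
    exact ha (hb hp)
  | add a b ha hb =>
    rw [map_add, LinearMap.add_apply]
    exact Submodule.add_mem _ (ha hp) (hb hp)

/-- The inclusion of `U = V ⊗ (t^{-N} ℂ[t] / ℂ[t])` with the basis `u_1, …, u_{Nr}`. -/
def uIncl (N r : ℕ) : (Fin (N * r) → ℂ) →ₗ[ℂ] LoopTail r :=
  Fintype.linearCombination ℂ uVec

theorem uIncl_single {N r : ℕ} (q : Fin (N * r)) : uIncl N r (Pi.single q 1) = uVec q := by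
  simp [uIncl, Fintype.linearCombination_apply_single]

/-- The coordinates with respect to the basis `u_1, …, u_{Nr}`, extended to
`V ⊗ ℂ[t, t⁻¹] / ℂ[t]`. -/
def uCoords (N r : ℕ) : LoopTail r →ₗ[ℂ] (Fin (N * r) → ℂ) := LinearMap.pi uCoord

theorem uCoords_uIncl {N : ℕ} (v : Fin (N * r) → ℂ) : uCoords N r (uIncl N r v) = v := by
  funext p
  simp [uCoords, uIncl, Fintype.linearCombination_apply, uCoord_uVec]

theorem uMatrix_mulVec {N : ℕ} (a : CurrentLie r) (v : Fin (N * r) → ℂ) :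
    (uMatrix N a).mulVec v = uCoords N r (loopRep r a (uIncl N r v)) := by
  funext p
  simp [uCoords, uIncl, Fintype.linearCombination_apply, uMatrix, Matrix.mulVec, dotProduct,
    mul_comm]

/-- The subspace `V ⊗ (t^{-l} ℂ[t] / ℂ[t])` is spanned by `u_1, …, u_{lr}`. -/
theorem tmul_mem_flag {N l : ℕ} (hl : l ≤ N) (v : Fin r → ℂ) {p : LaurentTail}
    (hp : p ∈ tailFil l) : v ⊗ₜ[ℂ] p ∈ (flag (N * r) (l * r)).map (uIncl N r) := by
  induction hp using Submodule.span_induction with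
  | zero => rw [TensorProduct.tmul_zero]; exact Submodule.zero_mem _
  | add p q _ _ hp hq => rw [TensorProduct.tmul_add]; exact Submodule.add_mem _ hp hq
  | smul c p _ hp => rw [TensorProduct.tmul_smul]; exact Submodule.smul_mem _ c hp
  | mem p hp =>
    obtain ⟨j, hj, rfl⟩ := hp
    rcases j with _ | j
    · rw [tailPow_zero, TensorProduct.tmul_zero]
      exact Submodule.zero_mem _
    · have hj' : j + 1 ≤ l := hj
      rw [← Finset.univ_sum_single v, TensorProduct.sum_tmul]
      refine Submodule.sum_mem _ fun i _ => ?_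
      rw [show (Pi.single i (v i) : Fin r → ℂ) = v i • Pi.single i 1 by
        rw [← Pi.single_smul, smul_eq_mul, mul_one], ← TensorProduct.smul_tmul']
      refine Submodule.smul_mem _ _ ?_
      let q : Fin (N * r) := finProdFinEquiv (⟨j, by omega⟩, i.rev)
      refine ⟨Pi.single q 1, Submodule.subset_span ⟨q, ?_, rfl⟩, ?_⟩
      · have h1 : (j + 1) * r ≤ l * r := Nat.mul_le_mul_right r hj'
        have := i.rev.2
        simp only [Set.mem_ofPred_eq, q, finProdFinEquiv_apply_val]
        rw [Nat.add_mul] at h1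
        rw [Nat.mul_comm r]
        omega
      · rw [uIncl_single]
        simp [uVec, loopVec, q]

theorem loopRep_mem_flag {N l : ℕ} (hl : l ≤ N) (a : CurrentLie r) {v : Fin (N * r) → ℂ}
    (hv : v ∈ flag (N * r) (l * r)) :
    loopRep r a (uIncl N r v) ∈ (flag (N * r) (l * r)).map (uIncl N r) := by
  induction hv using Submodule.span_induction with
  | zero => rw [map_zero, map_zero]; exact Submodule.zero_mem _
  | add p q _ _ hp hq => rw [map_add, map_add]; exact Submodule.add_mem _ hp hq
  | smul c p _ hp => rw [map_smul, map_smul]; exact Submodule.smul_mem _ c hp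
  | mem p hp =>
    obtain ⟨q, hq, rfl⟩ := hp
    simp only [uIncl_single]
    induction a using TensorProduct.induction_on with
    | zero => rw [map_zero]; exact Submodule.zero_mem _
    | add a b ha hb => rw [map_add]; exact Submodule.add_mem _ ha hb
    | tmul A z =>
      rw [uVec, loopVec, loopRep_tmul]
      refine tmul_mem_flag hl _ (tailRep_mem z (tailPow_mem ?_))
      obtain ⟨⟨j, i⟩, rfl⟩ := finProdFinEquiv.surjective q
      simp only [Set.mem_ofPred_eq, finProdFinEquiv_apply_val] at hq
      simp only [Equiv.symm_apply_apply]
      have : r * (j : ℕ) < r * l := by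
        rw [Nat.mul_comm r l]
        omega
      exact Nat.lt_of_mul_lt_mul_left this

theorem uIncl_uMatrix {N : ℕ} (a : CurrentLie r) (v : Fin (N * r) → ℂ) :
    uIncl N r ((uMatrix N a).mulVec v) = loopRep r a (uIncl N r v) := by
  obtain ⟨v', -, h⟩ := loopRep_mem_flag le_rfl a (v := v) (mem_flag.2 fun q hq =>
    absurd q.2 (not_lt.2 hq))
  rw [uMatrix_mulVec, ← h, uCoords_uIncl]

theorem uMatrix_mem_flag {N l : ℕ} (hl : l ≤ N) (a : CurrentLie r) {v : Fin (N * r) → ℂ}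
    (hv : v ∈ flag (N * r) (l * r)) : (uMatrix N a).mulVec v ∈ flag (N * r) (l * r) := by
  obtain ⟨v', hv', h⟩ := loopRep_mem_flag hl a hv
  rwa [uMatrix_mulVec, ← h, uCoords_uIncl]

theorem pow_tailX_tailPow (d j : ℕ) : (tailX ^ d) (tailPow (j + d)) = tailPow j := by
  induction d with
  | zero => simp
  | succ d ih => rw [pow_succ, Module.End.mul_apply, ← add_assoc, tailX_tailPow, ih]

theorem aeval_tailY_tailPow (P : Polynomial ℂ) (j : ℕ) :
    Polynomial.aeval tailY P (tailPow j) = P.eval (-(j : ℂ)) • tailPow j := by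
  have hpow : ∀ k : ℕ, (tailY ^ k) (tailPow j) = (-(j : ℂ)) ^ k • tailPow j := fun k => by
    induction k with
    | zero => simp
    | succ k ih => rw [pow_succ', Module.End.mul_apply, ih, map_smul, tailY_tailPow, smul_smul,
        pow_succ]
  induction P using Polynomial.induction_on' with
  | add P Q hP hQ => rw [map_add, LinearMap.add_apply, hP, hQ, Polynomial.eval_add, add_smul]
  | monomial k c =>
    rw [Polynomial.aeval_monomial, Module.End.mul_apply, hpow, Module.algebraMap_end_apply,
      smul_smul, Polynomial.eval_monomial]

/-- The matrix units above the diagonal are realized by the products of a matrix unit with a power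
of `X` and with a Lagrange interpolation polynomial in `Y`. -/
theorem exists_uMatrix_single {N : ℕ} {p q : Fin (N * r)} (h : p < q) :
    ∃ a : CurrentLie r, ∀ v, (uMatrix N a).mulVec v = v q • Pi.single p 1 := by
  obtain ⟨⟨j', i'⟩, rfl⟩ := finProdFinEquiv.surjective p
  obtain ⟨⟨j, i⟩, rfl⟩ := finProdFinEquiv.surjective q
  have hj : j' ≤ j := by
    by_contra hj
    rw [Fin.lt_def, finProdFinEquiv_apply_val, finProdFinEquiv_apply_val] at h
    have h1 : r * (j + 1 : ℕ) ≤ r * j' := Nat.mul_le_mul_left r (by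
      have := Fin.lt_def.1 (not_le.1 hj)
      omega)
    have := i.2
    rw [Nat.mul_add] at h1
    simp only at h
    omega
  -- `P(Y)` is the projection to `t^{-(j+1)}`, because `Y` has the eigenvalue `-(l+1)` on `t^{-(l+1)}`.
  let P : Polynomial ℂ := Lagrange.basis Finset.univ (fun l : Fin N => -((l + 1 : ℕ) : ℂ)) j
  have hinj : Function.Injective fun l : Fin N => -((l + 1 : ℕ) : ℂ) := fun a b hab => by
    simpa [Fin.val_inj] using hab
  refine ⟨Matrix.single i'.rev i.rev 1 ⊗ₜ[ℂ]
    (currentX ^ ((j : ℕ) - j') * Polynomial.aeval currentY P), fun v => ?_⟩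
  have key : ∀ l : Fin N, ∀ k : Fin r,
      loopRep r (Matrix.single i'.rev i.rev 1 ⊗ₜ[ℂ]
        (currentX ^ ((j : ℕ) - j') * Polynomial.aeval currentY P))
        (uVec (finProdFinEquiv (l, k))) =
      if finProdFinEquiv (l, k) = finProdFinEquiv (j, i) then uVec (finProdFinEquiv (j', i'))
        else 0 := by
    intro l k
    have h1 : tailRep (currentX ^ ((j : ℕ) - j') * Polynomial.aeval currentY P)
        (tailPow (l + 1)) = if l = j then tailPow (j' + 1) else 0 := by
      rw [map_mul, map_pow, tailRep_currentX, ← Polynomial.aeval_algHom_apply, tailRep_currentY,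
        Module.End.mul_apply, aeval_tailY_tailPow, map_smul]
      split_ifs with hl
      · rw [hl, Lagrange.eval_basis_self hinj.injOn (Finset.mem_univ j), one_smul]
        have := pow_tailX_tailPow ((j : ℕ) - j') (j' + 1)
        rwa [show (j' : ℕ) + 1 + (j - j') = j + 1 by
          have := Fin.le_def.1 hj
          omega] at this
      · have h0 : P.eval (-((l + 1 : ℕ) : ℂ)) = 0 :=
          Lagrange.eval_basis_of_ne (v := fun l : Fin N => -((l + 1 : ℕ) : ℂ)) (Ne.symm hl)
            (Finset.mem_univ l)
        rw [h0, zero_smul]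
    have h2 : (Matrix.single i'.rev i.rev (1 : ℂ)).mulVec (Pi.single k.rev 1) =
        if k = i then Pi.single i'.rev 1 else 0 := by
      funext x
      split_ifs with hk
      · subst hk
        simp [Matrix.single_apply, Pi.single_apply, eq_comm]
      · have : i.rev ≠ k.rev := fun e => hk (Fin.rev_inj.1 e).symm
        simp [this]
    simp only [uVec, loopVec, Equiv.symm_apply_apply, loopRep_tmul, h1, h2,
      EmbeddingLike.apply_eq_iff_eq, Prod.mk.injEq]
    by_cases hl : l = j <;> by_cases hk : k = i <;> simp [hl, hk]
  rw [uMatrix_mulVec, uIncl, Fintype.linearCombination_apply, map_sum, map_sum,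
    Finset.sum_eq_single (finProdFinEquiv (j, i))]
  · rw [map_smul, map_smul, key, if_pos rfl, ← uIncl_single, uCoords_uIncl]
  · intro q _ hq
    obtain ⟨⟨l, k⟩, rfl⟩ := finProdFinEquiv.surjective q
    rw [map_smul, key, if_neg hq, smul_zero, map_zero]
  · simp

/-- The strictly triangular matrices with one nonzero column are realized by the current algebra. -/
theorem exists_uMatrix_transvection {N : ℕ} (q : Fin (N * r)) (u : Fin (N * r) → ℂ)
    (hu : ∀ p, q ≤ p → u p = 0) :
    ∃ a : CurrentLie r, ∀ v, (uMatrix N a).mulVec v = v q • u := by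
  have h : ∀ p, ∃ a : CurrentLie r, ∀ v, (uMatrix N a).mulVec v = (v q * u p) • Pi.single p 1 := by
    intro p
    rcases lt_or_ge p q with hp | hp
    · obtain ⟨a, ha⟩ := exists_uMatrix_single hp
      refine ⟨u p • a, fun v => ?_⟩
      have := ha v
      rw [uMatrix_mulVec] at this ⊢
      rw [map_smul, LinearMap.smul_apply, map_smul, this, smul_smul, mul_comm (u p)]
    · refine ⟨0, fun v => ?_⟩
      rw [uMatrix_mulVec, map_zero, LinearMap.zero_apply, map_zero, hu p hp, mul_zero, zero_smul]
  choose a ha using h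
  refine ⟨∑ p, a p, fun v => ?_⟩
  have h1 := fun p => ha p v
  simp only [uMatrix_mulVec] at h1 ⊢
  rw [map_sum, LinearMap.sum_apply, map_sum, Finset.sum_congr rfl fun p _ => h1 p]
  conv_rhs => rw [← Finset.univ_sum_single u, Finset.smul_sum]
  refine Finset.sum_congr rfl fun p _ => ?_
  rw [← Pi.single_smul, ← Pi.single_smul, smul_eq_mul, smul_eq_mul, mul_one]

end Action

/-! ### The Schubert model of `V_ξ` -/

section Model

variable {r : ℕ} {ξ : Fin r → ℕ}

/-- The position `{η₁ < ⋯ < ηₙ}` of the Plücker coordinate that is highest on the Schubert variety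
attached to `ξ`. -/
abbrev etaIndex (hξ : Antitone ξ) : PluckerIndex (Finset.univ.sup ξ * r) (eta ξ).card :=
  shiftIndex (Finset.univ.sup ξ * r) (eta ξ) fun _ he => eta_bounds hξ he

theorem etaCone_eq (hξ : Antitone ξ) : etaCone ξ = echelonCone (etaIndex hξ) := schubertCone_eq _

/-- The wedge product of vectors of `U`, in `⋀ⁿ (V ⊗ ℂ[t, t⁻¹] / ℂ[t])`. -/
def wedgeForm (hξ : Antitone ξ) :
    (Fin (Finset.univ.sup ξ * r) → ℂ) [⋀^Fin (eta ξ).card]→ₗ[ℂ] Wedge r (∑ i, ξ i) :=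
  (((exteriorPower.ιMulti ℂ (∑ i, ξ i) :
      LoopTail r [⋀^Fin (∑ i, ξ i)]→ₗ[ℂ] ⋀[ℂ]^(∑ i, ξ i) (LoopTail r)).compLinearMap
    (uIncl (Finset.univ.sup ξ) r)).domDomCongr (finCongr (sum_eq_card_eta hξ)) :)

theorem wedgeForm_apply (hξ : Antitone ξ)
    (a : Fin (eta ξ).card → Fin (Finset.univ.sup ξ * r) → ℂ) :
    wedgeForm hξ a = exteriorPower.ιMulti ℂ (∑ i, ξ i)
      fun q => uIncl _ r (a (finCongr (sum_eq_card_eta hξ) q)) := rfl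

/-- The Plücker coordinates on `⋀ⁿ U`, extended to `⋀ⁿ (V ⊗ ℂ[t, t⁻¹] / ℂ[t])` by means of the
coordinates `uCoords`. -/
def wedgeCoord (hξ : Antitone ξ) : Wedge r (∑ i, ξ i) →ₗ[ℂ]
    (PluckerIndex (Finset.univ.sup ξ * r) (eta ξ).card → ℂ) :=
  LinearMap.pi fun I => exteriorPower.alternatingMapLinearEquiv
    (((pluckerForm I).compLinearMap (uCoords _ r)).domDomCongr
      (finCongr (sum_eq_card_eta hξ)).symm)

theorem wedgeCoord_wedgeForm (hξ : Antitone ξ)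
    (a : Fin (eta ξ).card → Fin (Finset.univ.sup ξ * r) → ℂ) :
    wedgeCoord hξ (wedgeForm hξ a) = plucker a := by
  funext I
  rw [wedgeForm_apply]
  refine (exteriorPower.alternatingMapLinearEquiv_apply_ιMulti _ _).trans ?_
  rw [AlternatingMap.domDomCongr_apply, AlternatingMap.compLinearMap_apply, ← pluckerForm_apply]
  congr 1
  funext i
  simp [uCoords_uIncl]

theorem wedgeRep_wedgeForm (hξ : Antitone ξ) (a : CurrentLie r)
    (v : Fin (eta ξ).card → Fin (Finset.univ.sup ξ * r) → ℂ) :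
    wedgeRep r (∑ i, ξ i) a (wedgeForm hξ v) =
      ∑ i, wedgeForm hξ (Function.update v i ((uMatrix _ a).mulVec (v i))) := by
  rw [wedgeForm_apply]
  refine (exteriorDer_ιMulti _ (loopRep r a) _).trans ?_
  refine Fintype.sum_equiv (finCongr (sum_eq_card_eta hξ)) _ _ fun q => ?_
  rw [wedgeForm_apply]
  congr 1
  funext p
  rcases eq_or_ne p q with rfl | h
  · rw [Function.update_self, Function.update_self, uIncl_uMatrix]
  · rw [Function.update_of_ne h, Function.update_of_ne ((Equiv.injective _).ne h)]

/-- Up to sign, `v_ξ` is the wedge product of the basis vectors `u_e`, `e ∈ η(ξ)`. -/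
theorem exists_wedgeVec_eq (hξ : Antitone ξ) :
    ∃ c : ℂ, c ≠ 0 ∧
      wedgeVec ξ = c • wedgeForm hξ fun i => Pi.single ((etaIndex hξ).emb i) 1 := by
  have hσ := sum_eq_card_eta hξ
  obtain ⟨I, π, h⟩ := exists_emb_comp_perm (wedgeIndex ξ ∘ (finCongr hσ).symm)
    (wedgeIndex_injective.comp (Equiv.injective _))
  have hI : I = etaIndex hξ := by
    refine Subtype.ext (Finset.eq_of_subset_of_card_le (fun q hq => ?_) ?_)
    · obtain ⟨i, rfl⟩ := (I.mem_iff q).1 hq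
      refine Finset.mem_filter.2 ⟨Finset.mem_univ _, ?_⟩
      refine (image_wedgeIndex hξ).subset (Finset.mem_image.2 ⟨(finCongr hσ).symm (π.symm i), Finset.mem_univ _, ?_⟩)
      have := congrFun h (π.symm i)
      simp only [Function.comp_apply, Equiv.apply_symm_apply] at this
      rw [this]
    · rw [I.2, (etaIndex hξ).2]
  subst hI
  refine ⟨((Equiv.Perm.sign π : ℤ) : ℂ), by
    rcases Int.units_eq_one_or (Equiv.Perm.sign π) with h | h <;> simp [h], ?_⟩
  have hw : wedgeVec ξ =
      wedgeForm hξ ((fun i => Pi.single ((etaIndex hξ).emb i) 1) ∘ π) := by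
    rw [wedgeForm_apply]
    refine congrArg (exteriorPower.ιMulti ℂ (∑ i, ξ i)) (funext fun q => ?_)
    have := congrFun h (finCongr hσ q)
    simp only [Function.comp_apply, Equiv.symm_apply_apply] at this
    rw [Function.comp_apply, ← this, uIncl_single, uVec_wedgeIndex]
  rw [hw, AlternatingMap.map_perm, Units.smul_def, Int.cast_smul_eq_zsmul]

/-- The action of the one-parameter subgroups preserves the Schubert cone: every `d ∈ η(ξ)` lies
in a block `d, …, lr` of consecutive elements of `η(ξ)`, and the subspace `⟨u_1, …, u_{lr}⟩`
is invariant. -/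
theorem compound_exp_mem_etaCone (hξ : Antitone ξ) (a : CurrentLie r) (t : ℂ)
    {x : PluckerIndex (Finset.univ.sup ξ * r) (eta ξ).card → ℂ} (hx : x ∈ etaCone ξ) :
    compound (NormedSpace.exp (-(t • uMatrix (Finset.univ.sup ξ) a))) x ∈ etaCone ξ := by
  refine compound_mem_schubertCone (Matrix.isUnit_exp _) (fun d hd => ?_) hx
  obtain ⟨l, hl, h1, h2, h3⟩ := eta_block hξ hd
  refine ⟨l * r, h1, h2, h3, Nat.mul_le_mul_right r hl, fun v hv => exp_mulVec_mem ?_ hv⟩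
  intro u hu
  rw [Matrix.neg_mulVec, Matrix.smul_mulVec]
  exact Submodule.neg_mem _ (Submodule.smul_mem _ _ (uMatrix_mem_flag hl a hu))

theorem nonempty_schubertModel (hξ : Antitone ξ) :
    Nonempty {M : SchubertModel (etaIndex hξ) (wedgeRep r (∑ i, ξ i)) (wedgeVec ξ) //
      M.mat = uMatrix (Finset.univ.sup ξ)} := by
  obtain ⟨c, hc, hw⟩ := exists_wedgeVec_eq hξ
  exact ⟨{
    form := wedgeForm hξ
    coord := wedgeCoord hξ
    mat := uMatrix (Finset.univ.sup ξ)
    scalar := c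
    coord_form := wedgeCoord_wedgeForm hξ
    act_form := wedgeRep_wedgeForm hξ
    scalar_ne_zero := hc
    gen_eq := hw
    stable := fun a t x hx => by
      rw [← etaCone_eq] at hx ⊢
      exact compound_exp_mem_etaCone hξ a t hx
    transvection := fun i u hu => exists_uMatrix_transvection _ u hu }, rfl⟩

end Model

end HigherLevel

end

theorem proposition3p3 (r : ℕ) (ξ : Fin r → ℕ) (hξ : Antitone ξ) :
    (∀ k : ℕ, ∃ Φ : HigherLevel.VHigher ξ k ≃ₗ[ℂ]
        Module.Dual ℂ (HigherLevel.sections (HigherLevel.etaCone ξ) k),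
      ∀ (a : HigherLevel.CurrentLie r) (s : HigherLevel.sections (HigherLevel.etaCone ξ) k),
        ∃ s' : HigherLevel.sections (HigherLevel.etaCone ξ) k,
          HigherLevel.IsLieAction (HigherLevel.uMatrix (Finset.univ.sup ξ) a) s.1 s'.1 ∧
          ∀ v : HigherLevel.VHigher ξ k, Φ (HigherLevel.VHigherRep ξ k a v) s = - Φ v s') ∧
    Nonempty (HigherLevel.projOver
        (HigherLevel.higherGrading (HigherLevel.VRep ξ) (HigherLevel.VGen ξ)) ≅
      HigherLevel.projVariety (HigherLevel.etaCone ξ)) := by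
  obtain ⟨M, hM⟩ := HigherLevel.nonempty_schubertModel hξ
  rw [HigherLevel.etaCone_eq hξ, ← hM]
  exact ⟨fun k => M.exists_equiv k, M.nonempty_iso⟩
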